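/- Let $\mathit{Atm}=\{p_0,p_1,\dots\}$ be a countable (finite or infinite) set of atomic propositions and let $\mathit{Agt}=\{1,\dots,n\}$, $n\ge 0$, be a finite set of agents. A \emph{spatial model} is a pair $M=(P,V)$ with $P:\mathit{Agt}\to\mathbb Z\times\mathbb Z$ and $V:\mathbb Z\times\mathbb Z\to 2^{\mathit{Atm}}$. Star-free programs $\alpha$ and formulas $\varphi$ are given by $$\alpha ::= {\Uparrow}\mid{\Downarrow}\mid{\Rightarrow}\mid{\Leftarrow}\mid \alpha;\alpha'\mid\alpha\cup\alpha'\mid\varphi?\qquad \varphi ::= p\mid h_i\mid\neg\varphi\mid\varphi\wedge\psi\mid[\alpha]\varphi\qquad(p\in\mathit{Atm},\ i\in\mathit{Agt}).$$ In a model $M$, the programs ${\Uparrow},{\Downarrow},{\Rightarrow},{\Leftarrow}$ denote the relations that lead from $(x,y)$ to $(x,y+1)$, $(x,y-1)$, $(x+1,y)$, $(x-1,y)$ respectively, $;$ denotes composition of relations, $\cup$ denotes union, and $\varphi?$ is the identity relation on the positions where $\varphi$ is true. At a position $u\in\mathbb Z\times\mathbb Z$, the formula $p$ is true iff $p\in V(u)$,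 $h_i$ is true iff $P(i)=u$, the Boolean connectives are read as usual, and $[\alpha]\varphi$ is true at $u$ iff $\varphi$ is true at every $v$ to which $\alpha$ leads from $u$. A formula is \emph{valid} if it is true at every position of every spatial model, and \emph{satisfiable} if its negation is not valid. Let $\mathsf{DL\text{-}S}^1$ be the set of valid formulas of this language, and let $\mathsf{DL\text{-}S}^0$ be the set of valid formulas of the sublanguage in which the only programs are ${\Uparrow},{\Downarrow},{\Rightarrow},{\Leftarrow}$. Formulas are written as strings over a finite alphabet, with the indices of atomic propositions in binary. \textbf{Theorem.} The sets $\mathsf{DL\text{-}S}^0$ and $\mathsf{DL\text{-}S}^1$ are decidable. Moreover, the satisfiability problem for formulas of the language of $\mathsf{DL\text{-}S}^0$ is in NP. -/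

import Mathlib

namespace SpatialLogic

/-! ### Syntax -/

mutual

/-- Spatial programs over atomic propositions `Atm` and agents `Agt`. -/
inductive Prog (Atm Agt : Type) : Type
  | up : Prog Atm Agt
  | down : Prog Atm Agt
  | right : Prog Atm Agt
  | left : Prog Atm Agt
  | seq : Prog Atm Agt → Prog Atm Agt → Prog Atm Agt
  | choice : Prog Atm Agt → Prog Atm Agt → Prog Atm Agt
  | iter : Prog Atm Agt → Prog Atm Agt
  | test : Form Atm Agt → Prog Atm Agt

/-- Formulas over atomic propositions `Atm` and agents `Agt`. -/
inductive Form (Atm Agt : Type) : Type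
  | atom : Atm → Form Atm Agt
  | here : Agt → Form Atm Agt
  | neg : Form Atm Agt → Form Atm Agt
  | and : Form Atm Agt → Form Atm Agt → Form Atm Agt
  | box : Prog Atm Agt → Form Atm Agt → Form Atm Agt

end

variable {Atm Agt : Type}

mutual

/-- Programs without iteration (also inside tests). -/
def Prog.StarFree : Prog Atm Agt → Prop
  | .up => True
  | .down => True
  | .right => True
  | .left => True
  | .seq α β => α.StarFree ∧ β.StarFree
  | .choice α β => α.StarFree ∧ β.StarFree
  | .iter _ => False
  | .test φ => φ.StarFree

/-- The formulas of the star-free language, that is, of `DL-S¹`. -/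
def Form.StarFree : Form Atm Agt → Prop
  | .atom _ => True
  | .here _ => True
  | .neg φ => φ.StarFree
  | .and φ ψ => φ.StarFree ∧ ψ.StarFree
  | .box α φ => α.StarFree ∧ φ.StarFree

end

/-- The four basic directions. -/
def Prog.IsDirection : Prog Atm Agt → Prop
  | .up => True
  | .down => True
  | .right => True
  | .left => True
  | _ => False

/-- The formulas of `DL-S⁰`: every program in them is one of the four basic directions. -/
def Form.Basic : Form Atm Agt → Prop
  | .atom _ => True
  | .here _ => True
  | .neg φ => φ.Basic
  | .and φ ψ => φ.Basic ∧ ψ.Basic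
  | .box α φ => α.IsDirection ∧ φ.Basic

/-! ### Semantics -/

/-- A spatial model: positions of the agents in the grid, and the facts true at each position. -/
structure SpatialModel (Atm Agt : Type) : Type where
  P : Agt → ℤ × ℤ
  V : ℤ × ℤ → Set Atm

mutual

/-- `α.Rel M u v`: position `v` is accessible from position `u` by the program `α`. -/
def Prog.Rel (M : SpatialModel Atm Agt) : Prog Atm Agt → ℤ × ℤ → ℤ × ℤ → Prop
  | .up => fun u v => v.1 = u.1 ∧ v.2 = u.2 + 1
  | .down => fun u v => v.1 = u.1 ∧ v.2 = u.2 - 1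
  | .right => fun u v => v.1 = u.1 + 1 ∧ v.2 = u.2
  | .left => fun u v => v.1 = u.1 - 1 ∧ v.2 = u.2
  | .seq α β => fun u v => ∃ w, α.Rel M u w ∧ β.Rel M w v
  | .choice α β => fun u v => α.Rel M u v ∨ β.Rel M u v
  | .iter α => Relation.ReflTransGen (α.Rel M)
  | .test φ => fun u v => u = v ∧ φ.Holds M u

/-- `φ.Holds M u`: the formula `φ` is true at position `u` of `M`. -/
def Form.Holds (M : SpatialModel Atm Agt) : Form Atm Agt → ℤ × ℤ → Prop
  | .atom p => fun u => p ∈ M.V u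
  | .here i => fun u => M.P i = u
  | .neg φ => fun u => ¬ φ.Holds M u
  | .and φ ψ => fun u => φ.Holds M u ∧ ψ.Holds M u
  | .box α φ => fun u => ∀ v, α.Rel M u v → φ.Holds M v

end

/-- Validity: truth at every position of every spatial model. -/
def Form.Valid (φ : Form Atm Agt) : Prop :=
  ∀ (M : SpatialModel Atm Agt) (u : ℤ × ℤ), φ.Holds M u

/-- A formula is satisfiable if its negation is not valid. -/
def Form.Satisfiable (φ : Form Atm Agt) : Prop :=
  ¬ (Form.neg φ).Valid

/-! ### Formulas as strings over a finite alphabet -/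

/-- The countable set of atomic propositions `p₀, p₁, …` with `N ≤ ∞` elements. -/
abbrev Atom (N : ℕ∞) : Type := {k : ℕ // (k : ℕ∞) < N}

/-- The symbols used to write formulas, apart from those for the agents. -/
inductive Tok : Type
  | up | down | right | left | seq | choice | iter | test
  | atom | zero | one | neg | and | box
  deriving DecidableEq

/-- A numbering of the symbols. -/
def Tok.equivFin : Tok ≃ Fin 14 where
  toFun
    | .up => 0 | .down => 1 | .right => 2 | .left => 3
    | .seq => 4 | .choice => 5 | .iter => 6 | .test => 7
    | .atom => 8 | .zero => 9 | .one => 10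
    | .neg => 11 | .and => 12 | .box => 13
  invFun := ![.up, .down, .right, .left, .seq, .choice, .iter, .test,
    .atom, .zero, .one, .neg, .and, .box]
  left_inv t := by cases t <;> rfl
  right_inv i := by fin_cases i <;> rfl

instance : Fintype Tok := Fintype.ofEquiv (Fin 14) Tok.equivFin.symm

instance : Primcodable Tok := Primcodable.ofEquiv (Fin 14) Tok.equivFin

/-- The finite alphabet for formulas with `n` agents: one symbol for each agent `i : Fin n`
(standing for the formula "agent `i` is here") in addition to the symbols of `Tok`. -/
abbrev Sym (n : ℕ) : Type := Tok ⊕ Fin n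

/-- The symbol for a binary digit. -/
def Tok.bit (b : Bool) : Tok := if b then .one else .zero

mutual

/-- Programs written in prefix notation. -/
def Prog.encode {N : ℕ∞} {n : ℕ} : Prog (Atom N) (Fin n) → List (Sym n)
  | .up => [.inl .up]
  | .down => [.inl .down]
  | .right => [.inl .right]
  | .left => [.inl .left]
  | .seq α β => .inl .seq :: (α.encode ++ β.encode)
  | .choice α β => .inl .choice :: (α.encode ++ β.encode)
  | .iter α => .inl .iter :: α.encode
  | .test φ => .inl .test :: φ.encode

/-- Formulas written in prefix notation; the index of an atomic proposition is written in
binary, least significant digit first. -/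
def Form.encode {N : ℕ∞} {n : ℕ} : Form (Atom N) (Fin n) → List (Sym n)
  | .atom p => .inl .atom :: (Nat.bits p.1).map (fun b => .inl (Tok.bit b))
  | .here i => [.inr i]
  | .neg φ => .inl .neg :: φ.encode
  | .and φ ψ => .inl .and :: (φ.encode ++ ψ.encode)
  | .box α φ => .inl .box :: (α.encode ++ φ.encode)

end

/-- `DL-S⁰`: the valid formulas of the basic language, as a set of strings. -/
def DLS0 (N : ℕ∞) (n : ℕ) : Set (List (Sym n)) :=
  {s | ∃ φ : Form (Atom N) (Fin n), φ.Basic ∧ φ.Valid ∧ φ.encode = s}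

/-- `DL-S¹`: the valid formulas of the star-free language, as a set of strings. -/
def DLS1 (N : ℕ∞) (n : ℕ) : Set (List (Sym n)) :=
  {s | ∃ φ : Form (Atom N) (Fin n), φ.StarFree ∧ φ.Valid ∧ φ.encode = s}

/-- The satisfiability problem of `DL-S⁰`: the satisfiable formulas of the basic language, as a
set of strings. -/
def SatDLS0 (N : ℕ∞) (n : ℕ) : Set (List (Sym n)) :=
  {s | ∃ φ : Form (Atom N) (Fin n), φ.Basic ∧ φ.Satisfiable ∧ φ.encode = s}

/-! ### Decidability and the class NP -/

/-- A set of strings is decidable if membership in it is a computable predicate. -/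
def IsDecidable {Γ : Type} [Primcodable Γ] (L : Set (List Γ)) : Prop :=
  ComputablePred fun s : List Γ => s ∈ L

/-- An input string followed by a certificate, as one string over the disjoint union of the two
alphabets. -/
def encodePair {Γ C : Type} (x : List Γ × List C) : List (Γ ⊕ C) :=
  x.1.map Sum.inl ++ x.2.map Sum.inr

/-- A set `L` of strings is in NP if there are a relation `R` between strings and certificates
(strings over some finite alphabet), decided by a Turing machine in polynomial time, and a
polynomial `p`, such that `x ∈ L` if and only if `R x w` for some certificate `w` of length at
most `p |x|`. -/
def InNP {Γ : Type} (L : Set (List Γ)) : Prop :=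
  ∃ (C : Type) (_ : Fintype C) (R : List Γ × List C → Bool) (p : Polynomial ℕ),
    Nonempty (Turing.TM2ComputableInPolyTime encodePair Computability.encodeBool R) ∧
    ∀ x : List Γ, x ∈ L ↔ ∃ w : List C, w.length ≤ p.eval x.length ∧ R (x, w) = true

end SpatialLogic

namespace SpatialLogic

set_option linter.unusedSectionVars false

/-! ### Nondeterministic prefix rewriting on several stacks -/

-- Two independent arguments prove the theorem.
--
-- Decidability. Without iteration a program makes only finitely many displacements, each guarded by
-- literals evaluated at fixed displacements from the start. Every star-free program therefore has a
-- finite disjunctive normal form whose clauses carry a displacement. Composition, union and "no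
-- transition exists" are computable on normal forms, and a formula is treated as its test program,
-- so `[α]φ` becomes "no transition of `α; (¬φ)?`". A clause is unsatisfiable exactly when two of
-- its literals conflict: opposite signs at the same place, or one agent at two places
-- (`exists_sat_of_no_conflict`). Hence validity is a finite check on the negated normal form
-- (`Dnf.total_iff`), and everything is primitive recursive, including the right-to-left parser
-- (`mem_DLS1_iff`). The basic language is the part of the star-free one whose strings avoid three
-- symbols (`mem_DLS0_iff`).
--
-- Membership in NP. For a basic formula of length m, truth at u depends only on at most m pairs
-- (position, atom), all within distance m of u. A certificate could list their truth values, but it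
-- must be checked by a very simple device: a system of prefix-rewriting rules on stacks. The
-- certificate is a sequence of rules, and a Turing machine with the same stacks replays it in
-- linear time (`StackSystem.replay_polyTime`, `StackSystem.inNP`). The rules first guess a model on
-- tapes and then evaluate the formula in it.
--
-- The truth value of atom k at (x, y) is stored in a single list, at the index given by a linear
-- form with natural coefficients in x, y and the binary digits of k. The coefficients are
-- themselves guessed, in unary: moving to the next cell of an axis, or reading a digit 1, shifts
-- the head of the value list by the matching amount. Whatever is guessed defines a genuine model,
-- colliding indices included, so acceptance is sound (`tabSystem_sound`). Conversely, at most m²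
-- differences of distinct pairs have to be kept away from zero, and a greedy choice of coefficients
-- not exceeding m² does this (`exists_separating`). All tapes then have polynomial length, and a
-- satisfying model yields a run of length O(m⁴) (`tabSystem_complete`).

/-- A rule of a stack system: in state `src`, if every stack `k` starts with `pre k`, replace
these prefixes by `post k` and go to state `dst`. -/
structure StackRule (S K A : Type) where
  src : S
  dst : S
  pre : K → List A
  post : K → List A

/-- A system of stack rules indexed by `C`, reading words over `Γ`. Initially the stacks hold
`base`, with the reversed input put on top of the stack `inp`. -/
structure StackSystem (Γ S K A C : Type) where
  rule : C → StackRule S K A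
  start : S
  accept : S
  base : K → List A
  inp : K
  emb : Γ → A

variable {Γ S K A C : Type}

/-- `r.Fires c c'`: the rule `r` leads from the configuration `c` to the configuration `c'`. -/
def StackRule.Fires (r : StackRule S K A) (c c' : S × (K → List A)) : Prop :=
  c.1 = r.src ∧ c'.1 = r.dst ∧ ∃ rest : K → List A,
    (∀ k, c.2 k = r.pre k ++ rest k) ∧ ∀ k, c'.2 k = r.post k ++ rest k

/-- `sys.Runs w c c'`: the rules in `w`, applied in order, lead from `c` to `c'`. -/
inductive StackSystem.Runs (sys : StackSystem Γ S K A C) :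
    List C → S × (K → List A) → S × (K → List A) → Prop
  | nil (c) : Runs sys [] c c
  | cons {i w c c' c''} : (sys.rule i).Fires c c' → Runs sys w c' c'' → Runs sys (i :: w) c c''

/-- The initial configuration on the input `x`. -/
def StackSystem.init [DecidableEq K] (sys : StackSystem Γ S K A C) (x : List Γ) :
    S × (K → List A) :=
  (sys.start, Function.update sys.base sys.inp ((x.map sys.emb).reverse ++ sys.base sys.inp))

/-! ### A Turing machine that replays a given run -/

/-- The stacks of the replaying machine. -/
inductive ReplayStk (K : Type)
  | inp
  | out
  | work (k : K)
  deriving DecidableEq, Fintype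

/-- The labels of the replaying machine. -/
inductive ReplayLbl (Γ C : Type)
  | start
  | loop
  | load (g : Γ)
  | exec (c : C)
  | clean
  deriving Fintype

/-- The internal states of the replaying machine: the state of the system, whether all rules could
be applied, the last symbol read, and whether a nonempty stack was seen. -/
abbrev ReplayVar (Γ S C : Type) : Type := S × Bool × Option (Γ ⊕ C) × Bool

/-- The stack alphabets of the replaying machine. -/
abbrev ReplayAlph (Γ K A C : Type) : ReplayStk K → Type
  | .inp => Γ ⊕ C
  | .out => Bool
  | .work _ => A

/-- The stack contents of the replaying machine. -/
def replayStk (i : List (Γ ⊕ C)) (o : List Bool) (W : K → List A) :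
    ∀ k, List (ReplayAlph Γ K A C k)
  | .inp => i
  | .out => o
  | .work k => W k

section Replay

open Turing TM2.Stmt

/-- `c` reaches `c'` in exactly `t` steps of `f`. -/
def ReachesIn {X : Type} (f : X → Option X) (t : ℕ) (c c' : X) : Prop :=
  (flip bind f)^[t] (some c) = some c'

theorem ReachesIn.trans {X : Type} {f : X → Option X} {t t' : ℕ} {c c' c'' : X}
    (h : ReachesIn f t c c') (h' : ReachesIn f t' c' c'') : ReachesIn f (t + t') c c'' := by
  rw [ReachesIn, add_comm, Function.iterate_add_apply, h, h']

theorem ReachesIn.single {X : Type} {f : X → Option X} {c c' : X} (h : f c = some c') :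
    ReachesIn f 1 c c' := h

/-- The statements of the replaying machine. -/
abbrev ReplayStmt (Γ S K A C : Type) : Type :=
  TM2.Stmt (ReplayAlph Γ K A C) (ReplayLbl Γ C) (ReplayVar Γ S C)

/-- The configurations of the replaying machine. -/
abbrev ReplayCfg (Γ S K A C : Type) : Type :=
  TM2.Cfg (ReplayAlph Γ K A C) (ReplayLbl Γ C) (ReplayVar Γ S C)

variable [DecidableEq K] [DecidableEq A] [DecidableEq S]

theorem update_replayStk_work (i : List (Γ ⊕ C)) (o : List Bool) (W : K → List A) (k : K)
    (l : List A) :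
    Function.update (replayStk i o W) (.work k) l = replayStk i o (Function.update W k l) := by
  funext j
  rcases j with _ | _ | j
  · simp [replayStk]
  · simp [replayStk]
  · by_cases h : j = k
    · subst h; simp [replayStk]
    · simp [replayStk, h]

theorem update_replayStk_inp (i i' : List (Γ ⊕ C)) (o : List Bool) (W : K → List A) :
    Function.update (replayStk i o W) .inp i' = replayStk i' o W := by
  funext j
  rcases j with _ | _ | j <;> simp [replayStk]

theorem update_replayStk_out (i : List (Γ ⊕ C)) (o o' : List Bool) (W : K → List A) :
    Function.update (replayStk i o W) .out o' = replayStk i o' W := by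
  funext j
  rcases j with _ | _ | j <;> simp [replayStk]

/-- Push a list on a working stack. -/
def pushList (k : K) : List A → ReplayStmt Γ S K A C → ReplayStmt Γ S K A C
  | [], q => q
  | a :: l, q => pushList k l (.push (.work k) (fun _ => a) q)

/-- Pop a list from a working stack, recording whether it was there. -/
def popList (k : K) : List A → ReplayStmt Γ S K A C → ReplayStmt Γ S K A C
  | [], q => q
  | a :: l, q => .pop (.work k) (fun v t => (v.1, v.2.1 && decide (t = some a), v.2.2))
      (popList k l q)

/-- Pop one symbol from a working stack, recording whether there was one. -/
def popAny (k : K) (q : ReplayStmt Γ S K A C) : ReplayStmt Γ S K A C :=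
  .pop (.work k) (fun v t => (v.1, v.2.1, v.2.2.1, v.2.2.2 || t.isSome)) q

/-- The recursion puts the push of the head into the continuation, so the last symbol is pushed
first and the list ends up on the stack with its head on top. -/
theorem stepAux_pushList (k : K) (l : List A) (q : ReplayStmt Γ S K A C) (v : ReplayVar Γ S C)
    (i : List (Γ ⊕ C)) (o : List Bool) (W : K → List A) :
    TM2.stepAux (pushList k l q) v (replayStk i o W) =
      TM2.stepAux q v (replayStk i o (Function.update W k (l ++ W k))) := by
  induction l generalizing q with
  | nil => simp [pushList]
  | cons a l ih =>
    rw [pushList, ih, TM2.stepAux, update_replayStk_work]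
    simp [replayStk]

/-- A mismatch or an empty stack does not block the machine; it only clears the flag. The contents
after the pops are therefore a plain `drop`, whether or not the prefix was present. -/
theorem stepAux_popList (k : K) (l : List A) (q : ReplayStmt Γ S K A C) (v : ReplayVar Γ S C)
    (i : List (Γ ⊕ C)) (o : List Bool) (W : K → List A) :
    TM2.stepAux (popList k l q) v (replayStk i o W) =
      TM2.stepAux q (v.1, v.2.1 && decide (l <+: W k), v.2.2)
        (replayStk i o (Function.update W k ((W k).drop l.length))) := by
  induction l generalizing v W with
  | nil => simp [popList]
  | cons a l ih =>
    rw [popList, TM2.stepAux, update_replayStk_work, ih]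
    simp only [Function.update_idem, Function.update_self]
    congr 1
    · congr 2
      cases h : W k with
      | nil => simp [replayStk, h]
      | cons b t =>
        simp only [replayStk, h, List.head?_cons, List.tail_cons, List.cons_prefix_cons,
          Bool.and_assoc, Option.some.injEq]
        by_cases hab : a = b
        · subst hab; simp
        · simp [hab, Ne.symm hab]
    · cases h : W k <;> simp [replayStk, h]

theorem stepAux_foldr_pushList (ks : List K) (hks : ks.Nodup) (f : K → List A)
    (q : ReplayStmt Γ S K A C) (v : ReplayVar Γ S C) (i : List (Γ ⊕ C)) (o : List Bool)
    (W : K → List A) :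
    TM2.stepAux (ks.foldr (fun k => pushList k (f k)) q) v (replayStk i o W) =
      TM2.stepAux q v (replayStk i o fun k => if k ∈ ks then f k ++ W k else W k) := by
  induction ks generalizing W with
  | nil => simp
  | cons k ks ih =>
    rw [List.nodup_cons] at hks
    rw [List.foldr_cons, stepAux_pushList, ih hks.2]
    congr 2
    funext j
    by_cases h : j = k
    · subst h; simp [hks.1]
    · simp [h]

theorem stepAux_foldr_popList (ks : List K) (hks : ks.Nodup) (f : K → List A)
    (q : ReplayStmt Γ S K A C) (v : ReplayVar Γ S C) (i : List (Γ ⊕ C)) (o : List Bool)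
    (W : K → List A) :
    TM2.stepAux (ks.foldr (fun k => popList k (f k)) q) v (replayStk i o W) =
      TM2.stepAux q (v.1, v.2.1 && decide (∀ k ∈ ks, f k <+: W k), v.2.2)
        (replayStk i o fun k => if k ∈ ks then (W k).drop (f k).length else W k) := by
  induction ks generalizing W v with
  | nil => simp
  | cons k ks ih =>
    rw [List.nodup_cons] at hks
    rw [List.foldr_cons, stepAux_popList, ih hks.2]
    congr 1
    · have : (∀ j ∈ ks, f j <+: Function.update W k ((W k).drop (f k).length) j) ↔
          ∀ j ∈ ks, f j <+: W j := by
        refine forall₂_congr fun j hj => ?_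
        rw [Function.update_of_ne (by rintro rfl; exact hks.1 hj)]
      simp [this, Bool.and_assoc, Bool.decide_and]
    · congr 1
      funext j
      by_cases h : j = k
      · subst h; simp [hks.1]
      · simp [h]

theorem stepAux_foldr_popAny (ks : List K) (hks : ks.Nodup)
    (q : ReplayStmt Γ S K A C) (v : ReplayVar Γ S C) (i : List (Γ ⊕ C)) (o : List Bool)
    (W : K → List A) :
    TM2.stepAux (ks.foldr popAny q) v (replayStk i o W) =
      TM2.stepAux q (v.1, v.2.1, v.2.2.1, v.2.2.2 || decide (∃ k ∈ ks, W k ≠ []))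
        (replayStk i o fun k => if k ∈ ks then (W k).tail else W k) := by
  induction ks generalizing W v with
  | nil => simp
  | cons k ks ih =>
    rw [List.nodup_cons] at hks
    rw [List.foldr_cons, popAny, TM2.stepAux, update_replayStk_work, ih hks.2]
    congr 1
    · have : (∃ j ∈ ks, Function.update W k (W k).tail j ≠ []) ↔ ∃ j ∈ ks, W j ≠ [] := by
        refine exists_congr fun j => and_congr_right fun hj => ?_
        rw [Function.update_of_ne (by rintro rfl; exact hks.1 hj)]
      simp only [replayStk, this, List.mem_cons, exists_eq_or_imp, Bool.or_assoc]
      congr 4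
      cases h : W k <;> simp
    · congr 1
      funext j
      by_cases h : j = k
      · subst h; simp [hks.1, replayStk]
      · simp [h]

variable [Fintype K] [Fintype Γ] [Fintype C] [Fintype S]

/-- The program of the replaying machine. -/
noncomputable def StackSystem.replayProg (sys : StackSystem Γ S K A C) :
    ReplayLbl Γ C → ReplayStmt Γ S K A C
  | .start => Finset.univ.toList.foldr (fun k => pushList k (sys.base k)) (.goto fun _ => .loop)
  | .loop => .pop .inp (fun v t => (v.1, v.2.1, t, v.2.2.2)) <| .goto fun v =>
      match v.2.2.1 with
      | none => .clean
      | some (.inl g) => .load g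
      | some (.inr c) => .exec c
  | .load g => .push (.work sys.inp) (fun _ => sys.emb g) (.goto fun _ => .loop)
  | .exec c =>
      .load (fun v => (v.1, v.2.1 && decide (v.1 = (sys.rule c).src), v.2.2)) <|
      Finset.univ.toList.foldr (fun k => popList k ((sys.rule c).pre k)) <|
      Finset.univ.toList.foldr (fun k => pushList k ((sys.rule c).post k)) <|
      .load (fun v => ((sys.rule c).dst, v.2)) <| .goto fun _ => .loop
  | .clean =>
      .load (fun v => (v.1, v.2.1, v.2.2.1, false)) <|
      Finset.univ.toList.foldr popAny <|
      .branch (fun v => v.2.2.2) (.goto fun _ => .clean) <|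
      .push .out (fun v => v.2.1 && decide (v.1 = sys.accept)) <|
      .load (fun _ => (sys.start, true, none, false)) .halt

/-- The machine that replays a run given as a certificate. -/
noncomputable def StackSystem.replayTM (sys : StackSystem Γ S K A C) : FinTM2 where
  K := ReplayStk K
  k₀ := .inp
  k₁ := .out
  Γ := ReplayAlph Γ K A C
  Λ := ReplayLbl Γ C
  main := .start
  σ := ReplayVar Γ S C
  initialState := (sys.start, true, none, false)
  Γk₀Fin := inferInstanceAs (Fintype (Γ ⊕ C))
  m := sys.replayProg

/-- The effect of one input symbol on the data of the replaying machine. -/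
def StackSystem.replayStep (sys : StackSystem Γ S K A C) (d : S × Bool × (K → List A)) :
    Γ ⊕ C → S × Bool × (K → List A)
  | .inl g => (d.1, d.2.1, Function.update d.2.2 sys.inp (sys.emb g :: d.2.2 sys.inp))
  | .inr c => ((sys.rule c).dst,
      (d.2.1 && decide (d.1 = (sys.rule c).src)) && decide (∀ k, (sys.rule c).pre k <+: d.2.2 k),
      fun k => (sys.rule c).post k ++ (d.2.2 k).drop ((sys.rule c).pre k).length)

/-- The configuration at the beginning of the main loop. -/
def StackSystem.loopCfg (_ : StackSystem Γ S K A C) (i : List (Γ ⊕ C)) (b : Option (Γ ⊕ C))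
    (d : S × Bool × (K → List A)) : ReplayCfg Γ S K A C :=
  ⟨some .loop, (d.1, d.2.1, b, false), replayStk i [] d.2.2⟩

/-- One machine step reads the input symbol and one executes it, since a statement may work on all
the stacks at once. -/
theorem StackSystem.loop_step (sys : StackSystem Γ S K A C) (a : Γ ⊕ C) (i : List (Γ ⊕ C))
    (b : Option (Γ ⊕ C)) (d : S × Bool × (K → List A)) :
    ReachesIn (TM2.step sys.replayProg) 2 (sys.loopCfg (a :: i) b d)
      (sys.loopCfg i (some a) (sys.replayStep d a)) := by
  rcases a with g | c
  · refine ReachesIn.trans (t := 1) (t' := 1)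
      (c' := ⟨some (.load g), (d.1, d.2.1, some (.inl g), false), replayStk i [] d.2.2⟩)
      (.single ?_) (.single ?_)
    · simp [loopCfg, replayProg, update_replayStk_inp, replayStk]
    · simp [loopCfg, replayProg, update_replayStk_work, replayStk, replayStep]
  · refine ReachesIn.trans (t := 1) (t' := 1)
      (c' := ⟨some (.exec c), (d.1, d.2.1, some (.inr c), false), replayStk i [] d.2.2⟩)
      (.single ?_) (.single ?_)
    · simp [loopCfg, replayProg, update_replayStk_inp, replayStk]
    · rw [TM2.step, replayProg, TM2.stepAux, stepAux_foldr_popList _ (Finset.nodup_toList _),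
        stepAux_foldr_pushList _ (Finset.nodup_toList _)]
      simp [replayStep, loopCfg, Bool.and_assoc]

theorem StackSystem.loop_run (sys : StackSystem Γ S K A C) (i : List (Γ ⊕ C))
    (b : Option (Γ ⊕ C)) (d : S × Bool × (K → List A)) :
    ∃ b', ReachesIn (TM2.step sys.replayProg) (2 * i.length) (sys.loopCfg i b d)
      (sys.loopCfg [] b' (i.foldl sys.replayStep d)) := by
  induction i generalizing b d with
  | nil => exact ⟨b, rfl⟩
  | cons a i ih =>
    obtain ⟨b', h⟩ := ih (some a) (sys.replayStep d a)
    refine ⟨b', ?_⟩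
    have := (sys.loop_step a i b d).trans h
    rwa [List.length_cons, mul_add, add_comm, mul_one]

/-- A halting configuration must have empty working stacks and the initial internal state. Each
round removes one symbol from every working stack, so the number of rounds is governed by the height
of the tallest stack, not by the total contents. -/
theorem StackSystem.clean_step (sys : StackSystem Γ S K A C) (s : S) (ok f : Bool)
    (b : Option (Γ ⊕ C)) (W : K → List A) :
    TM2.step sys.replayProg ⟨some .clean, (s, ok, b, f), replayStk [] [] W⟩ =
      some (if ∃ k, W k ≠ [] then
        ⟨some .clean, (s, ok, b, true), replayStk [] [] fun k => (W k).tail⟩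
      else ⟨none, (sys.start, true, none, false),
        replayStk [] [ok && decide (s = sys.accept)] fun _ => []⟩) := by
  rw [TM2.step, replayProg, TM2.stepAux, stepAux_foldr_popAny _ (Finset.nodup_toList _)]
  by_cases h : ∃ k, W k ≠ []
  · have h' : ∃ k ∈ Finset.univ.toList, W k ≠ [] := by simpa using h
    simp [h]
  · have hW : W = fun _ => [] := by
      funext k; by_contra hk; exact h ⟨k, hk⟩
    subst hW
    simp [update_replayStk_out, replayStk]

theorem StackSystem.clean_run (sys : StackSystem Γ S K A C) (s : S) (ok f : Bool)
    (b : Option (Γ ⊕ C)) (W : K → List A) (B : ℕ) (hB : ∀ k, (W k).length ≤ B) :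
    ∃ t ≤ B + 1, ReachesIn (TM2.step sys.replayProg) t
      ⟨some .clean, (s, ok, b, f), replayStk [] [] W⟩
      ⟨none, (sys.start, true, none, false),
        replayStk [] [ok && decide (s = sys.accept)] fun _ => []⟩ := by
  induction B generalizing f W with
  | zero =>
    refine ⟨1, le_rfl, .single ?_⟩
    rw [clean_step, if_neg]
    push Not
    exact fun k => List.length_eq_zero_iff.1 (Nat.le_zero.1 (hB k))
  | succ B ih =>
    by_cases h : ∃ k, W k ≠ []
    · obtain ⟨t, ht, hr⟩ := ih true (fun k => (W k).tail) (fun k => by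
        have := hB k; rw [List.length_tail]; omega)
      refine ⟨1 + t, by omega, ReachesIn.trans (.single ?_) hr⟩
      rw [clean_step, if_pos h]
    · refine ⟨1, by omega, .single ?_⟩
      rw [clean_step, if_neg h]

/-- There are finitely many rules, each pushing a fixed amount; hence the heights, and with them the
cleaning time, are linear in the length of the input. -/
theorem StackSystem.exists_height_bound (sys : StackSystem Γ S K A C) :
    ∃ B : ℕ, (∀ k, (sys.base k).length ≤ B) ∧
      ∀ d a k, ((sys.replayStep d a).2.2 k).length ≤ (d.2.2 k).length + B := by
  -- The summand 1 pays for loading one input symbol.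
  refine ⟨(∑ k, (sys.base k).length) + 1 + ∑ c, ∑ k, ((sys.rule c).post k).length,
    fun k => ?_, fun d a k => ?_⟩
  · have := Finset.single_le_sum (f := fun k => (sys.base k).length) (fun _ _ => Nat.zero_le _)
      (Finset.mem_univ k)
    omega
  · rcases a with g | c
    · simp only [replayStep]
      by_cases h : k = sys.inp
      · subst h; simp; omega
      · simp [h]
    · have h1 := Finset.single_le_sum (f := fun k => ((sys.rule c).post k).length)
        (fun _ _ => Nat.zero_le _) (Finset.mem_univ k)
      have h2 := Finset.single_le_sum (f := fun c => ∑ k, ((sys.rule c).post k).length)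
        (fun _ _ => Nat.zero_le _) (Finset.mem_univ c)
      simp only [replayStep, List.length_append, List.length_drop] at h1 h2 ⊢
      omega

theorem StackSystem.height_foldl (sys : StackSystem Γ S K A C) (B : ℕ)
    (hB : ∀ d a k, ((sys.replayStep d a).2.2 k).length ≤ (d.2.2 k).length + B)
    (i : List (Γ ⊕ C)) (d : S × Bool × (K → List A)) (k : K) :
    ((i.foldl sys.replayStep d).2.2 k).length ≤ (d.2.2 k).length + i.length * B := by
  induction i generalizing d with
  | nil => simp
  | cons a i ih =>
    have h1 := ih (sys.replayStep d a)
    have h2 := hB d a k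
    rw [List.foldl_cons, List.length_cons, add_mul]
    omega

/-- The result of replaying the certificate `x.2` on the input `x.1`. -/
def StackSystem.replay (sys : StackSystem Γ S K A C) (x : List Γ × List C) : Bool :=
  let d := (encodePair x).foldl sys.replayStep (sys.start, true, sys.base)
  d.2.1 && decide (d.1 = sys.accept)

theorem StackSystem.replay_polyTime (sys : StackSystem Γ S K A C) :
    Nonempty (TM2ComputableInPolyTime encodePair Computability.encodeBool sys.replay) := by
  obtain ⟨B, hB, hB'⟩ := sys.exists_height_bound
  refine ⟨{ tm := sys.replayTM
            inputAlphabet := Equiv.refl _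
            outputAlphabet := Equiv.refl _
            -- One step for the start, 2ℓ for the loop, one to notice the end of the input, and at
            -- most B + ℓB + 1 for the cleaning, where ℓ is the length of the input.
            time := Polynomial.C (B + 2) * Polynomial.X + Polynomial.C (B + 3)
            outputsFun := fun x => ?_ }⟩
  have hl := sys.loop_run (encodePair x) none (sys.start, true, sys.base)
  set d := (encodePair x).foldl sys.replayStep (sys.start, true, sys.base) with hd
  have hc := fun b => sys.clean_run d.1 d.2.1 false b d.2.2 (B + (encodePair x).length * B)
    (fun k => (sys.height_foldl B hB' _ _ k).trans (Nat.add_le_add_right (hB k) _))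
  have : ∃ t ≤ (B + 2) * (encodePair x).length + (B + 3), ReachesIn (TM2.step sys.replayProg) t
      ⟨some .start, (sys.start, true, none, false), replayStk (encodePair x) [] fun _ => []⟩
      ⟨none, (sys.start, true, none, false), replayStk [] [sys.replay x] fun _ => []⟩ := by
    obtain ⟨b, hl⟩ := hl
    obtain ⟨t, ht, hc⟩ := hc none
    have h0 : ReachesIn (TM2.step sys.replayProg) 1
        ⟨some .start, (sys.start, true, none, false), replayStk (encodePair x) [] fun _ => []⟩
        (sys.loopCfg (encodePair x) none (sys.start, true, sys.base)) := by
      refine .single ?_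
      rw [TM2.step, replayProg, stepAux_foldr_pushList _ (Finset.nodup_toList _)]
      simp [loopCfg]
    have h1 : ReachesIn (TM2.step sys.replayProg) 1 (sys.loopCfg [] b d)
        ⟨some .clean, (d.1, d.2.1, none, false), replayStk [] [] d.2.2⟩ := by
      refine .single ?_
      simp [loopCfg, replayProg, update_replayStk_inp, replayStk]
    refine ⟨_, ?_, ((h0.trans hl).trans h1).trans hc⟩
    nlinarith
  have e0 : initList sys.replayTM (encodePair x) =
      (⟨some .start, (sys.start, true, none, false),
        replayStk (encodePair x) [] fun _ => []⟩ : ReplayCfg Γ S K A C) := by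
    unfold initList
    congr 1
    funext j
    rcases j with _ | _ | j <;> rfl
  have e1 : haltList sys.replayTM [sys.replay x] =
      (⟨none, (sys.start, true, none, false),
        replayStk [] [sys.replay x] fun _ => []⟩ : ReplayCfg Γ S K A C) := by
    unfold haltList
    congr 1
    funext j
    rcases j with _ | _ | j <;> rfl
  have ht := this.choose_spec
  refine ⟨⟨this.choose, ?_⟩, by simpa using ht.1⟩
  have m0 : (encodePair x).map (Equiv.refl (Γ ⊕ C)).invFun = encodePair x := List.map_id _
  exact (congrArg (fun c => (flip bind (TM2.step sys.replayProg))^[this.choose] (some c))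
    ((congrArg (initList sys.replayTM) m0).trans e0)).trans
    (Eq.trans ht.2 (congrArg some e1.symm))

-- Replaying a certificate amounts to running the system

/-- The remainder below a prefix is determined by the stack, so each rule is a partial function.
Nondeterminism lies only in the choice of rules, which the certificate records. -/
theorem StackRule.fires_iff (r : StackRule S K A) (c c' : S × (K → List A)) :
    r.Fires c c' ↔ c.1 = r.src ∧ (∀ k, r.pre k <+: c.2 k) ∧
      c' = (r.dst, fun k => r.post k ++ (c.2 k).drop (r.pre k).length) := by
  constructor
  · rintro ⟨h1, h2, rest, h3, h4⟩
    refine ⟨h1, fun k => ⟨rest k, (h3 k).symm⟩, Prod.ext h2 (funext fun k => ?_)⟩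
    simp [h3, h4]
  · rintro ⟨h1, h2, rfl⟩
    refine ⟨h1, rfl, fun k => (c.2 k).drop (r.pre k).length, fun k => ?_, fun _ => rfl⟩
    exact (List.prefix_iff_eq_append.1 (h2 k)).symm

theorem StackSystem.foldl_replayStep_false (sys : StackSystem Γ S K A C) (w : List C) (s : S)
    (W : K → List A) :
    ((w.map Sum.inr).foldl sys.replayStep (s, false, W)).2.1 = false := by
  induction w generalizing s W with
  | nil => rfl
  | cons c w ih => simpa [replayStep] using ih _ _

theorem StackSystem.runs_iff (sys : StackSystem Γ S K A C) (w : List C) (s s' : S)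
    (W W' : K → List A) :
    sys.Runs w (s, W) (s', W') ↔
      (w.map Sum.inr).foldl sys.replayStep (s, true, W) = (s', true, W') := by
  induction w generalizing s W with
  | nil =>
    constructor
    · rintro ⟨⟩; rfl
    · intro h
      simp only [List.map_nil, List.foldl_nil, Prod.mk.injEq, true_and] at h
      obtain ⟨rfl, rfl⟩ := h
      exact .nil _
  | cons c w ih =>
    rw [List.map_cons, List.foldl_cons]
    constructor
    · rintro (_ | ⟨h, hw⟩)
      rw [StackRule.fires_iff] at h
      obtain ⟨h1, h2, rfl⟩ := h
      rw [ih] at hw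
      simp only at h1 h2
      rw [← hw, replayStep]
      simp [h1, h2]
    · intro h
      by_cases h1 : s = (sys.rule c).src ∧ ∀ k, (sys.rule c).pre k <+: W k
      · refine .cons ((StackRule.fires_iff _ _ _).2 ⟨h1.1, h1.2, rfl⟩) ((ih _ _).2 ?_)
        rw [← h, replayStep]
        simp [← h1.1, h1.2]
      · exfalso
        have := congrArg (fun d => d.2.1) h
        rw [replayStep] at this
        simp only at this
        rw [show (true && decide (s = (sys.rule c).src) &&
          decide (∀ k, (sys.rule c).pre k <+: W k)) = false by simpa using h1,
          sys.foldl_replayStep_false] at this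
        cases this

theorem StackSystem.foldl_replayStep_inl (sys : StackSystem Γ S K A C) (x : List Γ) (s : S)
    (W : K → List A) :
    (x.map Sum.inl).foldl sys.replayStep (s, true, W) =
      (s, true, Function.update W sys.inp ((x.map sys.emb).reverse ++ W sys.inp)) := by
  induction x generalizing W with
  | nil => simp
  | cons g x ih => simp [replayStep, ih]

/-- A language is in NP if its words are those on which a stack system has an accepting run of
polynomial length. -/
theorem StackSystem.inNP (sys : StackSystem Γ S K A C) (L : Set (List Γ)) (p : Polynomial ℕ)
    (hL : ∀ x, x ∈ L ↔ ∃ w W, w.length ≤ p.eval x.length ∧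
      sys.Runs w (sys.init x) (sys.accept, W)) : InNP L := by
  refine ⟨C, inferInstance, sys.replay, p, sys.replay_polyTime, fun x => ?_⟩
  rw [hL]
  refine exists_congr fun w => ?_
  rw [exists_and_left]
  refine and_congr_right fun _ => ?_
  simp only [runs_iff, init, replay, encodePair, List.foldl_append, foldl_replayStep_inl]
  generalize (w.map Sum.inr).foldl _ _ = d
  obtain ⟨s, ok, W⟩ := d
  simp [and_comm]

end Replay

end SpatialLogic

namespace SpatialLogic

/-! ### A stack system for the satisfiability of basic formulas -/

/-- The stacks: the reversed input, the rest of the formula, the pending goals, the two parts of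
the two coordinate tapes, of the tape of shift lengths and of the tape of truth values, and a
counter of shifts to be undone. -/
inductive TabStk
  | inp | src | goal
  | lo (a : Bool) | hi (a : Bool)
  | kl | kr | vl | vr | pend
  deriving DecidableEq, Fintype

/-- The stack symbols. -/
inductive TabSym (n : ℕ)
  | bot
  | tok (t : Sym n)
  | eval (b : Bool)
  | move (a d : Bool)
  | unit
  | cell (m : Finset (Fin n))
  | sep
  | val (b : Bool)
  deriving DecidableEq

/-- The states. -/
inductive TabState (n : ℕ)
  | rev
  | guess (u : Bool → Finset (Fin n))
  | main
  | depart (a d : Bool)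
  | moving (a d : Bool)
  | next (b l : Bool)
  | pass (b c : Bool)
  | rewind
  | acc
  deriving DecidableEq, Fintype

/-- The symbols of a formula that are not binary digits, and the end marker. -/
abbrev Follow (n : ℕ) : Type :=
  {s : Option (Sym n) // ∀ b, s ≠ some (.inl (Tok.bit b))}

/-- The stack symbol of an element of `Follow n`. -/
def Follow.sym {n : ℕ} (t : Follow n) : TabSym n := t.1.elim .bot .tok

set_option synthInstance.maxSize 1000 in
set_option synthInstance.maxHeartbeats 400000 in
/-- The names of the rules. -/
inductive TabRule (n : ℕ) (I : Type)
  | rev (s : Sym n)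
  | revDone
  | guessUnit (u : Bool → Finset (Fin n)) (a : Bool)
  | guessCell (u : Bool → Finset (Fin n)) (a : Bool) (m : Finset (Fin n))
  | guessSep (u : Bool → Finset (Fin n))
  | guessShift (u : Bool → Finset (Fin n))
  | guessVal (u : Bool → Finset (Fin n)) (b : Bool)
  | guessMove (u : Bool → Finset (Fin n)) (a d : Bool)
  | guessDone (u : Bool → Finset (Fin n))
  | neg (b : Bool)
  | and (b c : Bool)
  | box (b a d : Bool)
  | move (a d : Bool)
  | depart (a d : Bool) (m : Finset (Fin n))
  | step (a d v : Bool)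
  | arrive (a d : Bool) (m : Finset (Fin n))
  | here (i : Fin n) (m m' : Finset (Fin n))
  | atom (b : Bool) (j : I) (m m' : Finset (Fin n))
  | bit (b l c : Bool)
  | skip (b : Bool)
  | shift (b v : Bool)
  | blockEnd (b c : Bool)
  | read (b : Bool) (t : Follow n)
  | rewindUnit
  | rewindSep
  | unshift (v : Bool)
  | rewindDone
  | acc
  deriving Fintype

/-- The symbol for a step along axis `a`, forwards if `d` holds. -/
def Tok.dir : Bool → Bool → Tok
  | false, true => .right
  | false, false => .left
  | true, true => .up
  | true, false => .down

variable {n : ℕ} {I : Type}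

/-- The rules of the system. -/
def tabRule (pat : I → List (TabSym n)) :
    TabRule n I → StackRule (TabState n) TabStk (TabSym n)
  | .rev s => ⟨.rev, .rev, fun | .inp => [.tok s] | _ => [], fun | .src => [.tok s] | _ => []⟩
  | .revDone => ⟨.rev, .guess fun _ => ∅,
      fun | .inp => [.bot] | _ => [], fun | .inp => [.bot] | _ => []⟩
  | .guessUnit u a => ⟨.guess u, .guess u, fun _ => [],
      fun | .hi a' => if a' = a then [.unit] else [] | _ => []⟩
  -- `u a` collects the agents already placed on axis `a`; subtracting it forces the cells of an
  -- axis to be pairwise disjoint, whatever is guessed.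
  | .guessCell u a m => ⟨.guess u, .guess (Function.update u a (u a ∪ m)), fun _ => [],
      fun | .hi a' => if a' = a then [.cell (m \ u a)] else [] | _ => []⟩
  | .guessSep u => ⟨.guess u, .guess u, fun _ => [], fun | .kr => [.sep] | _ => []⟩
  | .guessShift u => ⟨.guess u, .guess u, fun _ => [], fun | .kr => [.unit] | _ => []⟩
  | .guessVal u b => ⟨.guess u, .guess u, fun _ => [], fun | .vr => [.val b] | _ => []⟩
  | .guessMove u a d => ⟨.guess u, .guess u, fun _ => [], fun | .goal => [.move a d] | _ => []⟩
  | .guessDone u => ⟨.guess u, .main, fun _ => [], fun _ => []⟩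
  | .neg b => ⟨.main, .main, fun | .src => [.tok (.inl .neg)] | .goal => [.eval b] | _ => [],
      fun | .goal => [.eval !b] | _ => []⟩
  | .and b c => ⟨.main, .main,
      fun | .src => [.tok (.inl .and)] | .goal => [.eval (b && c)] | _ => [],
      fun | .goal => [.eval b, .eval c] | _ => []⟩
  -- The goal below the evaluation of the body is the move back, so the rest of the formula is read
  -- at the original position.
  | .box b a d => ⟨.main, .depart a d,
      fun | .src => [.tok (.inl .box), .tok (.inl (.dir a d))] | .goal => [.eval b] | _ => [],
      fun | .goal => [.eval b, .move a !d] | _ => []⟩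
  | .move a d => ⟨.main, .depart a d, fun | .goal => [.move a d] | _ => [], fun _ => []⟩
  | .depart a d m => ⟨.depart a d, .moving a d,
      fun | .hi a' => if a' = a then [.cell m] else [] | _ => [],
      fun | .hi a' => if a' = a ∧ d = false then [.cell m] else []
          | .lo a' => if a' = a ∧ d = true then [.cell m] else [] | _ => []⟩
  | .step a d v => ⟨.moving a d, .moving a d,
      fun | .hi a' => if a' = a ∧ d = true then [.unit] else []
          | .lo a' => if a' = a ∧ d = false then [.unit] else []
          | .vr => if d = true then [.val v] else []
          | .vl => if d = false then [.val v] else []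
          | _ => [],
      fun | .lo a' => if a' = a ∧ d = true then [.unit] else []
          | .hi a' => if a' = a ∧ d = false then [.unit] else []
          | .vl => if d = true then [.val v] else []
          | .vr => if d = false then [.val v] else []
          | _ => []⟩
  | .arrive a d m => ⟨.moving a d, .main,
      fun | .hi a' => if a' = a ∧ d = true then [.cell m] else []
          | .lo a' => if a' = a ∧ d = false then [.cell m] else [] | _ => [],
      fun | .hi a' => if a' = a then [.cell m] else [] | _ => []⟩
  | .here i m m' => ⟨.main, .main,
      fun | .src => [.tok (.inr i)] | .goal => [.eval (decide (i ∈ m ∧ i ∈ m'))]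
          | .hi false => [.cell m] | .hi true => [.cell m'] | _ => [],
      fun | .hi false => [.cell m] | .hi true => [.cell m'] | _ => []⟩
  -- Requiring a cell on top of both coordinate tapes and bottom markers on `kl` and `pend` fixes
  -- the index at which the lookup starts. The pattern is a lookahead that checks the bound on the
  -- index. The recorded last digit starts as `true` because the number 0 has the empty numeral.
  | .atom b j m m' => ⟨.main, .next b true,
      fun | .src => .tok (.inl .atom) :: pat j | .goal => [.eval b]
          | .hi false => [.cell m] | .hi true => [.cell m'] | .kl => [.bot] | .pend => [.bot]
          | _ => [],
      fun | .src => pat j | .hi false => [.cell m] | .hi true => [.cell m']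
          | .kl => [.bot] | .pend => [.bot] | _ => []⟩
  | .bit b l c => ⟨.next b l, .pass b c, fun | .src => [.tok (.inl (.bit c))] | _ => [],
      fun _ => []⟩
  | .skip b => ⟨.pass b false, .pass b false, fun | .kr => [.unit] | _ => [],
      fun | .kl => [.unit] | _ => []⟩
  | .shift b v => ⟨.pass b true, .pass b true,
      fun | .kr => [.unit] | .vr => [.val v] | _ => [],
      fun | .kl => [.unit] | .vl => [.val v] | .pend => [.unit] | _ => []⟩
  | .blockEnd b c => ⟨.pass b c, .next b c, fun | .kr => [.sep] | _ => [],
      fun | .kl => [.sep] | _ => []⟩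
  -- Numerals carry no delimiter, so the next symbol must be seen to be no digit; and a nonempty
  -- numeral must end in the digit one, its most significant digit.
  | .read b t => ⟨.next b true, .rewind, fun | .src => [t.sym] | .vr => [.val b] | _ => [],
      fun | .src => [t.sym] | .vr => [.val b] | _ => []⟩
  | .rewindUnit => ⟨.rewind, .rewind, fun | .kl => [.unit] | _ => [],
      fun | .kr => [.unit] | _ => []⟩
  | .rewindSep => ⟨.rewind, .rewind, fun | .kl => [.sep] | _ => [], fun | .kr => [.sep] | _ => []⟩
  | .unshift v => ⟨.rewind, .rewind, fun | .pend => [.unit] | .vl => [.val v] | _ => [],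
      fun | .vr => [.val v] | _ => []⟩
  | .rewindDone => ⟨.rewind, .main, fun | .kl => [.bot] | .pend => [.bot] | _ => [],
      fun | .kl => [.bot] | .pend => [.bot] | _ => []⟩
  | .acc => ⟨.main, .acc, fun | .src => [.bot] | .goal => [.bot] | _ => [], fun _ => []⟩

/-- The stack system. -/
def tabSystem (pat : I → List (TabSym n)) :
    StackSystem (Sym n) (TabState n) TabStk (TabSym n) (TabRule n I) where
  rule := tabRule pat
  start := .rev
  accept := .acc
  base
    | .goal => [.eval true, .bot]
    | .inp => [.bot]
    | .src => [.bot]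
    | .kl => [.bot]
    | .pend => [.bot]
    | _ => []
  inp := .inp
  emb := .tok

/-- The patterns `pat` describe which numbers are indices of atomic propositions. -/
def PatSpec (N : ℕ∞) (pat : I → List (TabSym n)) : Prop :=
  ∀ (k : ℕ) (t : Follow n) (r : List (TabSym n)),
    (∃ j, pat j <+: (Nat.bits k).map (fun b => .tok (.inl (Tok.bit b))) ++ t.sym :: r) ↔
      (k : ℕ∞) < N

/-! ### The model described by the tapes -/

/-- The number of shift units on a tape. -/
def units (l : List (TabSym n)) : ℕ := l.count .unit

/-- The cells of a coordinate tape. -/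
def cellsOf (l : List (TabSym n)) : List (Finset (Fin n)) :=
  l.filterMap fun | .cell m => some m | _ => none

/-- The number of shift units before the `k`-th cell. -/
def unitsBefore : List (TabSym n) → ℕ → ℕ
  | .unit :: l, k => unitsBefore l k + 1
  | .cell _ :: l, k + 1 => unitsBefore l k
  | .cell _ :: _, 0 => 0
  | _ :: l, k => unitsBefore l k
  | [], _ => 0

/-- The total shift for a list of binary digits: the blocks of the tape give the shifts for the
digits that are one. -/
def totalShift : List (TabSym n) → List Bool → ℕ
  | .unit :: l, b :: bs => totalShift l (b :: bs) + (if b then 1 else 0)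
  | .sep :: l, _ :: bs => totalShift l bs
  | _ :: l, bs => totalShift l bs
  | [], _ => 0

@[simp] theorem units_nil : units ([] : List (TabSym n)) = 0 := rfl

@[simp] theorem units_cons (s : TabSym n) (l) :
    units (s :: l) = units l + if s = .unit then 1 else 0 := by
  simp [units, List.count_cons]

@[simp] theorem cellsOf_nil : cellsOf ([] : List (TabSym n)) = [] := rfl

@[simp] theorem cellsOf_cell (m : Finset (Fin n)) (l) : cellsOf (.cell m :: l) = m :: cellsOf l :=
  rfl

@[simp] theorem cellsOf_unit (l : List (TabSym n)) : cellsOf (.unit :: l) = cellsOf l := rfl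

@[simp] theorem cellsOf_append (l l' : List (TabSym n)) :
    cellsOf (l ++ l') = cellsOf l ++ cellsOf l' := List.filterMap_append

theorem totalShift_nil (l : List (TabSym n)) : totalShift l [] = 0 := by
  induction l with
  | nil => rfl
  | cons s l ih => cases s <;> simpa [totalShift] using ih

/-- This ties the index used by the model to the head: when a cell is about to be read, the units
passed so far are that axis's share of the index. -/
theorem unitsBefore_append_cell (l r : List (TabSym n)) (m : Finset (Fin n)) :
    unitsBefore (l ++ .cell m :: r) (cellsOf l).length = units l := by
  induction l with
  | nil => simp [unitsBefore]
  | cons s l ih =>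
    cases s <;> simp [unitsBefore, ← ih, cellsOf]

theorem units_reverse (l : List (TabSym n)) : units l.reverse = units l := by
  simp [units]

theorem cellsOf_reverse (l : List (TabSym n)) : cellsOf l.reverse = (cellsOf l).reverse := by
  simp [cellsOf, List.filterMap_reverse]

/-- The model described by coordinate tapes `F`, shift lengths `FK` and truth values `FV`. -/
def tapeModel (N : ℕ∞) (F : Bool → List (TabSym n)) (FK FV : List (TabSym n)) :
    SpatialModel (Atom N) (Fin n) where
  -- An agent missing from a tape gets the number of cells as its coordinate, just past the last
  -- cell, where no evaluation takes place.
  P i := (((cellsOf (F false)).findIdx (i ∈ ·) : ℕ), ((cellsOf (F true)).findIdx (i ∈ ·) : ℕ))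
  V u := {p | FV[unitsBefore (F false) u.1.toNat + unitsBefore (F true) u.2.toNat +
    totalShift FK (Nat.bits p.1)]? = some (.val true)}

/-- The positions next to `u`. -/
def neighbour (a d : Bool) (u : ℤ × ℤ) : ℤ × ℤ :=
  match a, d with
  | false, true => (u.1 + 1, u.2)
  | false, false => (u.1 - 1, u.2)
  | true, true => (u.1, u.2 + 1)
  | true, false => (u.1, u.2 - 1)

theorem neighbour_neighbour (a d : Bool) (u : ℤ × ℤ) :
    neighbour a (!d) (neighbour a d u) = u := by
  cases a <;> cases d <;> simp [neighbour]

/-- The program for a step along axis `a`. -/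
def dirProg {Atm Agt : Type} : Bool → Bool → Prog Atm Agt
  | false, true => .right
  | false, false => .left
  | true, true => .up
  | true, false => .down

theorem isDirection_dirProg {Atm Agt : Type} (a d : Bool) :
    (dirProg a d : Prog Atm Agt).IsDirection := by
  cases a <;> cases d <;> trivial

theorem exists_dirProg {Atm Agt : Type} {α : Prog Atm Agt} (h : α.IsDirection) :
    ∃ a d, α = dirProg a d := by
  cases α with
  | up => exact ⟨true, true, rfl⟩
  | down => exact ⟨true, false, rfl⟩
  | right => exact ⟨false, true, rfl⟩
  | left => exact ⟨false, false, rfl⟩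
  | _ => exact h.elim

theorem encode_dirProg {N : ℕ∞} (a d : Bool) :
    (dirProg a d : Prog (Atom N) (Fin n)).encode = [.inl (.dir a d)] := by
  cases a <;> cases d <;> simp [dirProg, Tok.dir, Prog.encode]

theorem holds_box_dirProg {Atm Agt : Type} (M : SpatialModel Atm Agt) (a d : Bool)
    (φ : Form Atm Agt) (u : ℤ × ℤ) :
    (Form.box (dirProg a d) φ).Holds M u ↔ φ.Holds M (neighbour a d u) := by
  cases a <;> cases d <;> simp [dirProg, Form.Holds, Prog.Rel, neighbour]

/-! ### Soundness -/

/-- The invariant of the tapes. -/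
structure TapeInv (F : Bool → List (TabSym n)) (FK FV : List (TabSym n))
    (T : TabStk → List (TabSym n)) : Prop where
  coord_false : (T (.lo false)).reverse ++ T (.hi false) = F false
  coord_true : (T (.lo true)).reverse ++ T (.hi true) = F true
  shifts : (T .kl).reverse ++ T .kr = .bot :: FK
  vals : (T .vl).reverse ++ T .vr = FV
  -- The displacement of the value head is the number of units passed on both axes plus the shifts
  -- still to be undone; the 1 accounts for the bottom marker on `pend`.
  length_vl : (T .vl).length + 1 = units (T (.lo false)) + units (T (.lo true)) + (T .pend).length
  -- The only bottom marker lies at the bottom, so seeing one on top means that the tape is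
  -- completely rewound.
  bot_kl : (T .kl).idxOf .bot + 1 = (T .kl).length
  bot_pend : (T .pend).idxOf .bot + 1 = (T .pend).length

/-- The initial states, in which the tapes are being filled. -/
def TabState.IsInit : TabState n → Prop
  | .rev => True
  | .guess _ => True
  | _ => False

/-- After the guessing phase a rule only moves symbols across the heads of the tapes, and every unit
crossed on an axis is matched by one value symbol. The tapes, and hence the model they describe, are
frozen. -/
theorem TapeInv.of_fires {F : Bool → List (TabSym n)} {FK FV : List (TabSym n)}
    {pat : I → List (TabSym n)} {i : TabRule n I} {s s' : TabState n}
    {T T' : TabStk → List (TabSym n)} (h : (tabRule pat i).Fires (s, T) (s', T'))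
    (hs : ¬ s.IsInit) (hT : TapeInv F FK FV T) : TapeInv F FK FV T' := by
  obtain ⟨h1, h2, rest, h3, h4⟩ := h
  obtain rfl : T = fun k => (tabRule pat i).pre k ++ rest k := funext h3
  obtain rfl : T' = fun k => (tabRule pat i).post k ++ rest k := funext h4
  simp only at h1
  clear h2 h3 h4
  obtain ⟨i1, i2, i3, i4, i5, i6, i7⟩ := hT
  cases i with
  | rev => subst h1; exact (hs trivial).elim
  | revDone => subst h1; exact (hs trivial).elim
  | guessUnit => subst h1; exact (hs trivial).elim
  | guessCell => subst h1; exact (hs trivial).elim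
  | guessSep => subst h1; exact (hs trivial).elim
  | guessShift => subst h1; exact (hs trivial).elim
  | guessVal => subst h1; exact (hs trivial).elim
  | guessMove => subst h1; exact (hs trivial).elim
  | guessDone => subst h1; exact (hs trivial).elim
  | depart a d m =>
    clear h1 hs
    cases a <;> cases d <;>
      simp only [tabRule, reduceIte, List.nil_append, List.cons_append, and_true,
        and_false, Bool.false_eq_true,
        Bool.true_eq_false] at i1 i2 i3 i4 i5 i6 i7 <;>
      constructor <;> simpa [tabRule]
  | step a d v =>
    clear h1 hs
    cases a <;> cases d <;>
      simp only [tabRule, reduceIte, List.nil_append, List.cons_append, and_true,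
        and_false, List.reverse_cons, List.append_assoc, Bool.false_eq_true, Bool.true_eq_false,
        units_cons,
        List.length_cons] at i1 i2 i3 i4 i5 i6 i7 <;>
      constructor <;> simp [tabRule] <;> omega
  | arrive a d m =>
    clear h1 hs
    cases a <;> cases d <;>
      simp only [tabRule, reduceIte, List.nil_append, List.cons_append, and_true,
        and_false, List.reverse_cons, List.append_assoc, Bool.false_eq_true,
        Bool.true_eq_false] at i1 i2 i3 i4 i5 i6 i7 <;>
      constructor <;> simpa [tabRule]
  | _ =>
    clear h1 hs
    constructor <;> simp only [tabRule] at i1 i2 i3 i4 i5 i6 i7 <;>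
      simp [tabRule] at * <;> first | assumption | omega

/-- What acceptance with the goals `g` at position `u` tells about the rest of the formula. -/
def Certified {N : ℕ∞} (M : SpatialModel (Atom N) (Fin n)) :
    List (TabSym n) → ℤ × ℤ → List (TabSym n) → Prop
  | .bot :: _, _, src => src.head? = some .bot
  | .eval b :: g, u, src => ∃ (φ : Form (Atom N) (Fin n)) (src' : List (TabSym n)), φ.Basic ∧
      src = φ.encode.map .tok ++ src' ∧ (φ.Holds M u ↔ b = true) ∧ Certified M g u src'
  | .move a d :: g, u, src => Certified M g (neighbour a d u) src
  | _, _, _ => False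

/-- The position described by the coordinate tapes. -/
def tapePos (T : TabStk → List (TabSym n)) : ℤ × ℤ :=
  ((cellsOf (T (.lo false))).length, (cellsOf (T (.lo true))).length)

/-- The meaning of a configuration from which an accepting state is reached. -/
def TabMeaning (N : ℕ∞) (F : Bool → List (TabSym n)) (FK FV : List (TabSym n)) (s : TabState n)
    (T : TabStk → List (TabSym n)) : Prop :=
  let M := tapeModel N F FK FV
  match s with
  | .main => Certified M (T .goal) (tapePos T) (T .src)
  | .rewind => Certified M (T .goal) (tapePos T) (T .src)
  | .depart a d => Certified M (T .goal) (neighbour a d (tapePos T)) (T .src)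
  -- On a forward move the cell left behind is put on `lo` at departure, so `tapePos` is already the
  -- target; on a backward move the count of cells changes only on arrival.
  | .moving _ true => Certified M (T .goal) (tapePos T) (T .src)
  | .moving a false => Certified M (T .goal) (neighbour a false (tapePos T)) (T .src)
  | .next b l => ∃ (bs : List Bool) (t : Follow n) (r : List (TabSym n)),
      T .src = bs.map (fun b => .tok (.inl (Tok.bit b))) ++ t.sym :: r ∧
      (l :: bs).getLast? = some true ∧
      FV[(T .vl).length + totalShift (T .kr) bs]? = some (.val b) ∧
      Certified M (T .goal) (tapePos T) (t.sym :: r)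
  | .pass b c => ∃ (bs : List Bool) (t : Follow n) (r : List (TabSym n)),
      T .src = bs.map (fun b => .tok (.inl (Tok.bit b))) ++ t.sym :: r ∧
      (c :: bs).getLast? = some true ∧
      FV[(T .vl).length + totalShift (T .kr) (c :: bs)]? = some (.val b) ∧
      Certified M (T .goal) (tapePos T) (t.sym :: r)
  | _ => True

/-- By disjointness at most one cell contains the agent, so inspecting the current cell alone
decides whether the agent has this coordinate. -/
theorem findIdx_eq_length_iff {i : Fin n} {l r : List (Finset (Fin n))} {m : Finset (Fin n)}
    (h : (l ++ m :: r).Pairwise Disjoint) :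
    (l ++ m :: r).findIdx (i ∈ ·) = l.length ↔ i ∈ m := by
  constructor
  · intro hi
    have hlt : (l ++ m :: r).findIdx (i ∈ ·) < (l ++ m :: r).length := by simp [hi]
    have := List.findIdx_getElem (w := hlt)
    simpa [hi] using this
  · intro hi
    have hl : ∀ m' ∈ l, i ∉ m' := fun m' hm' hi' =>
      Finset.disjoint_left.1 ((List.pairwise_append.1 h).2.2 m' hm' m (by simp)) hi' hi
    rw [List.findIdx_append, List.findIdx_cons]
    have : ¬ l.findIdx (i ∈ ·) < l.length := by
      rw [List.findIdx_lt_length]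
      push Not
      simpa using hl
    simp [hi, this]

/-- Digit lists, least significant digit first, are numerals as long as they do not end in zero. The
leading `true` in the hypothesis makes the empty list, the numeral of 0, acceptable. -/
theorem exists_bits_eq {bs : List Bool} (h : (true :: bs).getLast? = some true) :
    ∃ k, Nat.bits k = bs := by
  induction bs with
  | nil => exact ⟨0, Nat.zero_bits⟩
  | cons b bs ih =>
    cases bs with
    | nil =>
      simp only [List.getLast?_cons_cons, List.getLast?_singleton, Option.some.injEq] at h
      subst h
      exact ⟨1, Nat.one_bits⟩
    | cons c bs =>
      obtain ⟨k, hk⟩ := ih (by simpa using h)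
      refine ⟨Nat.bit b k, ?_⟩
      rw [Nat.bits_append_bit, hk]
      rintro rfl
      simp at hk

theorem unitsBefore_of_eq {l r F : List (TabSym n)} {m : Finset (Fin n)}
    (h : l.reverse ++ .cell m :: r = F) : unitsBefore F (cellsOf l).length = units l := by
  have := unitsBefore_append_cell l.reverse r m
  rwa [h, cellsOf_reverse, List.length_reverse, units_reverse] at this

theorem findIdx_cellsOf_iff {l r F : List (TabSym n)} {m : Finset (Fin n)} (i : Fin n)
    (h : l.reverse ++ .cell m :: r = F) (hF : (cellsOf F).Pairwise Disjoint) :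
    (cellsOf F).findIdx (i ∈ ·) = (cellsOf l).length ↔ i ∈ m := by
  have e : cellsOf F = (cellsOf l).reverse ++ m :: cellsOf r := by
    rw [← h, cellsOf_append, cellsOf_reverse, cellsOf_cell]
  rw [e] at hF ⊢
  rw [← findIdx_eq_length_iff hF, List.length_reverse]

/-- Meaning is transported backwards along a run: acceptance certifies the empty rest, and each rule
read in reverse adds one connective, modality or atom to a certified formula. No assumption on how
the tapes were guessed is needed beyond disjoint cells. -/
theorem TabMeaning.of_fires {N : ℕ∞} {F : Bool → List (TabSym n)} {FK FV : List (TabSym n)}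
    {pat : I → List (TabSym n)} (hpat : PatSpec N pat)
    (hF : ∀ a, (cellsOf (F a)).Pairwise Disjoint) {i : TabRule n I} {s s' : TabState n}
    {T T' : TabStk → List (TabSym n)} (h : (tabRule pat i).Fires (s, T) (s', T'))
    (hs : ¬ s.IsInit) (hT : TapeInv F FK FV T) (hm : TabMeaning N F FK FV s' T') :
    TabMeaning N F FK FV s T := by
  obtain ⟨h1, h2, rest, h3, h4⟩ := h
  obtain rfl : T = fun k => (tabRule pat i).pre k ++ rest k := funext h3
  obtain rfl : T' = fun k => (tabRule pat i).post k ++ rest k := funext h4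
  simp only at h1 h2
  clear h3 h4
  obtain ⟨i1, i2, i3, i4, i5, i6, i7⟩ := hT
  subst h1 h2
  cases i with
  | rev => exact (hs trivial).elim
  | revDone => exact (hs trivial).elim
  | guessUnit => exact (hs trivial).elim
  | guessCell => exact (hs trivial).elim
  | guessSep => exact (hs trivial).elim
  | guessShift => exact (hs trivial).elim
  | guessVal => exact (hs trivial).elim
  | guessMove => exact (hs trivial).elim
  | guessDone => exact (hs trivial).elim
  | neg b =>
    obtain ⟨φ, src', h1, h2, h3, h4⟩ := hm
    refine ⟨.neg φ, src', h1, ?_, ?_, h4⟩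
    · simpa [tabRule, Form.encode] using h2
    · exact (not_congr h3).trans (by simp)
  | and b c =>
    obtain ⟨φ, src', h1, h2, h3, ψ, src'', h4, h5, h6, h7⟩ := hm
    refine ⟨.and φ ψ, src'', ⟨h1, h4⟩, ?_, ?_, h7⟩
    · simp only [tabRule, List.nil_append] at h2
      simp [tabRule, Form.encode, h2, h5]
    · exact (and_congr h3 h6).trans (by simp)
  | box b a d =>
    obtain ⟨φ, src', h1, h2, h3, h4⟩ := hm
    refine ⟨.box (dirProg a d) φ, src', ⟨isDirection_dirProg a d, h1⟩, ?_, ?_, ?_⟩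
    · simp only [tabRule, List.nil_append] at h2
      simp [tabRule, Form.encode, encode_dirProg, h2]
    · rw [holds_box_dirProg]; exact h3
    · change Certified _ (rest .goal) (neighbour a (!d) (neighbour a d _)) src' at h4
      rw [neighbour_neighbour] at h4
      exact h4
  | move a d => exact hm
  | depart a d m =>
    cases a <;> cases d <;> simpa [TabMeaning, tabRule, tapePos, neighbour] using hm
  | step a d v =>
    cases a <;> cases d <;> simpa [TabMeaning, tabRule, tapePos, neighbour] using hm
  | arrive a d m =>
    cases a <;> cases d <;> simpa [TabMeaning, tabRule, tapePos, neighbour] using hm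
  | here i m m' =>
    refine ⟨.here i, rest .src, trivial, by simp [tabRule, Form.encode], ?_, hm⟩
    have e1 := findIdx_cellsOf_iff i i1 (hF _)
    have e2 := findIdx_cellsOf_iff i i2 (hF _)
    simp only [Form.Holds, tapeModel, tapePos, Prod.mk.injEq, Nat.cast_inj, e1, e2,
      decide_eq_true_eq]
  | atom b j m m' =>
    obtain ⟨bs, t, r, h1, h2, h3, h4⟩ := hm
    obtain ⟨k, rfl⟩ := exists_bits_eq h2
    have hk : (k : ℕ∞) < N := (hpat k t r).1 ⟨j, rest .src, h1⟩
    have e1 := unitsBefore_of_eq i1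
    have e2 := unitsBefore_of_eq i2
    refine ⟨.atom ⟨k, hk⟩, t.sym :: r, trivial, ?_, ?_, h4⟩
    · have : pat j ++ rest .src = _ := h1
      simp [tabRule, Form.encode, this, Function.comp_def]
    -- The bottom markers show that no shift is pending and that the shift tape is at its start, so
    -- the full index is the one used by `tapeModel`.
    · have e3 : rest .kl = [] := by simpa [tabRule] using i6
      have e4 : rest .pend = [] := by simpa [tabRule] using i7
      have e5 : rest .kr = FK := by simpa [tabRule, e3] using i3
      simp only [tabRule, e4, e5, List.nil_append, List.cons_append, List.length_cons,
        List.length_nil, zero_add, Nat.add_right_cancel_iff] at i5 h3 e1 e2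
      simp only [Form.Holds, tapeModel, tapePos, Set.mem_ofPred_eq, tabRule, List.nil_append,
        Int.toNat_natCast, e1, e2, ← i5, h3]
      simp
  | bit b l c =>
    obtain ⟨bs, t, r, h1, h2, h3, h4⟩ := hm
    refine ⟨c :: bs, t, r, ?_, by simpa using h2, h3, h4⟩
    simp only [tabRule, List.nil_append] at h1
    simp [tabRule, h1]
  | skip b =>
    obtain ⟨bs, t, r, h1, h2, h3, h4⟩ := hm
    refine ⟨bs, t, r, h1, h2, ?_, h4⟩
    simpa [tabRule, totalShift] using h3
  | shift b v =>
    obtain ⟨bs, t, r, h1, h2, h3, h4⟩ := hm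
    refine ⟨bs, t, r, h1, h2, ?_, h4⟩
    simp only [tabRule, totalShift, List.nil_append, List.cons_append, List.length_cons,
      reduceIte] at h3 ⊢
    rw [← h3]
    congr 1
    omega
  | blockEnd b c =>
    obtain ⟨bs, t, r, h1, h2, h3, h4⟩ := hm
    refine ⟨bs, t, r, h1, h2, ?_, h4⟩
    simpa [tabRule, totalShift] using h3
  | read b t =>
    refine ⟨[], t, rest .src, rfl, rfl, ?_, hm⟩
    rw [totalShift_nil, ← i4]
    simp [tabRule]
  | rewindUnit => exact hm
  | rewindSep => exact hm
  | unshift v => exact hm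
  | rewindDone => exact hm
  | acc => rfl

theorem TabMeaning.of_runs {N : ℕ∞} {F : Bool → List (TabSym n)} {FK FV : List (TabSym n)}
    {pat : I → List (TabSym n)} (hpat : PatSpec N pat)
    (hF : ∀ a, (cellsOf (F a)).Pairwise Disjoint) {w : List (TabRule n I)} {s : TabState n}
    {T W : TabStk → List (TabSym n)} (h : (tabSystem pat).Runs w (s, T) (.acc, W))
    (hs : ¬ s.IsInit) (hT : TapeInv F FK FV T) : TabMeaning N F FK FV s T := by
  induction w generalizing s T with
  | nil =>
    cases h
    trivial
  | cons i w ih =>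
    rcases h with _ | ⟨h, hw⟩
    rename_i c
    obtain ⟨s', T'⟩ := c
    refine TabMeaning.of_fires hpat hF h hs hT (ih hw ?_ (hT.of_fires h hs))
    obtain ⟨h1, h2, -⟩ := h
    simp only at h1 h2
    subst h1 h2
    -- No rule leads from a later state back into the guessing phase.
    intro h
    revert h hs
    cases i <;> simp [tabSystem, tabRule, TabState.IsInit]

/-- The guessed initial moves merely select the position at which the formula is evaluated. -/
theorem Certified.satisfiable {N : ℕ∞} {M : SpatialModel (Atom N) (Fin n)}
    {ms : List (Bool × Bool)} {u : ℤ × ℤ} {x : List (Sym n)}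
    (h : Certified M (ms.map (fun m => .move m.1 m.2) ++ [.eval true, .bot]) u
      (x.map .tok ++ [.bot])) : x ∈ SatDLS0 N n := by
  induction ms generalizing u with
  | nil =>
    obtain ⟨φ, src', h1, h2, h3, h4⟩ := h
    refine ⟨φ, h1, fun hv => hv M u (h3.2 rfl), ?_⟩
    have h4 : src'.head? = some .bot := h4
    cases src' with
    | nil => simp at h4
    | cons s r =>
      simp only [List.head?_cons, Option.some.injEq] at h4
      subst h4
      -- The bottom marker occurs only at the end of the source, so the certified formula uses up
      -- the whole input.
      have hl : r = [] := by
        rcases r.eq_nil_or_concat with rfl | ⟨r, y, rfl⟩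
        · rfl
        · have h5 : x.map TabSym.tok ++ [.bot] =
              (φ.encode.map .tok ++ .bot :: r) ++ [y] := by simpa using h2
          have h6 := (List.append_inj' h5 rfl).1
          have : TabSym.bot ∈ x.map TabSym.tok := by rw [h6]; simp
          simp at this
      subst hl
      have h6 := (List.append_inj' h2 rfl).1
      exact ((List.map_injective_iff.2 fun a b hab => by simpa using hab) h6).symm
  | cons m ms ih => exact ih h

/-- The invariant while the tapes are being filled. -/
def InitInv (x : List (Sym n)) : TabState n → (TabStk → List (TabSym n)) → Prop
  | .rev, T => ∃ l r : List (Sym n), l ++ r = x ∧ T .inp = (l.map .tok).reverse ++ [.bot] ∧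
      T .src = r.map .tok ++ [.bot] ∧ T .goal = [.eval true, .bot] ∧ (∀ a, T (.lo a) = []) ∧
      (∀ a, T (.hi a) = []) ∧ T .kl = [.bot] ∧ T .vl = [] ∧ T .pend = [.bot]
  | .guess u, T => (∃ ms : List (Bool × Bool),
        T .goal = ms.map (fun m => .move m.1 m.2) ++ [.eval true, .bot]) ∧
      T .src = x.map .tok ++ [.bot] ∧ (∀ a, T (.lo a) = []) ∧
      (∀ a, (cellsOf (T (.hi a))).Pairwise Disjoint ∧ ∀ m ∈ cellsOf (T (.hi a)), m ⊆ u a) ∧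
      T .kl = [.bot] ∧ T .vl = [] ∧ T .pend = [.bot]
  | _, _ => False

/-- The guessing phase has to guarantee just one property of the tapes, disjointness of the cells,
and it does so by its bookkeeping of placed agents. At the end of this phase the current contents
are taken as the model. -/
theorem InitInv.sound {N : ℕ∞} {pat : I → List (TabSym n)} (hpat : PatSpec N pat)
    {x : List (Sym n)} {w : List (TabRule n I)} {s : TabState n}
    {T W : TabStk → List (TabSym n)} (h : (tabSystem pat).Runs w (s, T) (.acc, W))
    (hT : InitInv x s T) : x ∈ SatDLS0 N n := by
  induction w generalizing s T with
  | nil =>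
    cases h
    exact hT.elim
  | cons i w ih =>
    rcases h with _ | ⟨h, hw⟩
    rename_i c
    obtain ⟨s', T'⟩ := c
    obtain ⟨h1, h2, rest, h3, h4⟩ := h
    simp only at h1 h2
    obtain rfl : T = fun k => (tabRule pat i).pre k ++ rest k := funext h3
    obtain rfl : T' = fun k => (tabRule pat i).post k ++ rest k := funext h4
    subst h1 h2
    clear h3 h4
    cases i with
    | rev s =>
      refine ih hw ?_
      obtain ⟨l, r, rfl, h1, h2, h3, h4, h5, h6, h7, h8⟩ := hT
      rcases l.eq_nil_or_concat with rfl | ⟨l, y, rfl⟩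
      · simp [tabRule] at h1
      · simp only [tabRule, List.cons_append, List.nil_append, List.concat_eq_append,
          List.map_append, List.map_cons, List.map_nil, List.reverse_append, List.reverse_cons,
          List.reverse_nil, List.cons.injEq, TabSym.tok.injEq] at h1
        obtain ⟨rfl, h1⟩ := h1
        refine ⟨l, s :: r, by simp, h1, ?_, h3, h4, h5, h6, h7, h8⟩
        simpa [tabRule, tabSystem] using h2
    | revDone =>
      refine ih hw ?_
      obtain ⟨l, r, rfl, h1, h2, h3, h4, h5, h6, h7, h8⟩ := hT
      rcases l.eq_nil_or_concat with rfl | ⟨l, y, rfl⟩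
      · refine ⟨⟨[], h3⟩, by simpa [tabRule] using h2, h4, fun a => ?_, h6, h7, h8⟩
        have := h5 a
        simp only [tabRule, List.nil_append] at this
        simp [tabRule, this]
      · simp [tabRule] at h1
    | guessUnit u a =>
      refine ih hw ?_
      obtain ⟨h1, h2, h3, h4, h5⟩ := hT
      refine ⟨h1, h2, h3, fun a' => ?_, h5⟩
      have := h4 a'
      by_cases h : a' = a <;> simpa [tabSystem, tabRule, h] using this
    | guessCell u a m =>
      refine ih hw ?_
      obtain ⟨h1, h2, h3, h4, h5⟩ := hT
      refine ⟨h1, h2, h3, fun a' => ?_, h5⟩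
      have := h4 a'
      by_cases h : a' = a
      · subst h
        simp only [tabRule, List.nil_append] at this
        simp only [tabRule, reduceIte, List.cons_append, List.nil_append, cellsOf_cell,
          List.pairwise_cons, List.mem_cons, forall_eq_or_imp, Function.update_self]
        refine ⟨⟨fun m' hm' => ?_, this.1⟩, ?_, fun m' hm' => ?_⟩
        · exact Finset.disjoint_of_subset_right (this.2 m' hm') Finset.sdiff_disjoint
        · exact Finset.sdiff_subset.trans Finset.subset_union_right
        · exact (this.2 m' hm').trans Finset.subset_union_left
      · simpa [tabSystem, tabRule, h] using this
    | guessSep u => exact ih hw hT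
    | guessShift u => exact ih hw hT
    | guessVal u b => exact ih hw hT
    | guessMove u a d =>
      refine ih hw ?_
      obtain ⟨⟨ms, h1⟩, h2⟩ := hT
      refine ⟨⟨(a, d) :: ms, ?_⟩, h2⟩
      simpa [tabSystem, tabRule] using h1
    | guessDone u =>
      obtain ⟨⟨ms, h1⟩, h2, h3, h4, h5, h6, h7⟩ := hT
      have h3' := h3 false
      have h3'' := h3 true
      simp only [tabRule, List.nil_append] at h1 h2 h3' h3'' h4 h5 h6 h7
      have hm := TabMeaning.of_runs (F := fun a => rest (.hi a)) (FK := rest .kr) (FV := rest .vr)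
        hpat (fun a => (h4 a).1) hw id (by
          constructor <;> simp [tabRule, h3', h3'', h5, h6, h7])
      simp only [TabMeaning, tabSystem, tabRule, List.nil_append, h1, h2] at hm
      exact hm.satisfiable
    | _ => exact hT.elim

theorem tabSystem_sound {N : ℕ∞} {pat : I → List (TabSym n)} (hpat : PatSpec N pat)
    {x : List (Sym n)} {w : List (TabRule n I)} {W : TabStk → List (TabSym n)}
    (h : (tabSystem pat).Runs w ((tabSystem pat).init x) (.acc, W)) : x ∈ SatDLS0 N n := by
  refine InitInv.sound (x := x) hpat h ⟨x, [], ?_⟩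
  simp [tabSystem]

end SpatialLogic

namespace SpatialLogic

variable {n : ℕ} {I : Type}

/-! ### Completeness -/

/-- `c` leads to `c'` in at most `t` steps. -/
def TabReach (pat : I → List (TabSym n)) (t : ℕ)
    (c c' : TabState n × (TabStk → List (TabSym n))) : Prop :=
  ∃ w, w.length ≤ t ∧ (tabSystem pat).Runs w c c'

section Reach

variable {pat : I → List (TabSym n)} {c c' c'' : TabState n × (TabStk → List (TabSym n))}

theorem TabReach.refl (pat : I → List (TabSym n)) (t : ℕ) (c) : TabReach pat t c c :=
  ⟨[], by simp, .nil _⟩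

theorem TabReach.trans {t t' t'' : ℕ} (h : TabReach pat t c c') (h' : TabReach pat t' c' c'')
    (ht : t + t' ≤ t'') : TabReach pat t'' c c'' := by
  obtain ⟨w, hw, h⟩ := h
  obtain ⟨w', hw', h'⟩ := h'
  refine ⟨w ++ w', by simp; omega, ?_⟩
  clear hw
  induction h with
  | nil => exact h'
  | cons hf _ ih => exact .cons hf (ih h')

theorem TabReach.mono {t t' : ℕ} (h : TabReach pat t c c') (ht : t ≤ t') :
    TabReach pat t' c c' := h.trans (.refl pat 0 _) ht

theorem TabReach.single {t : ℕ} (i : TabRule n I) (ht : 1 ≤ t)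
    (h1 : c.1 = (tabRule pat i).src) (h2 : ∀ k, (tabRule pat i).pre k <+: c.2 k)
    (h3 : c'.1 = (tabRule pat i).dst)
    (h4 : ∀ k, c'.2 k = (tabRule pat i).post k ++ (c.2 k).drop ((tabRule pat i).pre k).length) :
    TabReach pat t c c' :=
  ⟨[i], ht, .cons ((StackRule.fires_iff _ _ _).2 ⟨h1, h2, Prod.ext h3 (funext h4)⟩) (.nil _)⟩

theorem TabReach.head {t t' : ℕ} (i : TabRule n I)
    (h : TabReach pat t c' c'')
    (h1 : c.1 = (tabRule pat i).src) (h2 : ∀ k, (tabRule pat i).pre k <+: c.2 k)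
    (h3 : c'.1 = (tabRule pat i).dst)
    (h4 : ∀ k, c'.2 k = (tabRule pat i).post k ++ (c.2 k).drop ((tabRule pat i).pre k).length)
    (ht : t + 1 ≤ t') :
    TabReach pat t' c c'' :=
  (TabReach.single i le_rfl h1 h2 h3 h4).trans h (by omega)

end Reach

/-- The data of the tapes used for a satisfying model: the number of cells, the number of shift
units after each cell, the cells, the shift lengths, and the truth values. -/
structure Layout (n : ℕ) where
  W : ℕ
  A : Bool → ℕ
  cell : Bool → ℕ → Finset (Fin n)
  S : List ℕ
  V : List Bool

namespace Layout

variable (Y : Layout n)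

/-- The coordinate tapes. -/
def coord (a : Bool) : List (TabSym n) :=
  (List.range (Y.W * (Y.A a + 1))).map fun p =>
    if p % (Y.A a + 1) = 0 then .cell (Y.cell a (p / (Y.A a + 1))) else .unit

theorem coord_cell {a : Bool} {k : ℕ} (hk : k < Y.W) :
    (Y.coord a)[(Y.A a + 1) * k]? = some (.cell (Y.cell a k)) := by
  have h : (Y.A a + 1) * k < Y.W * (Y.A a + 1) := by
    rw [mul_comm]; exact Nat.mul_lt_mul_of_pos_right hk (Nat.succ_pos _)
  rw [coord, List.getElem?_map, List.getElem?_range h]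
  simp

theorem coord_unit {a : Bool} {k i : ℕ} (hk : k < Y.W) (hi : i < Y.A a) :
    (Y.coord a)[(Y.A a + 1) * k + 1 + i]? = some .unit := by
  have h : (Y.A a + 1) * k + 1 + i < Y.W * (Y.A a + 1) := by
    have : (Y.A a + 1) * (k + 1) ≤ (Y.A a + 1) * Y.W := Nat.mul_le_mul_left _ hk
    rw [mul_comm Y.W]
    rw [mul_add] at this
    omega
  rw [coord, List.getElem?_map, List.getElem?_range h]
  simp [add_assoc, Nat.mod_eq_of_lt (show 1 + i < Y.A a + 1 by omega)]

/-- The tape with the shift lengths `S`. -/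
def blocks (S : List ℕ) : List (TabSym n) := S.flatMap fun s => List.replicate s .unit ++ [.sep]

/-- The total shift for the digits `bs`. -/
def dot : List ℕ → List Bool → ℕ
  | s :: S, b :: bs => (if b then s else 0) + dot S bs
  | _, _ => 0

theorem dot_le_sum (S : List ℕ) (bs : List Bool) : dot S bs ≤ S.sum := by
  induction S generalizing bs with
  | nil => simp [dot]
  | cons s S ih =>
    cases bs with
    | nil => simp [dot]
    | cons b bs =>
      have := ih bs
      rw [dot, List.sum_cons]
      split <;> omega

/-- The stacks with coordinate tapes at `p` and the value tape at `q`. -/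
def stk (p : Bool → ℕ) (q : ℕ) (src goal kl kr pend : List (TabSym n)) :
    TabStk → List (TabSym n)
  | .inp => [.bot]
  | .src => src
  | .goal => goal
  | .lo a => ((Y.coord a).take (p a)).reverse
  | .hi a => (Y.coord a).drop (p a)
  | .kl => kl
  | .kr => kr
  | .vl => ((Y.V.map .val).take q).reverse
  | .vr => (Y.V.map .val).drop q
  | .pend => pend

theorem drop_eq_cons {α : Type} {l : List α} {p : ℕ} {s : α} (h : l[p]? = some s) :
    l.drop p = s :: l.drop (p + 1) := by
  obtain ⟨hp, rfl⟩ := List.getElem?_eq_some_iff.1 h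
  exact List.drop_eq_getElem_cons hp

theorem take_succ_eq {α : Type} {l : List α} {p : ℕ} {s : α} (h : l[p]? = some s) :
    l.take (p + 1) = l.take p ++ [s] := by
  rw [List.take_add_one, h]; rfl

variable {Y} {pat : I → List (TabSym n)} {src goal kl kr pend : List (TabSym n)}

theorem step_right {a : Bool} {p : Bool → ℕ} {q : ℕ} (hp : (Y.coord a)[p a]? = some .unit)
    (hq : q < Y.V.length) :
    TabReach pat 1 (.moving a true, Y.stk p q src goal kl kr pend)
      (.moving a true, Y.stk (Function.update p a (p a + 1)) (q + 1) src goal kl kr pend) := by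
  have hv : (Y.V.map (TabSym.val (n := n)))[q]? = some (.val Y.V[q]) := by simp [hq]
  refine .single (.step a true Y.V[q]) le_rfl rfl (fun k => ?_) rfl (fun k => ?_)
  · rcases k with _ | _ | _ | a' | a' | _ | _ | _ | _ | _ <;> try simp [tabRule]
    · by_cases h : a' = a
      · subst h; simp [stk, drop_eq_cons hp]
      · simp [h]
    · simp only [stk]; rw [drop_eq_cons hv]; simp
  · rcases k with _ | _ | _ | a' | a' | _ | _ | _ | _ | _ <;> try simp [tabRule, stk]
    · by_cases h : a' = a
      · subst h; simp [take_succ_eq hp]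
      · simp [h]
    · by_cases h : a' = a
      · subst h; simp
      · simp [h]
    · rw [take_succ_eq hv]

theorem step_left {a : Bool} {p : Bool → ℕ} {q j : ℕ} (hp : (Y.coord a)[j]? = some .unit)
    (hj : p a = j + 1) (hq : q < Y.V.length) :
    TabReach pat 1 (.moving a false, Y.stk p (q + 1) src goal kl kr pend)
      (.moving a false, Y.stk (Function.update p a j) q src goal kl kr pend) := by
  have hv : (Y.V.map (TabSym.val (n := n)))[q]? = some (.val Y.V[q]) := by simp [hq]
  refine .single (.step a false Y.V[q]) le_rfl rfl (fun k => ?_) rfl (fun k => ?_)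
  · rcases k with _ | _ | _ | a' | a' | _ | _ | _ | _ | _ <;> try simp [tabRule]
    · by_cases h : a' = a
      · subst h; simp [stk, hj, take_succ_eq hp]
      · simp [h]
    · simp only [stk]; rw [take_succ_eq hv]; simp
  · rcases k with _ | _ | _ | a' | a' | _ | _ | _ | _ | _ <;> try simp [tabRule, stk]
    · by_cases h : a' = a
      · subst h; simp [hj, take_succ_eq hp]
      · simp [h]
    · by_cases h : a' = a
      · subst h; simp [hj, drop_eq_cons hp]
      · simp [h]
    · rw [take_succ_eq hv]; simp
    · rw [drop_eq_cons hv]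

theorem steps_right {a : Bool} {p : Bool → ℕ} {q j : ℕ}
    (hp : ∀ i < j, (Y.coord a)[p a + i]? = some .unit) (hq : q + j ≤ Y.V.length) :
    TabReach pat j (.moving a true, Y.stk p q src goal kl kr pend)
      (.moving a true, Y.stk (Function.update p a (p a + j)) (q + j) src goal kl kr pend) := by
  induction j with
  | zero => simpa using TabReach.refl _ _ _
  | succ j ih =>
    refine (ih (fun i hi => hp i (by omega)) (by omega)).trans (t' := 1) ?_ le_rfl
    have := step_right (pat := pat) (src := src) (goal := goal) (kl := kl) (kr := kr)
      (pend := pend) (p := Function.update p a (p a + j)) (a := a) (Y := Y) (q := q + j)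
      (by simpa using hp j (by omega)) (by omega)
    simpa [add_assoc] using this

theorem steps_left {a : Bool} {p : Bool → ℕ} {q j x : ℕ} (hx : p a = x + j)
    (hp : ∀ i < j, (Y.coord a)[x + i]? = some .unit) (hq : q + j ≤ Y.V.length) :
    TabReach pat j (.moving a false, Y.stk p (q + j) src goal kl kr pend)
      (.moving a false, Y.stk (Function.update p a x) q src goal kl kr pend) := by
  induction j generalizing p with
  | zero =>
    have : Function.update p a x = p := by
      rw [Function.update_eq_self_iff]; exact hx.symm
    rw [this]
    exact TabReach.refl _ _ _
  | succ j ih =>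
    have h1 := step_left (pat := pat) (src := src) (goal := goal) (kl := kl) (kr := kr)
      (pend := pend) (p := p) (a := a) (Y := Y) (q := q + j) (hp j (by omega)) hx (by omega)
    have h2 := ih (p := Function.update p a (x + j)) (by simp) (fun i hi => hp i (by omega))
      (by omega)
    rw [Function.update_idem] at h2
    exact h1.trans h2 (by omega)

variable (Y) in
/-- The position of the value tape at the cell with coordinates `k`. -/
def valPos (k : Bool → ℕ) : ℕ := Y.A false * k false + Y.A true * k true

variable (Y) in
/-- The stacks at the cell with coordinates `k`. -/
def atCell (k : Bool → ℕ) (src goal : List (TabSym n)) : TabStk → List (TabSym n) :=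
  Y.stk (fun a => (Y.A a + 1) * k a) (Y.valPos k) src goal [.bot] (blocks Y.S) [.bot]

variable (Y) in
/-- The value tape is long enough. -/
def Long : Prop := ∀ k : Bool → ℕ, (∀ a, k a < Y.W) → Y.valPos k + Y.S.sum < Y.V.length

theorem valPos_update (k : Bool → ℕ) (a : Bool) :
    Y.valPos (Function.update k a (k a + 1)) = Y.valPos k + Y.A a := by
  cases a <;> simp [valPos, mul_add] <;> omega

theorem pos_update (k : Bool → ℕ) (a : Bool) (j : ℕ) :
    (fun b => (Y.A b + 1) * Function.update k a j b) =
      Function.update (fun b => (Y.A b + 1) * k b) a ((Y.A a + 1) * j) := by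
  funext b
  by_cases h : b = a
  · subst h; simp
  · simp [h]

/-- Between neighbouring cells of axis `a` lie exactly `Y.A a` units, so the value head advances by
the coefficient of that axis and stays at `valPos`. The two extra steps are the departure and the
arrival. -/
theorem move_right (hY : Y.Long) {k : Bool → ℕ} (hk : ∀ a, k a < Y.W) {a : Bool}
    (ha : k a + 1 < Y.W) :
    TabReach pat (Y.A a + 2) (.depart a true, Y.atCell k src goal)
      (.main, Y.atCell (Function.update k a (k a + 1)) src goal) := by
  have hc := Y.coord_cell (a := a) (hk a)
  have hk' : ∀ b, Function.update k a (k a + 1) b < Y.W := by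
    intro b
    by_cases h : b = a
    · subst h; simpa
    · simpa [h] using hk b
  -- Applied at the target cell, this ensures that the value tape does not run out during the move.
  have hl := hY _ hk'
  rw [valPos_update] at hl
  rw [atCell, atCell, pos_update, valPos_update]
  set p : Bool → ℕ := fun b => (Y.A b + 1) * k b with hp
  refine TabReach.head (t := Y.A a + 1) (c' := (.moving a true,
    Y.stk (Function.update p a (p a + 1)) (Y.valPos k) src goal [.bot] (blocks Y.S) [.bot]))
    (.depart a true (Y.cell a (k a))) ?_ rfl (fun k => ?_) rfl (fun k => ?_) le_rfl
  · have h1 := steps_right (pat := pat) (src := src) (goal := goal) (kl := [.bot])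
      (kr := blocks Y.S) (pend := [.bot]) (p := Function.update p a (p a + 1)) (a := a) (Y := Y)
      (q := Y.valPos k) (j := Y.A a)
      (fun i hi => by simpa using Y.coord_unit (hk a) hi) (by omega)
    rw [Function.update_idem, Function.update_self] at h1
    have e : p a + 1 + Y.A a = (Y.A a + 1) * (k a + 1) := by simp only [hp]; ring
    rw [e] at h1
    refine h1.trans (t' := 1) (TabReach.single (.arrive a true (Y.cell a (k a + 1))) le_rfl rfl
      (fun j => ?_) rfl (fun j => ?_)) le_rfl
    · rcases j with _ | _ | _ | a' | a' | _ | _ | _ | _ | _ <;> try simp [tabRule]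
      by_cases h : a' = a
      · subst h; simp [stk, drop_eq_cons (Y.coord_cell ha)]
      · simp [h]
    · rcases j with _ | _ | _ | a' | a' | _ | _ | _ | _ | _ <;> try simp [tabRule, stk]
      by_cases h : a' = a
      · subst h; simp [drop_eq_cons (Y.coord_cell ha)]
      · simp [h]
  · rcases k with _ | _ | _ | a' | a' | _ | _ | _ | _ | _ <;> try simp [tabRule]
    by_cases h : a' = a
    · subst h; simp [stk, hp, drop_eq_cons hc]
    · simp [h]
  · rcases k with _ | _ | _ | a' | a' | _ | _ | _ | _ | _ <;> try simp [tabRule, stk]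
    · by_cases h : a' = a
      · subst h; simp [hp, take_succ_eq hc]
      · simp [h]
    · by_cases h : a' = a
      · subst h; simp
      · simp [h]

theorem move_left (hY : Y.Long) {k : Bool → ℕ} (hk : ∀ a, k a < Y.W) {a : Bool} {j : ℕ}
    (ha : k a = j + 1) :
    TabReach pat (Y.A a + 2) (.depart a false, Y.atCell k src goal)
      (.main, Y.atCell (Function.update k a j) src goal) := by
  have hc := Y.coord_cell (a := a) (hk a)
  have hj : j < Y.W := by have := hk a; omega
  have hc' := Y.coord_cell (a := a) hj
  have hl := hY _ hk
  have e : Y.valPos k = Y.valPos (Function.update k a j) + Y.A a := by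
    rw [← valPos_update]; simp [← ha]
  rw [atCell, atCell, pos_update]
  rw [e] at hl ⊢
  set p : Bool → ℕ := fun b => (Y.A b + 1) * k b with hp
  refine TabReach.head (t := Y.A a + 1) (c' := (.moving a false,
    Y.stk p (Y.valPos (Function.update k a j) + Y.A a) src goal [.bot] (blocks Y.S) [.bot]))
    (.depart a false (Y.cell a (k a))) ?_ rfl (fun k => ?_) rfl (fun k => ?_) le_rfl
  · have h1 := steps_left (pat := pat) (src := src) (goal := goal) (kl := [.bot])
      (kr := blocks Y.S) (pend := [.bot]) (p := p) (a := a) (Y := Y)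
      (q := Y.valPos (Function.update k a j)) (j := Y.A a) (x := (Y.A a + 1) * j + 1)
      (by simp only [hp, ha]; ring)
      (fun i hi => Y.coord_unit hj hi) (by omega)
    refine h1.trans (t' := 1) (TabReach.single (.arrive a false (Y.cell a j)) le_rfl rfl
      (fun j' => ?_) rfl (fun j' => ?_)) le_rfl
    · rcases j' with _ | _ | _ | a' | a' | _ | _ | _ | _ | _ <;> try simp [tabRule]
      by_cases h : a' = a
      · subst h; simp [stk, take_succ_eq hc']
      · simp [h]
    · rcases j' with _ | _ | _ | a' | a' | _ | _ | _ | _ | _ <;> try simp [tabRule, stk]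
      · by_cases h : a' = a
        · subst h; simp [take_succ_eq hc']
        · simp [h]
      · by_cases h : a' = a
        · subst h; simp [drop_eq_cons hc']
        · simp [h]
  · rcases k with _ | _ | _ | a' | a' | _ | _ | _ | _ | _ <;> try simp [tabRule]
    by_cases h : a' = a
    · subst h; simp [stk, hp, drop_eq_cons hc]
    · simp [h]
  · rcases k with _ | _ | _ | a' | a' | _ | _ | _ | _ | _ <;> try simp [tabRule, stk]
    by_cases h : a' = a
    · subst h; simp [hp, drop_eq_cons hc]
    · simp [h]

end Layout

end SpatialLogic

-- Looking up an atomic proposition on the value tape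

namespace SpatialLogic

variable {n : ℕ} {I : Type}

namespace Layout

variable {Y : Layout n} {pat : I → List (TabSym n)} {src goal kl kr pend : List (TabSym n)}

theorem skip_run {p : Bool → ℕ} {q : ℕ} (b : Bool) (s : ℕ) :
    TabReach pat s
      (.pass b false, Y.stk p q src goal kl (List.replicate s .unit ++ kr) pend)
      (.pass b false, Y.stk p q src goal (List.replicate s .unit ++ kl) kr pend) := by
  induction s generalizing kl with
  | zero => exact .refl _ _ _
  | succ s ih =>
    refine TabReach.head (.skip b) (ih (kl := .unit :: kl)) rfl (fun k => ?_) rfl (fun k => ?_)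
      le_rfl |>.trans (t' := 0) ?_ le_rfl
    · cases k <;> simp [tabRule, stk, List.replicate_succ]
    · cases k <;> simp [tabRule, stk, List.replicate_succ]
    · rw [show List.replicate s TabSym.unit ++ .unit :: kl =
        List.replicate (s + 1) (TabSym.unit (n := n)) ++ kl by
          rw [List.replicate_succ']; simp]
      exact .refl _ _ _

theorem shift_run {p : Bool → ℕ} {q : ℕ} (b : Bool) (s : ℕ) (hq : q + s ≤ Y.V.length) :
    TabReach pat s
      (.pass b true, Y.stk p q src goal kl (List.replicate s .unit ++ kr) pend)
      (.pass b true, Y.stk p (q + s) src goal (List.replicate s .unit ++ kl) kr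
        (List.replicate s .unit ++ pend)) := by
  induction s generalizing kl pend q with
  | zero => exact .refl _ _ _
  | succ s ih =>
    have hq' : q < Y.V.length := by omega
    have hv : (Y.V.map (TabSym.val (n := n)))[q]? = some (.val Y.V[q]) := by simp [hq']
    have h := ih (kl := .unit :: kl) (pend := .unit :: pend) (q := q + 1) (by omega)
    have e : ∀ l : List (TabSym n), List.replicate s TabSym.unit ++ .unit :: l =
        List.replicate (s + 1) .unit ++ l := fun l => by
      rw [List.replicate_succ']; simp
    rw [e, e, add_assoc, add_comm 1 s] at h
    refine TabReach.head (.shift b Y.V[q]) h rfl (fun k => ?_) rfl (fun k => ?_) le_rfl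
    · cases k <;> try simp [tabRule, stk, List.replicate_succ]
      rw [drop_eq_cons hv]; simp
    · cases k <;> try simp [tabRule, stk, List.replicate_succ]
      rw [take_succ_eq hv]

theorem block_run {p : Bool → ℕ} {q : ℕ} (b c : Bool) (s : ℕ)
    (hq : q + (if c then s else 0) ≤ Y.V.length) :
    TabReach pat (s + 1)
      (.pass b c, Y.stk p q src goal kl (List.replicate s .unit ++ .sep :: kr) pend)
      (.next b c, Y.stk p (q + if c then s else 0) src goal
        (.sep :: (List.replicate s .unit ++ kl)) kr
        (List.replicate (if c then s else 0) .unit ++ pend)) := by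
  have hlast : ∀ q pend, TabReach pat 1
      (.pass b c, Y.stk p q src goal (List.replicate s .unit ++ kl) (.sep :: kr) pend)
      (.next b c, Y.stk p q src goal (.sep :: (List.replicate s .unit ++ kl)) kr pend) := by
    intro q pend
    refine TabReach.single (.blockEnd b c) le_rfl rfl (fun k => ?_) rfl (fun k => ?_) <;>
      cases k <;> simp [tabRule, stk]
  cases c with
  | false =>
    refine (skip_run b s).trans ?_ le_rfl
    simpa using hlast q pend
  | true =>
    refine (shift_run b s (by simpa using hq)).trans ?_ le_rfl
    simpa using hlast (q + s) _

/-- Each digit consumes one block of the shift tape, and the value head moves only in blocks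
belonging to the digit one; altogether it moves by the digit part of the linear form. The passed
symbols `ks` and the units added to `pend` record what must be undone. -/
theorem bits_run {p : Bool → ℕ} {q : ℕ} (b l : Bool) (bs : List Bool) (S : List ℕ)
    (hS : bs.length ≤ S.length) (hq : q + dot S bs ≤ Y.V.length) :
    ∃ (ks kr : List (TabSym n)), (∀ s ∈ ks, s = .unit ∨ s = .sep) ∧
      ks.reverse ++ kr = blocks S ∧ ks.length ≤ S.sum + S.length ∧
      TabReach pat (S.sum + 2 * S.length)
        (.next b l, Y.stk p q (bs.map (fun b => .tok (.inl (Tok.bit b))) ++ src) goal kl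
          (blocks S) pend)
        (.next b ((l :: bs).getLast (by simp)), Y.stk p (q + dot S bs) src goal (ks ++ kl) kr
          (List.replicate (dot S bs) .unit ++ pend)) := by
  induction bs generalizing S kl pend q l with
  | nil =>
    refine ⟨[], blocks S, by simp, rfl, by simp, ?_⟩
    cases S <;> simpa [dot] using TabReach.refl _ _ _
  | cons c bs ih =>
    cases S with
    | nil => simp at hS
    | cons s S =>
      rw [dot] at hq ⊢
      obtain ⟨ks, kr, h1, h2, h3, h4⟩ := ih (l := c) (S := S) (q := q + if c then s else 0)
        (kl := .sep :: (List.replicate s .unit ++ kl))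
        (pend := List.replicate (if c then s else 0) .unit ++ pend)
        (by simpa using hS) (by omega)
      refine ⟨ks ++ .sep :: List.replicate s .unit, kr, ?_, ?_, ?_, ?_⟩
      · intro x hx
        simp only [List.mem_append, List.mem_cons, List.mem_replicate] at hx
        rcases hx with hx | rfl | ⟨-, rfl⟩
        · exact h1 x hx
        · exact .inr rfl
        · exact .inl rfl
      · simp only [blocks, List.flatMap_cons] at h2 ⊢
        simp [← h2]
      · simp only [List.length_append, List.length_cons, List.length_replicate, List.sum_cons]
        omega
      · have hb := block_run (pat := pat) (src := bs.map (fun b => .tok (.inl (Tok.bit b))) ++ src)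
          (goal := goal) (kl := kl) (kr := blocks S) (pend := pend) (p := p) (Y := Y) (q := q)
          b c s (by omega)
        have h5 := hb.trans h4 le_rfl
        have e : List.replicate ((if c then s else 0) + dot S bs) TabSym.unit ++ pend =
            List.replicate (dot S bs) TabSym.unit ++
              (List.replicate (if c then s else 0) .unit ++ pend) := by
          rw [add_comm, List.replicate_add, List.append_assoc]
        rw [e, List.getLast_cons (by simp), ← add_assoc]
        rw [show (ks ++ .sep :: List.replicate s .unit) ++ kl =
          ks ++ .sep :: (List.replicate s .unit ++ kl) by simp]
        refine TabReach.head (.bit b l c) h5 rfl (fun k => ?_) rfl (fun k => ?_) ?_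
        · cases k <;> simp [tabRule, stk]
        · cases k <;> simp [tabRule, stk, blocks]
        · simp only [List.sum_cons, List.length_cons]; omega

/-- The shift tape and the value tape are wound back separately: `ks` says how far for the former,
the units on `pend` for the latter. -/
theorem rewind_run {p : Bool → ℕ} {q : ℕ} (ks : List (TabSym n))
    (hks : ∀ s ∈ ks, s = .unit ∨ s = .sep) (d : ℕ) (hq : q + d ≤ Y.V.length) :
    TabReach pat (ks.length + d + 1)
      (.rewind, Y.stk p (q + d) src goal (ks ++ [.bot]) kr (List.replicate d .unit ++ [.bot]))
      (.main, Y.stk p q src goal [.bot] (ks.reverse ++ kr) [.bot]) := by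
  induction ks generalizing kr with
  | nil =>
    induction d with
    | zero =>
      refine TabReach.single .rewindDone (by simp) rfl (fun k => ?_) rfl (fun k => ?_) <;>
        cases k <;> simp [tabRule, stk]
    | succ d ih =>
      have hq' : q + d < Y.V.length := by omega
      have hv : (Y.V.map (TabSym.val (n := n)))[q + d]? = some (.val Y.V[q + d]) := by simp [hq']
      refine TabReach.head (.unshift Y.V[q + d]) (ih (by omega)) rfl (fun k => ?_) rfl
        (fun k => ?_) (by simp)
      · cases k <;> try simp [tabRule, stk, List.replicate_succ]
        rw [← add_assoc, take_succ_eq hv]; simp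
      · cases k <;> try simp [tabRule, stk, List.replicate_succ]
        · rw [← add_assoc, take_succ_eq hv]; simp
        · rw [drop_eq_cons hv]; rfl
  | cons s ks ih =>
    have h := ih (kr := s :: kr) (fun x hx => hks x (by simp [hx]))
    rw [show (s :: ks).reverse ++ kr = ks.reverse ++ s :: kr by simp]
    rcases hks s (by simp) with rfl | rfl
    · refine TabReach.head .rewindUnit h rfl (fun k => ?_) rfl (fun k => ?_)
        (by simp only [List.length_cons]; omega) <;>
        cases k <;> simp [tabRule, stk]
    · refine TabReach.head .rewindSep h rfl (fun k => ?_) rfl (fun k => ?_)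
        (by simp only [List.length_cons]; omega) <;>
        cases k <;> simp [tabRule, stk]

theorem getLast_true_cons_bits (k : ℕ) : (true :: Nat.bits k).getLast (by simp) = true := by
  induction k using Nat.binaryRec' with
  | zero => simp
  | bit b k h ih =>
    rw [Nat.bits_append_bit _ _ h]
    by_cases hk : k = 0
    · subst hk; simp [h rfl]
    · have : Nat.bits k ≠ [] := by
        intro e; apply hk
        have := congrArg List.length e
        rw [Nat.size_eq_bits_len] at this
        exact Nat.size_eq_zero.1 (by simpa using this)
      rw [List.getLast_cons this] at ih
      rw [List.getLast_cons (by simp), List.getLast_cons this, ih]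

/-- A lookup restores every tape, so atoms can be evaluated one after another from the same layout.
The bound counts at most one pass over the shift tape each way, the steps for the digits, and the
undoing of the shifts. -/
theorem atom_run {N : ℕ∞} (hpat : PatSpec N pat) (hY : Y.Long) {k : Bool → ℕ}
    (hk : ∀ a, k a < Y.W) (i : Atom N) (b : Bool) (t : Follow n) (r : List (TabSym n))
    (hi : (Nat.bits i.1).length ≤ Y.S.length)
    (hV : Y.V[Y.valPos k + dot Y.S (Nat.bits i.1)]? = some b) :
    TabReach pat (3 * Y.S.sum + 3 * Y.S.length + 3)
      (.main, Y.atCell k (.tok (.inl .atom) ::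
        (Nat.bits i.1).map (fun b => .tok (.inl (Tok.bit b))) ++ t.sym :: r) (.eval b :: goal))
      (.main, Y.atCell k (t.sym :: r) goal) := by
  obtain ⟨j, rest, hj⟩ := (hpat i.1 t r).2 i.2
  have hle := dot_le_sum Y.S (Nat.bits i.1)
  have hl := hY k hk
  obtain ⟨ks, kr, h1, h2, h3, h4⟩ := bits_run (pat := pat) (src := t.sym :: r) (goal := goal)
    (kl := [.bot]) (pend := [.bot]) (Y := Y) (p := fun a => (Y.A a + 1) * k a)
    (q := Y.valPos k) b true (Nat.bits i.1) Y.S hi (by omega)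
  rw [getLast_true_cons_bits] at h4
  have h5 := rewind_run (pat := pat) (src := t.sym :: r) (goal := goal) (kr := kr) (Y := Y)
    (p := fun a => (Y.A a + 1) * k a) (q := Y.valPos k) ks h1 (dot Y.S (Nat.bits i.1)) (by omega)
  rw [h2] at h5
  have hv : (Y.V.map (TabSym.val (n := n)))[Y.valPos k + dot Y.S (Nat.bits i.1)]? =
    some (.val b) := by simp [hV]
  have h6 : TabReach pat (ks.length + dot Y.S (Nat.bits i.1) + 2)
      (.next b true, Y.stk (fun a => (Y.A a + 1) * k a) (Y.valPos k + dot Y.S (Nat.bits i.1))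
        (t.sym :: r) goal (ks ++ [.bot]) kr
        (List.replicate (dot Y.S (Nat.bits i.1)) .unit ++ [.bot]))
      (.main, Y.atCell k (t.sym :: r) goal) := by
    refine TabReach.head (.read b t) h5 rfl (fun k' => ?_) rfl (fun k' => ?_) le_rfl
    · cases k' <;> try simp [tabRule, stk]
      rw [drop_eq_cons hv]; simp
    · cases k' <;> try simp [tabRule, stk]
      rw [drop_eq_cons hv]
  refine TabReach.head (.atom b j (Y.cell false (k false)) (Y.cell true (k true)))
    (h4.trans h6 le_rfl) rfl (fun k' => ?_) rfl (fun k' => ?_) (by omega)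
  · rcases k' with _ | _ | _ | a' | (_ | _) | _ | _ | _ | _ | _ <;>
      try simp [tabRule, atCell, stk]
    · exact ⟨rest, hj⟩
    · rw [drop_eq_cons (Y.coord_cell (hk false))]; simp
    · rw [drop_eq_cons (Y.coord_cell (hk true))]; simp
  · rcases k' with _ | _ | _ | a' | (_ | _) | _ | _ | _ | _ | _ <;>
      try simp [tabRule, atCell, stk]
    · rw [← hj]; simp
    · rw [drop_eq_cons (Y.coord_cell (hk false))]
    · rw [drop_eq_cons (Y.coord_cell (hk true))]

end Layout

end SpatialLogic

-- Evaluating a basic formula along a satisfying model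

namespace SpatialLogic

variable {n : ℕ} {I : Type}

/-- The atomic propositions, with the positions at which they are evaluated, on which the truth of
a basic formula at `u` depends. -/
def Form.keys {Atm Agt : Type} : Form Atm Agt → ℤ × ℤ → List ((ℤ × ℤ) × Atm)
  | .atom p, u => [(u, p)]
  | .here _, _ => []
  | .neg φ, u => φ.keys u
  | .and φ ψ, u => φ.keys u ++ ψ.keys u
  | .box .up φ, u => φ.keys (neighbour true true u)
  | .box .down φ, u => φ.keys (neighbour true false u)
  | .box .right φ, u => φ.keys (neighbour false true u)
  | .box .left φ, u => φ.keys (neighbour false false u)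
  | .box _ _, _ => []

theorem keys_box_dirProg {Atm Agt : Type} (a d : Bool) (φ : Form Atm Agt) (u : ℤ × ℤ) :
    (Form.box (dirProg a d) φ).keys u = φ.keys (neighbour a d u) := by
  cases a <;> cases d <;> simp [dirProg, Form.keys]

/-- No formula begins with a digit; hence a numeral directly followed by another formula ends
unambiguously. -/
theorem exists_follow {N : ℕ∞} (φ : Form (Atom N) (Fin n)) (r : List (TabSym n)) :
    ∃ (t : Follow n) (r' : List (TabSym n)), φ.encode.map .tok ++ r = t.sym :: r' := by
  have key : ∀ (s : Sym n) (l : List (Sym n)), (∀ b, s ≠ .inl (Tok.bit b)) →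
      ∃ (t : Follow n) (r' : List (TabSym n)), (s :: l).map .tok ++ r = t.sym :: r' :=
    fun s l h => ⟨⟨some s, fun b hb => h b (by simpa using hb)⟩, l.map .tok ++ r, rfl⟩
  cases φ <;> rw [Form.encode] <;> refine key _ _ ?_ <;> rintro (_ | _) <;> simp [Tok.bit]

/-- The cell with coordinates `k` as a position. -/
def cellPos (o : ℤ × ℤ) (k : Bool → ℕ) : ℤ × ℤ := (o.1 + k false, o.2 + k true)

theorem neighbour_cellPos_true (o : ℤ × ℤ) (k : Bool → ℕ) (a : Bool) :
    neighbour a true (cellPos o k) = cellPos o (Function.update k a (k a + 1)) := by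
  cases a <;> simp [neighbour, cellPos, add_assoc]

theorem neighbour_cellPos_false (o : ℤ × ℤ) (k : Bool → ℕ) (a : Bool) {j : ℕ} (h : k a = j + 1) :
    neighbour a false (cellPos o k) = cellPos o (Function.update k a j) := by
  cases a <;> simp [neighbour, cellPos, h, add_sub_assoc]

namespace Layout

variable {Y : Layout n} {pat : I → List (TabSym n)}

variable (Y) in
/-- The position on the value tape of an atomic proposition at a position of the grid. -/
def index {N : ℕ∞} (o : ℤ × ℤ) (key : (ℤ × ℤ) × Atom N) : ℕ :=
  Y.A false * (key.1.1 - o.1).toNat + Y.A true * (key.1.2 - o.2).toNat +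
    dot Y.S (Nat.bits key.2.1)

theorem index_cellPos {N : ℕ∞} (o : ℤ × ℤ) (k : Bool → ℕ) (i : Atom N) :
    Y.index o (cellPos o k, i) = Y.valPos k + dot Y.S (Nat.bits i.1) := by
  simp [index, cellPos, valPos]

/-- The run guesses the actual truth values of the subformulas in `M`. The margin around the cell
shrinks with the length of the formula: each modality costs at least as many symbols as cells, so
the walk never leaves the window. The cost is charged as `B` per symbol. -/
theorem eval_run {N : ℕ∞} (hpat : PatSpec N pat) (hY : Y.Long) {M : SpatialModel (Atom N) (Fin n)}
    {o : ℤ × ℤ} (hc : ∀ i k, i ∈ Y.cell false k ↔ (M.P i).1 = o.1 + k)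
    (hc' : ∀ i k, i ∈ Y.cell true k ↔ (M.P i).2 = o.2 + k) {B : ℕ}
    (hB : 3 * Y.S.sum + 3 * Y.S.length + Y.A false + Y.A true + 3 ≤ B)
    (φ : Form (Atom N) (Fin n)) (hφ : φ.Basic) {k : Bool → ℕ}
    (hk : ∀ a, φ.encode.length ≤ k a ∧ k a + φ.encode.length ≤ Y.W)
    (hS : φ.encode.length ≤ Y.S.length) {b : Bool}
    (hV : ∀ key ∈ φ.keys (cellPos o k), ∃ c : Bool, Y.V[Y.index o key]? = some c ∧
      (c = true ↔ key.2 ∈ M.V key.1))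
    (hb : φ.Holds M (cellPos o k) ↔ b = true) (t : Follow n) (r goal : List (TabSym n)) :
    TabReach pat (B * φ.encode.length)
      (.main, Y.atCell k (φ.encode.map .tok ++ t.sym :: r) (.eval b :: goal))
      (.main, Y.atCell k (t.sym :: r) goal) := by
  have hlt : ∀ (ψ : Form (Atom N) (Fin n)), 0 < ψ.encode.length := fun ψ => by
    cases ψ <;> simp [Form.encode]
  have hkW : ∀ a, k a < Y.W := fun a => by have := hk a; have := hlt φ; omega
  induction φ using Form.rec (motive_1 := fun _ => True) generalizing k b t r goal with
  | atom i =>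
    obtain ⟨c, h1, h2⟩ := hV (cellPos o k, i) (by simp [Form.keys])
    have : c = b := by
      change i ∈ M.V (cellPos o k) ↔ b = true at hb
      rw [Bool.eq_iff_iff, h2, ← hb]
    subst this
    rw [index_cellPos] at h1
    have := atom_run (goal := goal) hpat hY hkW i c t r
      (by simp only [Form.encode, List.length_cons, List.length_map] at hS; omega) h1
    rw [Form.encode, List.map_cons, List.map_map]
    refine this.mono ?_
    refine le_trans (by omega) (Nat.le_mul_of_pos_right B (by simp))
  | here i =>
    have : b = decide (i ∈ Y.cell false (k false) ∧ i ∈ Y.cell true (k true)) := by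
      rw [Bool.eq_iff_iff, ← hb, decide_eq_true_eq, hc, hc']
      exact Prod.ext_iff
    subst this
    refine TabReach.single (.here i (Y.cell false (k false)) (Y.cell true (k true)))
      (by simp [Form.encode]; omega) rfl (fun k' => ?_) rfl (fun k' => ?_)
    · rcases k' with _ | _ | _ | a' | (_ | _) | _ | _ | _ | _ | _ <;>
        try simp [tabRule, atCell, stk, Form.encode]
      · rw [drop_eq_cons (Y.coord_cell (hkW false))]; simp
      · rw [drop_eq_cons (Y.coord_cell (hkW true))]; simp
    · rcases k' with _ | _ | _ | a' | (_ | _) | _ | _ | _ | _ | _ <;>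
        try simp [tabRule, atCell, stk, Form.encode]
      · rw [drop_eq_cons (Y.coord_cell (hkW false))]
      · rw [drop_eq_cons (Y.coord_cell (hkW true))]
  | neg φ ih =>
    have hl : (Form.neg φ).encode.length = φ.encode.length + 1 := by simp [Form.encode]
    rw [hl] at hk hS ⊢
    refine TabReach.head (.neg b) (ih (k := k) (b := !b) hφ
      (fun a => by have := hk a; omega) (by omega) hV ?_ t r goal hkW) rfl (fun k' => ?_) rfl
      (fun k' => ?_) (by rw [mul_add]; omega)
    · have : ¬ φ.Holds M (cellPos o k) ↔ b = true := hb
      rw [← not_iff_not, this]; simp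
    · cases k' <;> simp [tabRule, atCell, stk, Form.encode]
    · cases k' <;> simp [tabRule, atCell, stk, Form.encode]
  | and φ ψ ih ih' =>
    have hl : (Form.and φ ψ).encode.length = φ.encode.length + ψ.encode.length + 1 := by
      simp [Form.encode]
    rw [hl] at hk hS ⊢
    obtain ⟨t', r', ht'⟩ := exists_follow ψ (t.sym :: r)
    classical
    have h2 := ih' (k := k) (b := decide (ψ.Holds M (cellPos o k))) hφ.2
      (fun a => by have := hk a; omega) (by omega)
      (fun key h => hV key (by simp [Form.keys, h])) (by simp) t r goal hkW
    rw [ht'] at h2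
    have h1 := ih (k := k) (b := decide (φ.Holds M (cellPos o k))) hφ.1
      (fun a => by have := hk a; omega) (by omega)
      (fun key h => hV key (by simp [Form.keys, h])) (by simp) t' r'
      (.eval (decide (ψ.Holds M (cellPos o k))) :: goal) hkW
    have : b = (decide (φ.Holds M (cellPos o k)) && decide (ψ.Holds M (cellPos o k))) := by
      rw [Bool.eq_iff_iff, ← hb, Form.Holds]; simp
    subst this
    refine TabReach.head (.and (decide (φ.Holds M (cellPos o k)))
      (decide (ψ.Holds M (cellPos o k)))) (h1.trans h2 le_rfl) rfl (fun k' => ?_) rfl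
      (fun k' => ?_) (by rw [mul_add, mul_add]; omega)
    · cases k' <;> simp [tabRule, atCell, stk, Form.encode]
    · cases k' <;> simp [tabRule, atCell, stk, Form.encode, ht']
  | box α φ _ ih =>
    obtain ⟨a, d, rfl⟩ := exists_dirProg hφ.1
    have hl : (Form.box (dirProg a d) φ).encode.length = φ.encode.length + 2 := by
      simp [Form.encode, encode_dirProg]
    rw [hl] at hk hS ⊢
    rw [keys_box_dirProg] at hV
    rw [holds_box_dirProg] at hb
    -- The two symbols of a modality pay for the rule itself, the move out, popping the goal of the
    -- move back, and the move back.
    have hA : 2 * Y.A a + 6 ≤ 2 * B := by cases a <;> omega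
    obtain ⟨k', hk', hk'', hu, h1, h2⟩ : ∃ k' : Bool → ℕ,
        (∀ a', φ.encode.length ≤ k' a' ∧ k' a' + φ.encode.length ≤ Y.W) ∧ (∀ a', k' a' < Y.W) ∧
        neighbour a d (cellPos o k) = cellPos o k' ∧
        (∀ src goal, TabReach pat (Y.A a + 2) (.depart a d, Y.atCell k src goal)
          (.main, Y.atCell k' src goal)) ∧
        (∀ src goal, TabReach pat (Y.A a + 2) (.depart a (!d), Y.atCell k' src goal)
          (.main, Y.atCell k src goal)) := by
      have hka := hk a
      have hp := hlt φ
      cases d with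
      | true =>
        have hW : ∀ a', Function.update k a (k a + 1) a' < Y.W := by
          intro a'
          by_cases h : a' = a
          · subst h; simp; omega
          · simpa [h] using hkW a'
        refine ⟨Function.update k a (k a + 1), fun a' => ?_, hW, neighbour_cellPos_true o k a,
          fun src goal => move_right hY hkW (by omega), fun src goal => ?_⟩
        · have := hk a'
          by_cases h : a' = a
          · subst h; simp; omega
          · simp [h]; omega
        · have := move_left (pat := pat) (src := src) (goal := goal) hY hW (a := a) (j := k a)
            (by simp)
          simpa using this
      | false =>
        obtain ⟨j, hj⟩ : ∃ j, k a = j + 1 := ⟨k a - 1, by omega⟩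
        have hW : ∀ a', Function.update k a j a' < Y.W := by
          intro a'
          by_cases h : a' = a
          · subst h; simp; omega
          · simpa [h] using hkW a'
        refine ⟨Function.update k a j, fun a' => ?_, hW, neighbour_cellPos_false o k a hj,
          fun src goal => move_left hY hkW hj, fun src goal => ?_⟩
        · have := hk a'
          by_cases h : a' = a
          · subst h; simp; omega
          · simp [h]; omega
        · have := move_right (pat := pat) (src := src) (goal := goal) hY hW (a := a)
            (by simp; omega)
          simpa [← hj] using this
    rw [hu] at hV hb
    have h3 := ih hφ.2 hk' (by omega) hV hb t r (.move a (!d) :: goal) hk''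
    have h4 : TabReach pat (Y.A a + 3)
        (.main, Y.atCell k' (t.sym :: r) (.move a (!d) :: goal))
        (.main, Y.atCell k (t.sym :: r) goal) := by
      refine TabReach.head (.move a (!d)) (h2 _ _) rfl (fun k' => ?_) rfl (fun k' => ?_) le_rfl
      · cases k' <;> simp [tabRule, atCell, stk]
      · cases k' <;> simp [tabRule, atCell, stk]
    refine TabReach.head (.box b a d) (((h1 _ _).trans h3 le_rfl).trans h4 le_rfl) rfl
      (fun k' => ?_) rfl (fun k' => ?_) (by rw [mul_add]; omega)
    · cases k' <;> simp [tabRule, atCell, stk, Form.encode, encode_dirProg]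
    · cases k' <;> simp [tabRule, atCell, stk, Form.encode, encode_dirProg]
  | _ => trivial

end Layout

end SpatialLogic

namespace SpatialLogic

variable {n : ℕ} {I : Type}

/-! ### Separating finitely many vectors by a linear form with small coefficients -/

/-- Coefficients are chosen greedily. Vectors nonzero on the earlier coordinates are handled by
induction; for the last coefficient each vector with nonzero last entry forbids at most one value,
so one of `E.card + 1` candidates is allowed. -/
theorem exists_separating (L : ℕ) (E : Finset (ℕ → ℤ)) (hE : ∀ v ∈ E, ∃ j < L, v j ≠ 0) :
    ∃ S : ℕ → ℕ, (∀ j, S j ≤ E.card) ∧ ∀ v ∈ E, ∑ j ∈ Finset.range L, (S j : ℤ) * v j ≠ 0 := by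
  classical
  induction L generalizing E with
  | zero =>
    refine ⟨fun _ => 0, by simp, fun v hv => ?_⟩
    obtain ⟨j, hj, -⟩ := hE v hv
    omega
  | succ L ih =>
    obtain ⟨S, hS, hS'⟩ := ih (E.filter fun v => ∃ j < L, v j ≠ 0) (by simp)
    -- This is the only coefficient that can make the form vanish at `v` when `v L ≠ 0`. For other
    -- vectors, or inexact or negative quotients, the value is arbitrary and merely excludes one
    -- candidate more.
    let bad : (ℕ → ℤ) → ℕ := fun v => (-(∑ j ∈ Finset.range L, (S j : ℤ) * v j) / v L).toNat
    obtain ⟨s, hs, hs'⟩ : ∃ s ∈ Finset.range (E.card + 1), s ∉ E.image bad := by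
      by_contra! h
      have h1 := Finset.card_le_card (fun s hs => h s hs : Finset.range (E.card + 1) ⊆ E.image bad)
      have h2 := Finset.card_image_le (s := E) (f := bad)
      rw [Finset.card_range] at h1
      omega
    refine ⟨Function.update S L s, fun j => ?_, fun v hv => ?_⟩
    · by_cases h : j = L
      · subst h
        rw [Function.update_self]
        exact Nat.le_of_lt_succ (Finset.mem_range.1 hs)
      · rw [Function.update_of_ne h]
        exact (hS j).trans (Finset.card_filter_le _ _)
    · have e : ∑ j ∈ Finset.range L, ((Function.update S L s j : ℕ) : ℤ) * v j =
          ∑ j ∈ Finset.range L, (S j : ℤ) * v j := by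
        refine Finset.sum_congr rfl fun j hj => ?_
        rw [Function.update_of_ne (Finset.mem_range.1 hj).ne]
      rw [Finset.sum_range_succ, e, Function.update_self]
      by_cases h : v L = 0
      · rw [h, mul_zero, add_zero]
        refine hS' v (Finset.mem_filter.2 ⟨hv, ?_⟩)
        obtain ⟨j, hj, hj'⟩ := hE v hv
        refine ⟨j, ?_, hj'⟩
        rcases Nat.lt_succ_iff_lt_or_eq.1 hj with h' | rfl
        · exact h'
        · exact absurd h hj'
      · intro h0
        refine hs' (Finset.mem_image.2 ⟨v, hv, ?_⟩)
        have h1 : -(∑ j ∈ Finset.range L, (S j : ℤ) * v j) = s * v L := by linarith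
        simp only [bad, h1]
        rw [Int.mul_ediv_cancel _ h]
        simp

/-- Past the end of the digits `getI` returns `false`, so all numerals can be padded to the same
number of terms. -/
theorem dot_range' (f : ℕ → ℕ) (m s : ℕ) (bs : List Bool) :
    Layout.dot ((List.range' s m).map f) bs =
      ∑ j ∈ Finset.range m, f (s + j) * (bs.getI j).toNat := by
  induction m generalizing s bs with
  | zero => simp [Layout.dot]
  | succ m ih =>
    rw [List.range'_succ, List.map_cons, Finset.sum_range_succ']
    cases bs with
    | nil => simp [Layout.dot]
    | cons b bs =>
      rw [Layout.dot, ih, add_comm]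
      congr 1
      · refine Finset.sum_congr rfl fun j _ => ?_
        rw [List.getI_cons_succ, add_right_comm, add_assoc]
      · cases b <;> simp

/-! ### Filling the tapes -/

section Guess

variable {pat : I → List (TabSym n)}

/-- A stack is filled from its far end. The second conclusion is what carries the induction: a cell
disjoint from everything placed so far is unaffected when the placed agents are subtracted from it.
-/
theorem guess_coord (a : Bool) (F : List (TabSym n)) (u : Bool → Finset (Fin n))
    (T : TabStk → List (TabSym n)) (hF : ∀ s ∈ F, s = .unit ∨ ∃ m, s = .cell m)
    (hd : (cellsOf F).Pairwise Disjoint) (hu : ∀ m ∈ cellsOf F, Disjoint m (u a)) :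
    ∃ u' : Bool → Finset (Fin n), u' (!a) = u (!a) ∧
      (∀ m, Disjoint m (u a) → (∀ m' ∈ cellsOf F, Disjoint m m') → Disjoint m (u' a)) ∧
      TabReach pat F.length (.guess u, T)
        (.guess u', Function.update T (.hi a) (F ++ T (.hi a))) := by
  induction F with
  | nil => exact ⟨u, rfl, fun m h _ => h, by simpa using TabReach.refl _ _ _⟩
  | cons s F ih =>
    rcases hF s (by simp) with rfl | ⟨m, rfl⟩
    · obtain ⟨u', h1, h2, h3⟩ := ih (fun s hs => hF s (by simp [hs])) hd hu
      refine ⟨u', h1, h2, h3.trans (t' := 1) (TabReach.single (.guessUnit u' a) le_rfl rfl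
        (fun k => List.nil_prefix) rfl (fun k => ?_)) le_rfl⟩
      by_cases hk : k = .hi a
      · subst hk; simp [tabRule]
      · rcases k with _ | _ | _ | a' | a' | _ | _ | _ | _ | _ <;> simp [tabRule]
        have : a' ≠ a := by rintro rfl; exact hk rfl
        simp [this]
    · rw [cellsOf_cell, List.pairwise_cons] at hd
      obtain ⟨u', h1, h2, h3⟩ := ih (fun s hs => hF s (by simp [hs])) hd.2
        (fun m' hm' => hu m' (by simp [hm']))
      have hm : Disjoint m (u' a) := h2 m (hu m (by simp)) hd.1
      refine ⟨Function.update u' a (u' a ∪ m), by simp [h1], fun m' h h' => ?_,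
        h3.trans (t' := 1) (TabReach.single (.guessCell u' a m) le_rfl rfl
        (fun k => List.nil_prefix) rfl (fun k => ?_)) le_rfl⟩
      · rw [Function.update_self, Finset.disjoint_union_right]
        exact ⟨h2 m' h fun m'' hm'' => h' m'' (by simp [hm'']), h' m (by simp)⟩
      · by_cases hk : k = .hi a
        · subst hk; simp [tabRule, Finset.sdiff_eq_self_of_disjoint hm]
        · rcases k with _ | _ | _ | a' | a' | _ | _ | _ | _ | _ <;> simp [tabRule]
          have : a' ≠ a := by rintro rfl; exact hk rfl
          simp [this]

theorem guess_shifts (F : List (TabSym n)) (u : Bool → Finset (Fin n))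
    (T : TabStk → List (TabSym n)) (hF : ∀ s ∈ F, s = .unit ∨ s = .sep) :
    TabReach pat F.length (.guess u, T) (.guess u, Function.update T .kr (F ++ T .kr)) := by
  induction F with
  | nil => simpa using TabReach.refl _ _ _
  | cons s F ih =>
    have h3 := ih (fun s hs => hF s (by simp [hs]))
    rcases hF s (by simp) with rfl | rfl
    · refine h3.trans (t' := 1) (TabReach.single (.guessShift u) le_rfl rfl
        (fun k => List.nil_prefix) rfl (fun k => ?_)) le_rfl
      cases k <;> simp [tabRule]
    · refine h3.trans (t' := 1) (TabReach.single (.guessSep u) le_rfl rfl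
        (fun k => List.nil_prefix) rfl (fun k => ?_)) le_rfl
      cases k <;> simp [tabRule]

theorem guess_vals (F : List Bool) (u : Bool → Finset (Fin n)) (T : TabStk → List (TabSym n)) :
    TabReach pat F.length (.guess u, T)
      (.guess u, Function.update T .vr (F.map .val ++ T .vr)) := by
  induction F with
  | nil => simpa using TabReach.refl _ _ _
  | cons b F ih =>
    refine ih.trans (t' := 1) (TabReach.single (.guessVal u b) le_rfl rfl
      (fun k => List.nil_prefix) rfl (fun k => ?_)) le_rfl
    cases k <;> simp [tabRule]

theorem guess_moves (a d : Bool) (j : ℕ) (u : Bool → Finset (Fin n))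
    (T : TabStk → List (TabSym n)) :
    TabReach pat j (.guess u, T)
      (.guess u, Function.update T .goal (List.replicate j (.move a d) ++ T .goal)) := by
  induction j with
  | zero => simpa using TabReach.refl _ _ _
  | succ j ih =>
    refine ih.trans (t' := 1) (TabReach.single (.guessMove u a d) le_rfl rfl
      (fun k => List.nil_prefix) rfl (fun k => ?_)) le_rfl
    cases k <;> simp [tabRule, List.replicate_succ]

/-- The input arrives with its last symbol on top; unloading it turns it around, so the source
starts with the first symbol of the formula. -/
theorem rev_run (x : List (Sym n)) (T : TabStk → List (TabSym n)) :
    TabReach pat x.length (.rev, Function.update T .inp ((x.map .tok).reverse ++ T .inp))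
      (.rev, Function.update T .src (x.map .tok ++ T .src)) := by
  induction x using List.reverseRecOn generalizing T with
  | nil => simpa using TabReach.refl _ _ _
  | append_singleton x s ih =>
    have := ih (Function.update T .src (.tok s :: T .src))
    rw [Function.update_idem, Function.update_self,
      Function.update_of_ne (show TabStk.inp ≠ .src by simp)] at this
    rw [List.map_append, List.append_assoc]
    refine TabReach.head (.rev s) this rfl (fun k => ?_) rfl (fun k => ?_) (by simp)
    · cases k <;> simp [tabRule]
    · cases k <;> simp [tabRule]

end Guess

namespace Layout

variable {Y : Layout n} {pat : I → List (TabSym n)}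

theorem moves_run (hY : Y.Long) {k : Bool → ℕ} (hk : ∀ a, k a < Y.W) {a : Bool} (j : ℕ)
    (hj : k a + j < Y.W) (src goal : List (TabSym n)) :
    TabReach pat ((Y.A a + 3) * j)
      (.main, Y.atCell k src (List.replicate j (.move a true) ++ goal))
      (.main, Y.atCell (Function.update k a (k a + j)) src goal) := by
  induction j generalizing k with
  | zero => simpa using TabReach.refl _ _ _
  | succ j ih =>
    have hk' : ∀ b, Function.update k a (k a + 1) b < Y.W := by
      intro b
      by_cases h : b = a
      · subst h; simp; omega
      · simpa [h] using hk b
    have h2 := ih hk' (by simp; omega)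
    rw [Function.update_idem, Function.update_self, add_assoc, add_comm 1 j] at h2
    have h1 := move_right (pat := pat) (src := src)
      (goal := List.replicate j (.move a true) ++ goal) hY hk (a := a) (by omega)
    refine TabReach.head (.move a true) (h1.trans h2 le_rfl) rfl (fun k => ?_) rfl (fun k => ?_)
      (by rw [mul_add]; omega)
    · cases k <;> simp [tabRule, atCell, stk, List.replicate_succ]
    · cases k <;> simp [tabRule, atCell, stk, List.replicate_succ]

theorem cellsOf_coord_pairwise (a : Bool)
    (h : ∀ k k', k ≠ k' → Disjoint (Y.cell a k) (Y.cell a k')) :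
    (cellsOf (Y.coord a)).Pairwise Disjoint := by
  rw [cellsOf, coord, List.filterMap_map, List.pairwise_filterMap]
  refine List.pairwise_lt_range.imp fun {p p'} hp m hm m' hm' => ?_
  simp only [Function.comp_apply] at hm hm'
  split_ifs at hm hm' with h1 h2
  simp at hm hm'
  subst hm hm'
  refine h _ _ fun e => ?_
  have e1 := Nat.div_add_mod p (Y.A a + 1)
  have e2 := Nat.div_add_mod p' (Y.A a + 1)
  rw [h1] at e1
  rw [h2] at e2
  rw [e] at e1
  omega

theorem length_blocks (S : List ℕ) : (blocks S : List (TabSym n)).length = S.sum + S.length := by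
  induction S with
  | nil => rfl
  | cons s S ih =>
    rw [blocks, List.flatMap_cons, List.length_append, ← blocks, ih]
    simp
    omega

theorem mem_blocks (S : List ℕ) (s : TabSym n) (h : s ∈ blocks S) : s = .unit ∨ s = .sep := by
  simp only [blocks, List.mem_flatMap, List.mem_append, List.mem_replicate, List.mem_singleton] at h
  obtain ⟨_, _, ⟨_, h⟩ | h⟩ := h
  · exact .inl h
  · exact .inr h

/-- The heads start at the corner of the window, while the formula is evaluated at its centre, so
the guessed goals include `m` moves along each axis. The three groups of the bound are the reversal,
the filling of the tapes, and these moves. -/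
theorem init_run (hY : Y.Long)
    (hd : ∀ a k k', k ≠ k' → Disjoint (Y.cell a k) (Y.cell a k')) (m : ℕ) (hm : m < Y.W)
    (x : List (Sym n)) :
    TabReach pat (x.length + 1 + (Y.W * (Y.A false + 1) + Y.W * (Y.A true + 1) +
        (Y.S.sum + Y.S.length) + Y.V.length + 2 * m + 1) +
        ((Y.A false + 3) * m + (Y.A true + 3) * m))
      ((tabSystem pat).init x)
      (.main, Y.atCell (fun _ => m) (x.map .tok ++ [.bot]) [.eval true, .bot]) := by
  set T₀ := (tabSystem pat).base
  have h1 : TabReach pat (x.length + 1) ((tabSystem pat).init x)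
      (.guess fun _ => ∅, Function.update T₀ .src (x.map .tok ++ T₀ .src)) := by
    refine (rev_run x T₀).trans (t' := 1) (TabReach.single .revDone le_rfl rfl (fun k => ?_) rfl
      (fun k => ?_)) le_rfl
    · cases k <;> simp [tabRule, T₀, tabSystem]
    · cases k <;> simp [tabRule, T₀, tabSystem]
  have hF : ∀ a, ∀ s ∈ Y.coord a, s = .unit ∨ ∃ m, s = .cell m := by
    intro a s hs
    simp only [coord, List.mem_map] at hs
    obtain ⟨p, -, rfl⟩ := hs
    split_ifs
    · exact .inr ⟨_, rfl⟩
    · exact .inl rfl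
  have hl : ∀ a, (Y.coord a).length = Y.W * (Y.A a + 1) := by simp [coord]
  obtain ⟨u, hu, -, h2⟩ := guess_coord (pat := pat) false (Y.coord false) (fun _ => ∅)
    (Function.update T₀ .src (x.map .tok ++ T₀ .src)) (hF _) (cellsOf_coord_pairwise _ (hd _))
    (by simp)
  obtain ⟨u', -, -, h3⟩ := guess_coord (pat := pat) true (Y.coord true) u _ (hF _)
    (cellsOf_coord_pairwise _ (hd _)) (fun m _ => by
      have : u true = ∅ := hu
      simp [this])
  have h4 := h2.trans h3 le_rfl
  have h5 := h4.trans (guess_shifts (blocks Y.S) u' _ (mem_blocks _)) le_rfl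
  have h6 := h5.trans (guess_vals Y.V u' _) le_rfl
  have h7 := h6.trans (guess_moves true true m u' _) le_rfl
  have h8 := h7.trans (guess_moves false true m u' _) le_rfl
  have h9 := h8.trans (t' := 1) (TabReach.single (c' := (.main, Y.atCell (fun _ => 0)
      (x.map .tok ++ [.bot]) (List.replicate m (.move false true) ++
        (List.replicate m (.move true true) ++ [.eval true, .bot]))))
    (.guessDone u') le_rfl rfl (fun k => List.nil_prefix) rfl (fun k => by
      rcases k with _ | _ | _ | _ | (_ | _) | _ | _ | _ | _ | _ <;>
        simp [tabRule, T₀, tabSystem, atCell, stk, valPos])) le_rfl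
  rw [hl, hl, length_blocks] at h9
  have h10 := moves_run (pat := pat) hY (k := fun _ => 0) (fun _ => by omega) (a := false) m
    (by simpa) (x.map .tok ++ [.bot]) (List.replicate m (.move true true) ++ [.eval true, .bot])
  have hk : ∀ b, Function.update (fun _ : Bool => 0) false (0 + m) b < Y.W := by
    intro b
    cases b <;> simp <;> omega
  have h11 := moves_run (pat := pat) hY hk (a := true) m
    (by simpa) (x.map .tok ++ [.bot]) [.eval true, .bot]
  have e : Function.update (Function.update (fun _ : Bool => 0) false (0 + m)) true
      (Function.update (fun _ : Bool => 0) false (0 + m) true + m) = fun _ => m := by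
    funext b
    cases b <;> simp
  rw [e] at h11
  exact (h1.trans h9 le_rfl).trans (h10.trans h11 le_rfl) (by omega)

end Layout

end SpatialLogic

-- Polynomial-size tapes for a satisfiable formula

namespace SpatialLogic

variable {n : ℕ} {I : Type}

/-- Every relevant pair comes from an occurrence of an atom, every unit of distance from an
occurrence of a modality, and every digit is itself a symbol; all are bounded by the length of the
string. -/
theorem keys_spec {N : ℕ∞} (φ : Form (Atom N) (Fin n)) (hφ : φ.Basic) (u : ℤ × ℤ) :
    (φ.keys u).length ≤ φ.encode.length ∧ ∀ key ∈ φ.keys u,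
      (Nat.bits key.2.1).length ≤ φ.encode.length ∧
      |key.1.1 - u.1| ≤ φ.encode.length ∧ |key.1.2 - u.2| ≤ φ.encode.length := by
  induction φ using Form.rec (motive_1 := fun _ => True) generalizing u with
  | atom p => simp [Form.keys, Form.encode]; omega
  | here i => simp [Form.keys]
  | neg φ ih =>
    obtain ⟨h1, h2⟩ := ih hφ u
    simp only [Form.keys, Form.encode, List.length_cons]
    refine ⟨by omega, fun key hkey => ?_⟩
    obtain ⟨h3, h4, h5⟩ := h2 key hkey
    push_cast
    refine ⟨by omega, by omega, by omega⟩
  | and φ ψ ih ih' =>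
    obtain ⟨h1, h2⟩ := ih hφ.1 u
    obtain ⟨h1', h2'⟩ := ih' hφ.2 u
    simp only [Form.keys, Form.encode, List.length_cons, List.length_append]
    refine ⟨by omega, fun key hkey => ?_⟩
    push_cast
    rcases List.mem_append.1 hkey with hkey | hkey
    · obtain ⟨h3, h4, h5⟩ := h2 key hkey
      refine ⟨by omega, by omega, by omega⟩
    · obtain ⟨h3, h4, h5⟩ := h2' key hkey
      refine ⟨by omega, by omega, by omega⟩
  | box α φ _ ih =>
    obtain ⟨a, d, rfl⟩ := exists_dirProg hφ.1
    obtain ⟨h1, h2⟩ := ih hφ.2 (neighbour a d u)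
    rw [keys_box_dirProg]
    simp only [Form.encode, encode_dirProg, List.length_cons, List.length_append, List.length_nil]
    refine ⟨by omega, fun key hkey => ?_⟩
    obtain ⟨h3, h4, h5⟩ := h2 key hkey
    push_cast
    rw [abs_le] at h4 h5 ⊢
    rw [abs_le]
    cases a <;> cases d <;> simp only [neighbour] at h4 h5 <;>
      exact ⟨by omega, by omega, by omega⟩
  | _ => trivial

/-- A position and the binary digits of a number as a vector. -/
def keyVec {N : ℕ∞} (o : ℤ × ℤ) (key : (ℤ × ℤ) × Atom N) : ℕ → ℤ
  | 0 => key.1.1 - o.1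
  | 1 => key.1.2 - o.2
  | j + 2 => ((Nat.bits key.2.1).getI j).toNat

theorem eq_of_getI_bits_eq {m a b : ℕ} (ha : (Nat.bits a).length ≤ m) (hb : (Nat.bits b).length ≤ m)
    (h : ∀ j < m, (Nat.bits a).getI j = (Nat.bits b).getI j) : a = b := by
  refine Nat.eq_of_testBit_eq fun j => ?_
  rw [Nat.testBit_eq_inth, Nat.testBit_eq_inth]
  by_cases hj : j < m
  · exact h j hj
  · rw [List.getI_eq_default _ (by omega), List.getI_eq_default _ (by omega)]

/-- The separating lemma is applied to the differences of distinct keys, of which there are at most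
`m * m`. The `m + 2` coordinates are the two grid coordinates and `m` digits. -/
theorem exists_separating_keys {N : ℕ∞} (o : ℤ × ℤ) (m : ℕ) (K : List ((ℤ × ℤ) × Atom N))
    (hK : K.length ≤ m) (hb : ∀ key ∈ K, (Nat.bits key.2.1).length ≤ m) :
    ∃ S : ℕ → ℕ, (∀ j, S j ≤ m * m) ∧ ∀ key ∈ K, ∀ key' ∈ K,
      ∑ j ∈ Finset.range (m + 2), (S j : ℤ) * keyVec o key j =
        ∑ j ∈ Finset.range (m + 2), (S j : ℤ) * keyVec o key' j → key = key' := by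
  classical
  obtain ⟨S, hS, hS'⟩ := exists_separating (m + 2)
    (((K.toFinset ×ˢ K.toFinset).filter fun q => q.1 ≠ q.2).image
      fun q j => keyVec o q.1 j - keyVec o q.2 j) (by
    simp only [Finset.mem_image, Finset.mem_filter, Finset.mem_product, List.mem_toFinset]
    rintro _ ⟨⟨⟨u, p⟩, ⟨u', p'⟩⟩, ⟨⟨h1, h2⟩, h3⟩, rfl⟩
    by_contra! h
    refine h3 (Prod.ext (Prod.ext ?_ ?_) (Subtype.ext ?_))
    · have := h 0 (by omega)
      simp only [keyVec] at this
      change u.1 = u'.1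
      omega
    · have := h 1 (by omega)
      simp only [keyVec] at this
      change u.2 = u'.2
      omega
    · refine eq_of_getI_bits_eq (hb _ h1) (hb _ h2) fun j hj => ?_
      have := h (j + 2) (by omega)
      simp only [keyVec, sub_eq_zero, Nat.cast_inj] at this
      revert this
      cases (Nat.bits p.1).getI j <;> cases (Nat.bits p'.1).getI j <;> simp)
  refine ⟨S, fun j => (hS j).trans ?_, fun key h key' h' e => ?_⟩
  · refine (Finset.card_image_le.trans (Finset.card_filter_le _ _)).trans ?_
    rw [Finset.card_product]
    have := (List.toFinset_card_le K).trans hK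
    exact Nat.mul_le_mul this this
  · by_contra hne
    refine hS' _ (Finset.mem_image.2 ⟨(key, key'), by simp [h, h', hne], rfl⟩) ?_
    simp only [mul_sub, Finset.sum_sub_distrib, e, sub_self]

/-- The tapes encode a window of a satisfying model, with coefficients that give distinct indices to
the relevant pairs. Truth values at other indices do not matter, so they are set to `false`. -/
theorem tabSystem_complete {N : ℕ∞} {pat : I → List (TabSym n)} (hpat : PatSpec N pat)
    (φ : Form (Atom N) (Fin n)) (hφ : φ.Basic) (h : φ.Satisfiable) :
    ∃ w W, w.length ≤ 100 * φ.encode.length ^ 4 + 100 ∧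
      (tabSystem pat).Runs w ((tabSystem pat).init φ.encode) (.acc, W) := by
  classical
  obtain ⟨M, u, hu⟩ : ∃ (M : SpatialModel (Atom N) (Fin n)) (u : ℤ × ℤ), φ.Holds M u := by
    by_contra! h'
    exact h h'
  obtain ⟨hlen, hkey⟩ := keys_spec φ hφ u
  set m := φ.encode.length with hm
  have hm0 : 0 < m := by rw [hm]; cases φ <;> simp [Form.encode]
  -- The corner of a window of side `2 * m` around `u`, so that all visited cells have natural
  -- coordinates.
  set o : ℤ × ℤ := (u.1 - m, u.2 - m) with ho
  have hou : cellPos o (fun _ => m) = u := by simp [cellPos, ho]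
  obtain ⟨S, hS, hinj⟩ := exists_separating_keys o m (φ.keys u) hlen fun key h => (hkey key h).1
  -- Indices do not depend on the value tape; a preliminary layout with an empty one lets them be
  -- used to define the actual values.
  let Y₀ : Layout n :=
    { W := 2 * m
      A := fun a => if a then S 1 else S 0
      cell := fun a k => Finset.univ.filter fun i =>
        if a then (M.P i).2 = o.2 + k else (M.P i).1 = o.1 + k
      S := (List.range' 2 m).map S
      V := [] }
  let Y : Layout n :=
    { Y₀ with
      V := (List.range (2 * m * (S 0 + S 1) + Y₀.S.sum + 1)).map fun q =>
        decide (∃ key ∈ φ.keys u, Y₀.index o key = q ∧ key.2 ∈ M.V key.1) }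
  have hsum : Y.S.sum ≤ m * (m * m) := by
    refine (List.sum_le_card_nsmul _ (m * m) ?_).trans ?_
    · simp only [Y, Y₀, List.mem_map]
      rintro _ ⟨j, -, rfl⟩
      exact hS j
    · simp [Y, Y₀]
  have hVl : Y.V.length = 2 * m * (S 0 + S 1) + Y.S.sum + 1 := by simp [Y, Y₀]
  have hSl : Y.S.length = m := by simp [Y, Y₀]
  have hlong : Y.Long := by
    intro k hk
    rw [hVl, Layout.valPos]
    have h0 : S 0 * k false ≤ S 0 * (2 * m) := Nat.mul_le_mul_left _ (hk false).le
    have h1 : S 1 * k true ≤ S 1 * (2 * m) := Nat.mul_le_mul_left _ (hk true).le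
    have e : 2 * m * (S 0 + S 1) = S 0 * (2 * m) + S 1 * (2 * m) := by ring
    change S 0 * k false + S 1 * k true + _ < _
    omega
  have hdisj : ∀ a k k', k ≠ k' → Disjoint (Y.cell a k) (Y.cell a k') := by
    intro a k k' hne
    refine Finset.disjoint_filter.2 fun i _ h1 h2 => hne ?_
    cases a <;> simp at h1 h2 <;> omega
  have hindex : ∀ key ∈ φ.keys u, (Y.index o key : ℤ) =
      ∑ j ∈ Finset.range (m + 2), (S j : ℤ) * keyVec o key j := by
    intro key h
    obtain ⟨-, h1, h2⟩ := hkey key h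
    rw [abs_le] at h1 h2
    have e1 : ((key.1.1 - o.1).toNat : ℤ) = key.1.1 - o.1 :=
      Int.toNat_of_nonneg (by simp only [ho]; omega)
    have e2 : ((key.1.2 - o.2).toNat : ℤ) = key.1.2 - o.2 :=
      Int.toNat_of_nonneg (by simp only [ho]; omega)
    rw [Layout.index]
    change ((S 0 * _ + S 1 * _ + Layout.dot ((List.range' 2 m).map S) _ : ℕ) : ℤ) = _
    rw [dot_range', Finset.sum_range_succ', Finset.sum_range_succ']
    push_cast [e1, e2]
    simp only [keyVec, add_comm 2]
    ring
  have hV : ∀ key ∈ φ.keys u, ∃ c : Bool, Y.V[Y.index o key]? = some c ∧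
      (c = true ↔ key.2 ∈ M.V key.1) := by
    intro key h
    obtain ⟨-, h1, h2⟩ := hkey key h
    rw [abs_le] at h1 h2
    have e1 : (key.1.1 - o.1).toNat ≤ 2 * m := by simp only [ho]; omega
    have e2 : (key.1.2 - o.2).toNat ≤ 2 * m := by simp only [ho]; omega
    have hlt : Y.index o key < 2 * m * (S 0 + S 1) + Y.S.sum + 1 := by
      have h0 := Nat.mul_le_mul_left (S 0) e1
      have h1 := Nat.mul_le_mul_left (S 1) e2
      have h2 := Layout.dot_le_sum Y.S (Nat.bits key.2.1)
      have e : 2 * m * (S 0 + S 1) = S 0 * (2 * m) + S 1 * (2 * m) := by ring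
      rw [Layout.index]
      change S 0 * _ + S 1 * _ + _ < _
      omega
    refine ⟨_, by simp only [Y]; rw [List.getElem?_map, List.getElem?_range hlt]; rfl, ?_⟩
    rw [decide_eq_true_eq]
    constructor
    · rintro ⟨key', h', e, hmem⟩
      -- Injectivity of the index on the relevant keys prevents another key from setting this entry
      -- to `true`.
      have : key' = key := by
        refine hinj _ h' _ h ?_
        rw [← hindex _ h', ← hindex _ h]
        exact congrArg _ e
      rwa [← this]
    · exact fun hmem => ⟨key, h, rfl, hmem⟩
  have hinit := Layout.init_run (pat := pat) hlong hdisj m (show m < 2 * m by omega) φ.encode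
  -- The cost per symbol is cubic: `m` digit shifts and two axis coefficients, each at most `m * m`.
  -- Multiplied by `m` symbols it gives the fourth power.
  have heval := Layout.eval_run hpat hlong (M := M) (o := o) (by simp [Y, Y₀]) (by simp [Y, Y₀])
    (B := 3 * (m * (m * m)) + 3 * m + m * m + m * m + 3) (by
      rw [hSl]
      have h0 := hS 0
      have h1 := hS 1
      change _ + _ + S 0 + S 1 + _ ≤ _
      omega) φ hφ (k := fun _ => m) (fun _ => ⟨le_rfl, by change m + m ≤ 2 * m; omega⟩) hSl.ge
    (b := true) (by rwa [hou]) (by rw [hou]; simpa using hu) ⟨none, by simp⟩ [] [.bot]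
  have hacc : TabReach pat 1 (.main, Y.atCell (fun _ => m) [.bot] [.bot])
      (.acc, Y.atCell (fun _ => m) [] []) := by
    refine TabReach.single .acc le_rfl rfl (fun k => ?_) rfl (fun k => ?_)
    · cases k <;> simp [tabRule, Layout.atCell, Layout.stk]
    · cases k <;> simp [tabRule, Layout.atCell, Layout.stk]
  obtain ⟨w, hw, hr⟩ := (hinit.trans heval le_rfl).trans hacc le_rfl
  refine ⟨w, _, hw.trans ?_, hr⟩
  rw [hVl, hSl, ← hm]
  change m + 1 + (2 * m * (S 0 + 1) + 2 * m * (S 1 + 1) + _ + _ + 2 * m + 1) +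
    ((S 0 + 3) * m + (S 1 + 3) * m) + _ + 1 ≤ _
  have h0 := Nat.mul_le_mul_left m (hS 0)
  have h1 := Nat.mul_le_mul_left m (hS 1)
  have g : m * (m * m) ≤ m ^ 4 := by
    rw [show m * (m * m) = m ^ 3 by ring]
    exact Nat.pow_le_pow_right hm0 (by norm_num)
  have g2 : m * m ≤ m ^ 4 := by
    rw [show m * m = m ^ 2 by ring]
    exact Nat.pow_le_pow_right hm0 (by norm_num)
  have g1 : m ≤ m ^ 4 := Nat.le_self_pow (by norm_num) m
  have e4 : (3 * (m * (m * m)) + 3 * m + m * m + m * m + 3) * m =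
      3 * m ^ 4 + 3 * (m * m) + 2 * (m * (m * m)) + 3 * m := by ring
  rw [e4]
  have e5 : 2 * m * (S 0 + 1) = 2 * (m * S 0) + 2 * m := by ring
  have e6 : 2 * m * (S 1 + 1) = 2 * (m * S 1) + 2 * m := by ring
  have e7 : 2 * m * (S 0 + S 1) = 2 * (m * S 0) + 2 * (m * S 1) := by ring
  have e8 : (S 0 + 3) * m = m * S 0 + 3 * m := by ring
  have e9 : (S 1 + 3) * m = m * S 1 + 3 * m := by ring
  rw [e5, e6, e7, e8, e9]
  omega

-- Recognizing the indices of atomic propositions by finitely many patterns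

/-- With infinitely many propositions every number is an index, so a single empty pattern imposes no
condition. -/
theorem patSpec_top : PatSpec ⊤ (fun _ : Unit => ([] : List (TabSym n))) :=
  fun k _ _ => ⟨fun _ => by simp, fun _ => ⟨(), List.nil_prefix⟩⟩

/-- The terminating symbols are not digits, so a terminated numeral cannot match inside a longer or
shorter one. -/
theorem eq_of_map_append_isPrefix {α β : Type} {f : α → β} (hf : Function.Injective f) {t t' : β}
    (ht : ∀ a, t ≠ f a) (ht' : ∀ a, t' ≠ f a) {l l' : List α} {r : List β}
    (h : l.map f ++ [t] <+: l'.map f ++ t' :: r) : l = l' := by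
  induction l generalizing l' with
  | nil =>
    cases l' with
    | nil => rfl
    | cons a l' =>
      simp only [List.map_nil, List.nil_append, List.map_cons, List.cons_append,
        List.cons_prefix_cons] at h
      exact (ht a h.1).elim
  | cons a l ih =>
    cases l' with
    | nil =>
      simp only [List.map_nil, List.nil_append, List.map_cons, List.cons_append,
        List.cons_prefix_cons] at h
      exact (ht' a h.1.symm).elim
    | cons a' l' =>
      simp only [List.map_cons, List.cons_append, List.cons_prefix_cons] at h
      rw [hf h.1, ih h.2]

theorem nat_bits_injective : Function.Injective Nat.bits := fun a b h =>
  eq_of_getI_bits_eq le_rfl (by rw [h]) fun j _ => by rw [h]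

/-- For finitely many propositions all numerals can be listed. The terminator in each pattern is
essential, since one numeral may be a prefix of another. -/
theorem patSpec_natCast (N : ℕ) : PatSpec N (fun q : Fin N × Follow n =>
    (Nat.bits q.1).map (fun b => TabSym.tok (.inl (Tok.bit b))) ++ [q.2.sym]) := by
  have hs : ∀ (t : Follow n) b, t.sym ≠ TabSym.tok (.inl (Tok.bit b)) := by
    rintro ⟨_ | s, h⟩ b
    · simp [Follow.sym]
    · have := h b
      simpa [Follow.sym] using this
  have hf : Function.Injective fun b => (TabSym.tok (.inl (Tok.bit b)) : TabSym n) := by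
    intro b b' h
    revert h
    cases b <;> cases b' <;> simp [Tok.bit]
  intro k t r
  rw [Nat.cast_lt]
  constructor
  · rintro ⟨⟨i, t'⟩, h⟩
    rw [← nat_bits_injective (eq_of_map_append_isPrefix hf (hs t') (hs t) h)]
    exact i.2
  · intro hk
    exact ⟨(⟨k, hk⟩, t), r, by simp⟩

theorem inNP_satDLS0_of_patSpec [Fintype I] {N : ℕ∞} {pat : I → List (TabSym n)}
    (hpat : PatSpec N pat) : InNP (SatDLS0 N n) := by
  classical
  refine (tabSystem pat).inNP _ (100 * Polynomial.X ^ 4 + 100) fun x => ⟨?_, ?_⟩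
  · rintro ⟨φ, hφ, h, rfl⟩
    obtain ⟨w, W, hw, hr⟩ := tabSystem_complete hpat φ hφ h
    exact ⟨w, W, by simpa using hw, hr⟩
  · rintro ⟨w, W, -, hr⟩
    exact tabSystem_sound hpat hr

/-- The satisfiability problem of the basic language is in NP. -/
theorem inNP_satDLS0 (N : ℕ∞) (n : ℕ) : InNP (SatDLS0 N n) := by
  cases N with
  | top => exact inNP_satDLS0_of_patSpec patSpec_top
  | coe N =>
    classical
    exact inNP_satDLS0_of_patSpec (patSpec_natCast N)


end SpatialLogic

namespace SpatialLogic

variable {n : ℕ}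

/-! ### Disjunctive normal forms of star-free programs -/

/-- A displacement in the grid, with its components written as differences. -/
abbrev Offset : Type := (ℕ × ℕ) × (ℕ × ℕ)

/-- The displacement as a vector. -/
def Offset.vec (d : Offset) : ℤ × ℤ := ((d.1.1 : ℤ) - d.1.2, (d.2.1 : ℤ) - d.2.2)

/-- Two displacements are equal as vectors. -/
def Offset.Same (d d' : Offset) : Prop :=
  d.1.1 + d'.1.2 = d'.1.1 + d.1.2 ∧ d.2.1 + d'.2.2 = d'.2.1 + d.2.2

theorem Offset.vec_add (d d' : Offset) : (d + d').vec = d.vec + d'.vec := by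
  ext <;> simp [vec] <;> ring

theorem Offset.vec_zero : (0 : Offset).vec = 0 := by
  ext <;> simp [vec]

theorem Offset.same_iff (d d' : Offset) : d.Same d' ↔ d.vec = d'.vec := by
  rw [Same, Prod.ext_iff]
  simp only [vec]
  omega

/-- A literal: its sign, a propositional variable (given by its binary digits) or an agent, and
the displacement of the position at which it is evaluated. -/
abbrev Lit (n : ℕ) : Type := Bool × (List Bool ⊕ Fin n) × Offset

/-- A disjunctive normal form; every clause comes with a displacement. -/
abbrev Dnf (n : ℕ) : Type := List (List (Lit n) × Offset)

/-- The truth of an atomic formula at a position. -/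
def AtomicHolds (M : SpatialModel (List Bool) (Fin n)) : List Bool ⊕ Fin n → ℤ × ℤ → Prop
  | .inl bs, u => bs ∈ M.V u
  | .inr i, u => M.P i = u

/-- The truth of a clause at a position. -/
def Sat (M : SpatialModel (List Bool) (Fin n)) (u : ℤ × ℤ) (c : List (Lit n)) : Prop :=
  ∀ l ∈ c, (AtomicHolds M l.2.1 (u + l.2.2.vec) ↔ l.1 = true)

/-- Two literals that cannot be true together. -/
def Conflict (l l' : Lit n) : Prop :=
  l.2.1 = l'.2.1 ∧ ((l.2.2.Same l'.2.2 ∧ l.1 ≠ l'.1) ∨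
    ((l.2.1.isRight = true ∧ l.1 = true ∧ l'.1 = true) ∧ ¬ l.2.2.Same l'.2.2))

theorem sat_cons (M : SpatialModel (List Bool) (Fin n)) (u : ℤ × ℤ) (l : Lit n) (c) :
    Sat M u (l :: c) ↔ (AtomicHolds M l.2.1 (u + l.2.2.vec) ↔ l.1 = true) ∧ Sat M u c := by
  simp [Sat]

theorem not_sat_of_conflict {c : List (Lit n)} {l l' : Lit n} (hl : l ∈ c) (hl' : l' ∈ c)
    (h : Conflict l l') (M : SpatialModel (List Bool) (Fin n)) (u : ℤ × ℤ) : ¬ Sat M u c := by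
  intro hs
  obtain ⟨b, x, d⟩ := l
  obtain ⟨b', x', d'⟩ := l'
  have h1 := hs _ hl
  have h2 := hs _ hl'
  obtain ⟨h3, h4⟩ := h
  simp only [Offset.same_iff] at h1 h2 h3 h4
  subst h3
  rcases h4 with ⟨h4, h5⟩ | ⟨⟨h4, h5, h6⟩, h7⟩
  · rw [h4, h2] at h1
    exact h5 (Bool.eq_iff_iff.2 h1).symm
  · obtain ⟨i, rfl⟩ := Sum.isRight_iff.1 h4
    have h1' := h1.2 h5
    have h2' := h2.2 h6
    rw [AtomicHolds] at h1' h2'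
    exact h7 (add_left_cancel (h1'.symm.trans h2'))

/-- Make true only what positive literals demand: variables exactly at the demanded places, agents
at the demanded place if there is one. Absence of conflicts makes this well defined and compatible
with the negative literals. -/
theorem exists_sat_of_no_conflict {c : List (Lit n)}
    (h : ∀ l ∈ c, ∀ l' ∈ c, ¬ Conflict l l') : ∃ M u, Sat M u c := by
  classical
  -- Agents without a positive literal are sent to a place that the clause does not mention, which
  -- satisfies all their negative literals.
  obtain ⟨z, hz⟩ := ((c.map fun l => l.2.2.vec).toFinset).exists_notMem
  refine ⟨{ P := fun i => if hi : ∃ l ∈ c, l.1 = true ∧ l.2.1 = .inr i then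
              hi.choose.2.2.vec else z
            V := fun u => {bs | ∃ l ∈ c, l.1 = true ∧ l.2.1 = .inl bs ∧ l.2.2.vec = u} }, 0, ?_⟩
  rintro ⟨b, x, d⟩ hl
  simp only [zero_add]
  cases x with
  | inl bs =>
    refine ⟨?_, fun hb => ⟨_, hl, hb, rfl, rfl⟩⟩
    rintro ⟨⟨b', x', d'⟩, hl', hb', hx, hd⟩
    by_contra hb
    refine h _ hl _ hl' ⟨hx.symm, .inl ⟨(Offset.same_iff _ _).2 hd.symm, fun e => hb ?_⟩⟩
    exact Eq.trans e hb'
  | inr i =>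
    simp only [AtomicHolds]
    split_ifs with hi
    · obtain ⟨h1, h2, h3⟩ := hi.choose_spec
      set l' := hi.choose
      constructor
      · intro e
        by_contra hb
        refine h _ hl _ h1 ⟨h3.symm, .inl ⟨(Offset.same_iff _ _).2 e.symm, fun e' => hb ?_⟩⟩
        exact Eq.trans e' h2
      · intro hb
        by_contra e
        refine h _ hl _ h1 ⟨h3.symm, .inr ⟨⟨rfl, hb, h2⟩, fun e' => e ?_⟩⟩
        exact ((Offset.same_iff _ _).1 e').symm
    · constructor
      · rintro rfl
        exact (hz (List.mem_toFinset.2 (List.mem_map.2 ⟨_, hl, rfl⟩))).elim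
      · intro hb
        exact (hi ⟨_, hl, hb, rfl⟩).elim

/-- A normal form that describes the relation `R` in every model. -/
def Describes (v : Dnf n)
    (R : SpatialModel (List Bool) (Fin n) → ℤ × ℤ → ℤ × ℤ → Prop) : Prop :=
  ∀ M u w, R M u w ↔ ∃ c ∈ v, Sat M u c.1 ∧ w = u + c.2.vec

/-- Composition of normal forms. -/
def Dnf.seq (v v' : Dnf n) : Dnf n :=
  v.flatMap fun c => v'.map fun c' =>
    (c.1 ++ c'.1.map fun l => (l.1, l.2.1, c.2 + l.2.2), c.2 + c'.2)

/-- A normal form for the test that there is no transition. -/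
def Dnf.neg (v : Dnf n) : Dnf n :=
  v.foldr (fun c v' => c.1.flatMap fun l => v'.map fun c' => ((!l.1, l.2) :: c'.1, c'.2)) [([], 0)]

theorem sat_append_shift (M : SpatialModel (List Bool) (Fin n)) (u : ℤ × ℤ) (d : Offset)
    (c c' : List (Lit n)) :
    Sat M u (c ++ c'.map fun l => (l.1, l.2.1, d + l.2.2)) ↔ Sat M u c ∧ Sat M (u + d.vec) c' := by
  simp only [Sat, List.mem_append, List.mem_map, or_imp, forall_and, forall_exists_index, and_imp,
    forall_apply_eq_imp_iff₂, Offset.vec_add, add_assoc]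

section Describes

variable {v v' : Dnf n} {R R' : SpatialModel (List Bool) (Fin n) → ℤ × ℤ → ℤ × ℤ → Prop}

theorem Describes.seq (h : Describes v R) (h' : Describes v' R') :
    Describes (v.seq v') fun M u w => ∃ x, R M u x ∧ R' M x w := by
  intro M u w
  simp only [Dnf.seq, List.mem_flatMap, List.mem_map]
  constructor
  · rintro ⟨x, h1, h2⟩
    obtain ⟨c, hc, h3, rfl⟩ := (h M u x).1 h1
    obtain ⟨c', hc', h4, rfl⟩ := (h' M _ w).1 h2
    exact ⟨_, ⟨c, hc, c', hc', rfl⟩, (sat_append_shift ..).2 ⟨h3, h4⟩,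
      by rw [Offset.vec_add, add_assoc]⟩
  · rintro ⟨_, ⟨c, hc, c', hc', rfl⟩, h1, rfl⟩
    obtain ⟨h3, h4⟩ := (sat_append_shift ..).1 h1
    exact ⟨_, (h M u _).2 ⟨c, hc, h3, rfl⟩, (h' M _ _).2 ⟨c', hc', h4,
      by rw [Offset.vec_add, add_assoc]⟩⟩

theorem Describes.append (h : Describes v R) (h' : Describes v' R') :
    Describes (v ++ v') fun M u w => R M u w ∨ R' M u w := by
  intro M u w
  simp only [h M u w, h' M u w, List.mem_append, or_and_right, exists_or]

/-- By distributivity: all clauses fail exactly when one literal can be chosen from each clause such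
that all the chosen ones fail. The displacement 0 comes from the starting clause of the fold. -/
theorem Dnf.exists_mem_neg (v : Dnf n) (M : SpatialModel (List Bool) (Fin n)) (u w : ℤ × ℤ) :
    (∃ c ∈ v.neg, Sat M u c.1 ∧ w = u + c.2.vec) ↔ u = w ∧ ∀ c ∈ v, ¬ Sat M u c.1 := by
  induction v with
  | nil => simpa [Dnf.neg, Sat, Offset.vec_zero] using eq_comm
  | cons c v ih =>
    rw [List.forall_mem_cons, and_left_comm, ← ih]
    have e : Dnf.neg (c :: v) = c.1.flatMap fun l =>
      (Dnf.neg v).map fun c' => ((!l.1, l.2) :: c'.1, c'.2) := rfl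
    rw [e]
    simp only [List.mem_flatMap, List.mem_map]
    constructor
    · rintro ⟨_, ⟨l, hl, c', hc', rfl⟩, h1, h2⟩
      rw [sat_cons] at h1
      refine ⟨fun hs => ?_, c', hc', h1.2, h2⟩
      have h3 := hs l hl
      have h4 := h1.1
      rw [h3] at h4
      revert h4
      cases l.1 <;> simp
    · rintro ⟨h1, c', hc', h2, h3⟩
      simp only [Sat, not_forall] at h1
      obtain ⟨l, hl, h4⟩ := h1
      refine ⟨_, ⟨l, hl, c', hc', rfl⟩, (sat_cons ..).2 ⟨?_, h2⟩, h3⟩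
      revert h4
      cases l.1 <;> simp

theorem Describes.neg (h : Describes v R) :
    Describes v.neg fun M u w => u = w ∧ ∀ x, ¬ R M u x := by
  intro M u w
  rw [Dnf.exists_mem_neg]
  refine and_congr_right fun _ => ?_
  simp only [h M u]
  constructor
  · exact fun h1 c hc hs => h1 _ ⟨c, hc, hs, rfl⟩
  · rintro h1 x ⟨c, hc, hs, -⟩
    exact h1 c hc hs

theorem Describes.congr (h : Describes v R) (h' : ∀ M u w, R M u w ↔ R' M u w) :
    Describes v R' := fun M u w => (h' M u w).symm.trans (h M u w)

theorem describes_singleton (c : List (Lit n)) (d : Offset) :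
    Describes [(c, d)] fun M u w => Sat M u c ∧ w = u + d.vec := by
  intro M u w
  simp

end Describes

/-- There is a transition from every position of every model. -/
def Dnf.Total (v : Dnf n) : Prop := ∀ c ∈ v.neg, ∃ l ∈ c.1, ∃ l' ∈ c.1, Conflict l' l

/-- Totality fails in some model exactly when the negated normal form has a satisfiable clause, that
is, one without a conflicting pair. -/
theorem Dnf.total_iff {v : Dnf n}
    {R : SpatialModel (List Bool) (Fin n) → ℤ × ℤ → ℤ × ℤ → Prop} (h : Describes v R) :
    v.Total ↔ ∀ M u, ∃ w, R M u w := by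
  constructor
  · intro hv M u
    by_contra! h1
    obtain ⟨c, hc, hs, -⟩ := (h.neg M u u).1 ⟨rfl, h1⟩
    obtain ⟨l, hl, l', hl', h2⟩ := hv c hc
    exact not_sat_of_conflict hl' hl h2 M u hs
  · intro h1 c hc
    by_contra! h2
    obtain ⟨M, u, hs⟩ := exists_sat_of_no_conflict fun l hl l' hl' => h2 l' hl' l hl
    obtain ⟨w, hw⟩ := h1 M u
    exact ((h.neg M u _).2 ⟨c, hc, hs, rfl⟩).2 w hw

/-- The model for the variables `Atom N` obtained from a model whose variables are strings. -/
def pullModel (N : ℕ∞) (M : SpatialModel (List Bool) (Fin n)) : SpatialModel (Atom N) (Fin n) where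
  P := M.P
  V u := {p | Nat.bits p.1 ∈ M.V u}

/-- Normal forms use digit strings as variables and so do not depend on `N`. As numerals determine
numbers, no model over `Atom N` is lost by passing to strings. -/
theorem exists_pullModel_eq {N : ℕ∞} (M : SpatialModel (Atom N) (Fin n)) :
    ∃ M', pullModel N M' = M := by
  refine ⟨⟨M.P, fun u => (fun p => Nat.bits p.1) '' M.V u⟩, ?_⟩
  have hinj : Function.Injective fun p : Atom N => Nat.bits p.1 := fun p q h =>
    Subtype.ext (nat_bits_injective h)
  obtain ⟨P, V⟩ := M
  simp only [pullModel, SpatialModel.mk.injEq, true_and]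
  funext u
  ext p
  exact hinj.mem_set_image

/-- A normal form of a program. -/
def IsDnf {N : ℕ∞} (v : Dnf n) (α : Prog (Atom N) (Fin n)) : Prop :=
  Describes v fun M => α.Rel (pullModel N M)

section IsDnf

variable {N : ℕ∞} {v v' : Dnf n} {α β : Prog (Atom N) (Fin n)} {φ ψ : Form (Atom N) (Fin n)}

theorem IsDnf.seq (h : IsDnf v α) (h' : IsDnf v' β) : IsDnf (v.seq v') (.seq α β) :=
  (Describes.seq h h').congr fun M u w => by rw [Prog.Rel]

theorem IsDnf.choice (h : IsDnf v α) (h' : IsDnf v' β) : IsDnf (v ++ v') (.choice α β) :=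
  (Describes.append h h').congr fun M u w => by rw [Prog.Rel]

theorem IsDnf.neg (h : IsDnf v (.test φ)) : IsDnf v.neg (.test (.neg φ)) :=
  (Describes.neg h).congr fun M u w => by simp [Prog.Rel, Form.Holds]

theorem IsDnf.and (h : IsDnf v (.test φ)) (h' : IsDnf v' (.test ψ)) :
    IsDnf (v.seq v') (.test (.and φ ψ)) :=
  (Describes.seq h h').congr fun M u w => by
    simp only [Prog.Rel, Form.Holds]
    constructor
    · rintro ⟨x, ⟨rfl, h1⟩, rfl, h2⟩
      exact ⟨rfl, h1, h2⟩
    · rintro ⟨rfl, h1, h2⟩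
      exact ⟨_, ⟨rfl, h1⟩, rfl, h2⟩

/-- A box holds when no transition of the program can be followed by the test of the negated body.
-/
theorem IsDnf.box (h : IsDnf v α) (h' : IsDnf v' (.test φ)) :
    IsDnf (v.seq v'.neg).neg (.test (.box α φ)) :=
  (Describes.seq h h'.neg).neg.congr fun M u w => by
    simp only [Prog.Rel, Form.Holds]
    refine and_congr_right fun _ => ?_
    constructor
    · intro h1 x hx
      by_contra h2
      exact h1 x ⟨x, hx, rfl, h2⟩
    · rintro h1 _ ⟨x, hx, rfl, h2⟩
      exact h2 (h1 x hx)

theorem isDnf_atom (p : Atom N) :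
    IsDnf [([(true, .inl (Nat.bits p.1), 0)], 0)] (.test (.atom p) : Prog (Atom N) (Fin n)) :=
  (describes_singleton _ _).congr fun M u w => by
    simp only [Prog.Rel, Form.Holds, sat_cons, AtomicHolds, Offset.vec_zero, add_zero, iff_true]
    rw [and_comm, eq_comm]
    simp [Sat, pullModel]

theorem isDnf_here (i : Fin n) :
    IsDnf [([(true, .inr i, 0)], 0)] (.test (.here i) : Prog (Atom N) (Fin n)) :=
  (describes_singleton _ _).congr fun M u w => by
    simp only [Prog.Rel, Form.Holds, sat_cons, AtomicHolds, Offset.vec_zero, add_zero, iff_true]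
    rw [and_comm, eq_comm]
    simp [Sat, pullModel]

theorem isDnf_of_forall (d : Offset)
    (h : ∀ M u w, α.Rel M u w ↔ w = u + d.vec) : IsDnf [([], d)] α :=
  (describes_singleton _ _).congr fun M u w => by simp [Sat, h]

theorem isDnf_up : IsDnf [([], ((0, 0), (1, 0)))] (.up : Prog (Atom N) (Fin n)) :=
  isDnf_of_forall _ fun M u w => by simp [Prog.Rel, Offset.vec, Prod.ext_iff]

theorem isDnf_down : IsDnf [([], ((0, 0), (0, 1)))] (.down : Prog (Atom N) (Fin n)) :=
  isDnf_of_forall _ fun M u w => by simp [Prog.Rel, Offset.vec, Prod.ext_iff, sub_eq_add_neg]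

theorem isDnf_right : IsDnf [([], ((1, 0), (0, 0)))] (.right : Prog (Atom N) (Fin n)) :=
  isDnf_of_forall _ fun M u w => by simp [Prog.Rel, Offset.vec, Prod.ext_iff]

theorem isDnf_left : IsDnf [([], ((0, 1), (0, 0)))] (.left : Prog (Atom N) (Fin n)) :=
  isDnf_of_forall _ fun M u w => by simp [Prog.Rel, Offset.vec, Prod.ext_iff, sub_eq_add_neg]

theorem IsDnf.total_iff_valid (h : IsDnf v (.test φ)) : v.Total ↔ φ.Valid := by
  rw [Dnf.total_iff h]
  constructor
  · intro h1 M u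
    obtain ⟨M, rfl⟩ := exists_pullModel_eq M
    obtain ⟨w, hw⟩ := h1 M u
    exact hw.2
  · exact fun h1 M u => ⟨u, rfl, h1 _ u⟩

end IsDnf

/-! ### Parsing -/

/-- A stack of normal forms; the flag distinguishes formulas from programs. -/
abbrev DnfStack (n : ℕ) : Type := List (Bool × Dnf n)

/-- Replace the topmost entry. -/
def popOne (t : Bool) (f : Dnf n → Bool × Dnf n) (k : DnfStack n) : Option (DnfStack n) :=
  k.head?.bind fun x => if x.1 = t then some (f x.2 :: k.tail) else none

/-- Replace the two topmost entries. -/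
def popTwo (t t' : Bool) (f : Dnf n → Dnf n → Bool × Dnf n) (k : DnfStack n) :
    Option (DnfStack n) :=
  k.head?.bind fun x => k.tail.head?.bind fun y =>
    if x.1 = t ∧ y.1 = t' then some (f x.2 y.2 :: k.tail.tail) else none

theorem popOne_eq_some {t : Bool} {f : Dnf n → Bool × Dnf n} {k k' : DnfStack n}
    (h : popOne t f k = some k') : ∃ v r, k = (t, v) :: r ∧ k' = f v :: r := by
  rcases k with _ | ⟨⟨t', v⟩, r⟩
  · simp [popOne] at h
  · simp only [popOne, List.head?_cons, Option.bind_some, List.tail_cons] at h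
    split_ifs at h with h1
    subst h1
    exact ⟨v, r, rfl, (Option.some.inj h).symm⟩

theorem popTwo_eq_some {t t' : Bool} {f : Dnf n → Dnf n → Bool × Dnf n} {k k' : DnfStack n}
    (h : popTwo t t' f k = some k') :
    ∃ v v' r, k = (t, v) :: (t', v') :: r ∧ k' = f v v' :: r := by
  rcases k with _ | ⟨⟨s, v⟩, _ | ⟨⟨s', v'⟩, r⟩⟩
  · simp [popTwo] at h
  · simp [popTwo] at h
  · simp only [popTwo, List.head?_cons, Option.bind_some, List.tail_cons] at h
    split_ifs at h with h1
    obtain ⟨rfl, rfl⟩ := h1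
    exact ⟨v, v', r, rfl, (Option.some.inj h).symm⟩

/-- The effect of a symbol on the stack, when the string is read from right to left. -/
def stackOp : Sym n → DnfStack n → Option (DnfStack n)
  | .inl .up => fun k => some ((false, [([], ((0, 0), (1, 0)))]) :: k)
  | .inl .down => fun k => some ((false, [([], ((0, 0), (0, 1)))]) :: k)
  | .inl .right => fun k => some ((false, [([], ((1, 0), (0, 0)))]) :: k)
  | .inl .left => fun k => some ((false, [([], ((0, 1), (0, 0)))]) :: k)
  | .inl .seq => popTwo false false fun v v' => (false, v.seq v')
  | .inl .choice => popTwo false false fun v v' => (false, v ++ v')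
  | .inl .test => popOne true fun v => (false, v)
  | .inl .neg => popOne true fun v => (true, v.neg)
  | .inl .and => popTwo true true fun v v' => (true, v.seq v')
  | .inl .box => popTwo false true fun v v' => (true, (v.seq v'.neg).neg)
  | .inr i => fun k => some ((true, [([(true, .inr i, 0)], 0)]) :: k)
  | _ => fun _ => none

/-- The effect of a symbol on the binary digits read last and the stack. -/
def parseStep (ok : List Bool → Bool) (s : Sym n) (st : List Bool × DnfStack n) :
    Option (List Bool × DnfStack n) :=
  if s = .inl .zero then some (false :: st.1, st.2)
  else if s = .inl .one then some (true :: st.1, st.2)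
  else if s = .inl .atom then
    if ok st.1 = true then some ([], (true, [([(true, .inl st.1, 0)], 0)]) :: st.2) else none
  else if st.1 = [] then (stackOp s st.2).map fun k => ([], k) else none

/-- The result of reading a string from right to left. -/
def parse (ok : List Bool → Bool) (s : List (Sym n)) (st : Option (List Bool × DnfStack n)) :
    Option (List Bool × DnfStack n) :=
  s.foldr (fun s st => st.bind (parseStep ok s)) st

theorem parse_append (ok : List Bool → Bool) (s s' : List (Sym n)) (st) :
    parse ok (s ++ s') st = parse ok s (parse ok s' st) := List.foldr_append

theorem parse_cons (ok : List Bool → Bool) (s : Sym n) (s' : List (Sym n)) (st) :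
    parse ok (s :: s') st = (parse ok s' st).bind (parseStep ok s) := rfl

theorem parse_bits (ok : List Bool → Bool) (bs bs' : List Bool) (k : DnfStack n) :
    parse ok (bs.map fun b => .inl (Tok.bit b)) (some (bs', k)) = some (bs ++ bs', k) := by
  induction bs with
  | nil => rfl
  | cons b bs ih =>
    rw [List.map_cons, parse_cons, ih]
    cases b <;> simp [parseStep, Tok.bit]

/-- Read from right to left, prefix notation delivers the operands before the operator, so a stack
suffices. The normal form must not depend on the stack `k` below it, for then the claims for the
parts compose. -/
theorem parse_encode {N : ℕ∞} {ok : List Bool → Bool}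
    (hok : ∀ bs, ok bs = true ↔ ∃ p : Atom N, Nat.bits p.1 = bs) (φ : Form (Atom N) (Fin n))
    (hφ : φ.StarFree) : ∃ v : Dnf n, IsDnf v (.test φ) ∧
      ∀ k, parse ok φ.encode (some ([], k)) = some ([], (true, v) :: k) := by
  induction φ using Form.rec (motive_1 := fun α => α.StarFree → ∃ v : Dnf n, IsDnf v α ∧
      ∀ k, parse ok α.encode (some ([], k)) = some ([], (false, v) :: k)) with
  | atom p =>
    refine ⟨_, isDnf_atom p, fun k => ?_⟩
    rw [Form.encode, parse_cons, parse_bits]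
    simp [parseStep, (hok _).2 ⟨p, rfl⟩]
  | here i => exact ⟨_, isDnf_here i, fun k => by
      simp [Form.encode, parse, parseStep, stackOp]⟩
  | neg φ ih =>
    obtain ⟨v, h1, h2⟩ := ih hφ
    exact ⟨_, h1.neg, fun k => by
      simp [Form.encode, parse_cons, h2, parseStep, stackOp, popOne]⟩
  | and φ ψ ih ih' =>
    obtain ⟨v, h1, h2⟩ := ih hφ.1
    obtain ⟨v', h1', h2'⟩ := ih' hφ.2
    exact ⟨_, h1.and h1', fun k => by
      simp [Form.encode, parse_cons, parse_append, h2, h2', parseStep, stackOp, popTwo]⟩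
  | box α φ ih ih' =>
    obtain ⟨v, h1, h2⟩ := ih hφ.1
    obtain ⟨v', h1', h2'⟩ := ih' hφ.2
    exact ⟨_, h1.box h1', fun k => by
      simp [Form.encode, parse_cons, parse_append, h2, h2', parseStep, stackOp, popTwo]⟩
  | up => exact ⟨_, isDnf_up, fun k => by simp [Prog.encode, parse, parseStep, stackOp]⟩
  | down =>
    exact ⟨_, isDnf_down, fun k => by simp [Prog.encode, parse, parseStep, stackOp]⟩
  | right =>
    exact ⟨_, isDnf_right, fun k => by simp [Prog.encode, parse, parseStep, stackOp]⟩
  | left =>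
    exact ⟨_, isDnf_left, fun k => by simp [Prog.encode, parse, parseStep, stackOp]⟩
  | seq α β ih ih' hα =>
    obtain ⟨v, h1, h2⟩ := ih hα.1
    obtain ⟨v', h1', h2'⟩ := ih' hα.2
    exact ⟨_, h1.seq h1', fun k => by
      simp [Prog.encode, parse_cons, parse_append, h2, h2', parseStep, stackOp, popTwo]⟩
  | choice α β ih ih' hα =>
    obtain ⟨v, h1, h2⟩ := ih hα.1
    obtain ⟨v', h1', h2'⟩ := ih' hα.2
    exact ⟨_, h1.choice h1', fun k => by
      simp [Prog.encode, parse_cons, parse_append, h2, h2', parseStep, stackOp, popTwo]⟩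
  | iter α _ hα => exact hα.elim
  | test φ ih hφ =>
    obtain ⟨v, h1, h2⟩ := ih hφ
    exact ⟨v, h1, fun k => by
      simp [Prog.encode, parse_cons, h2, parseStep, stackOp, popOne]⟩

/-- The string consists of the star-free programs and formulas whose normal forms are on the
stack. -/
inductive Parsed (N : ℕ∞) {n : ℕ} : List (Sym n) → DnfStack n → Prop
  | nil : Parsed N [] []
  | prog {s k v} (α : Prog (Atom N) (Fin n)) (h : α.StarFree) (hv : IsDnf v α) :
      Parsed N s k → Parsed N (α.encode ++ s) ((false, v) :: k)
  | form {s k v} (φ : Form (Atom N) (Fin n)) (h : φ.StarFree) (hv : IsDnf v (.test φ)) :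
      Parsed N s k → Parsed N (φ.encode ++ s) ((true, v) :: k)

/-- This gives the converse of parsing: a stack operation succeeds only if the flags on the stack
match, and then the symbol joins the corresponding expressions into a larger one. -/
theorem Parsed.of_stackOp {N : ℕ∞} {s : List (Sym n)} {k k' : DnfStack n} (h : Parsed N s k)
    (t : Sym n) (hk : stackOp t k = some k') : Parsed N (t :: s) k' := by
  rcases t with t | i
  · cases t with
    | up => cases hk; simpa [Prog.encode] using h.prog .up trivial isDnf_up
    | down => cases hk; simpa [Prog.encode] using h.prog .down trivial isDnf_down
    | right => cases hk; simpa [Prog.encode] using h.prog .right trivial isDnf_right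
    | left => cases hk; simpa [Prog.encode] using h.prog .left trivial isDnf_left
    | seq =>
      obtain ⟨v, v', r, rfl, rfl⟩ := popTwo_eq_some (by simpa only [stackOp] using hk)
      obtain _ | ⟨α, hα, hv, _ | ⟨β, hβ, hv', h⟩⟩ := h
      simpa [Prog.encode] using h.prog (.seq α β) ⟨hα, hβ⟩ (hv.seq hv')
    | choice =>
      obtain ⟨v, v', r, rfl, rfl⟩ := popTwo_eq_some (by simpa only [stackOp] using hk)
      obtain _ | ⟨α, hα, hv, _ | ⟨β, hβ, hv', h⟩⟩ := h
      simpa [Prog.encode] using h.prog (.choice α β) ⟨hα, hβ⟩ (hv.choice hv')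
    | test =>
      obtain ⟨v, r, rfl, rfl⟩ := popOne_eq_some (by simpa only [stackOp] using hk)
      obtain _ | _ | ⟨φ, hφ, hv, h⟩ := h
      simpa [Prog.encode] using h.prog (.test φ) hφ hv
    | neg =>
      obtain ⟨v, r, rfl, rfl⟩ := popOne_eq_some (by simpa only [stackOp] using hk)
      obtain _ | _ | ⟨φ, hφ, hv, h⟩ := h
      simpa [Form.encode] using h.form (.neg φ) hφ hv.neg
    | and =>
      obtain ⟨v, v', r, rfl, rfl⟩ := popTwo_eq_some (by simpa only [stackOp] using hk)
      obtain _ | _ | ⟨φ, hφ, hv, _ | _ | ⟨ψ, hψ, hv', h⟩⟩ := h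
      simpa [Form.encode] using h.form (.and φ ψ) ⟨hφ, hψ⟩ (hv.and hv')
    | box =>
      obtain ⟨v, v', r, rfl, rfl⟩ := popTwo_eq_some (by simpa only [stackOp] using hk)
      obtain _ | ⟨α, hα, hv, _ | _ | ⟨φ, hφ, hv', h⟩⟩ := h
      simpa [Form.encode] using h.form (.box α φ) ⟨hα, hφ⟩ (hv.box hv')
    | iter => cases hk
    | atom => cases hk
    | zero => cases hk
    | one => cases hk
  · cases hk
    simpa [Form.encode] using h.form (.here i) trivial (isDnf_here i)

/-- The digits held in the parser's state are those at the front of the string not yet claimed by an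
atom symbol; what follows them is already a sequence of complete expressions. -/
theorem exists_parsed {N : ℕ∞} {ok : List Bool → Bool}
    (hok : ∀ bs, ok bs = true ↔ ∃ p : Atom N, Nat.bits p.1 = bs) (s : List (Sym n))
    {bs : List Bool} {k : DnfStack n} (h : parse ok s (some ([], [])) = some (bs, k)) :
    ∃ r, s = bs.map (fun b => .inl (Tok.bit b)) ++ r ∧ Parsed N r k := by
  induction s generalizing bs k with
  | nil =>
    cases h
    exact ⟨[], rfl, .nil⟩
  | cons t s ih =>
    rw [parse_cons, Option.bind_eq_some_iff] at h
    obtain ⟨⟨bs', k'⟩, h1, h2⟩ := h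
    obtain ⟨r, rfl, hr⟩ := ih h1
    simp only [parseStep] at h2
    split_ifs at h2 with e1 e2 e3 e4 e5
    · subst e1; cases h2
      exact ⟨r, by simp [Tok.bit], hr⟩
    · subst e2; cases h2
      exact ⟨r, by simp [Tok.bit], hr⟩
    · subst e3; cases h2
      obtain ⟨p, rfl⟩ := (hok _).1 e4
      exact ⟨_, rfl, by simpa [Form.encode] using hr.form (.atom p) trivial (isDnf_atom p)⟩
    · subst e5
      obtain ⟨k'', h3, h4⟩ := Option.map_eq_some_iff.1 h2
      cases h4
      exact ⟨_, rfl, by simpa using hr.of_stackOp t h3⟩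

/-- The normal form of a string that is a formula. -/
def parseResult (st : List Bool × DnfStack n) : Option (Dnf n) :=
  if st.1 = [] ∧ st.2.tail = [] then
    st.2.head?.bind fun x => if x.1 = true then some x.2 else none
  else none

theorem parseResult_eq_some {st : List Bool × DnfStack n} {v : Dnf n} :
    parseResult st = some v ↔ st = ([], [(true, v)]) := by
  obtain ⟨bs, k⟩ := st
  rcases k with _ | ⟨⟨t, v'⟩, _ | ⟨y, r⟩⟩
  · simp [parseResult]
  · cases t <;> simp [parseResult]
  · simp [parseResult]

theorem mem_DLS1_iff {N : ℕ∞} {ok : List Bool → Bool}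
    (hok : ∀ bs, ok bs = true ↔ ∃ p : Atom N, Nat.bits p.1 = bs) (s : List (Sym n)) :
    s ∈ DLS1 N n ↔ ∃ v ∈ ((parse ok s (some ([], []))).bind parseResult).toList, v.Total := by
  constructor
  · rintro ⟨φ, hφ, hv, rfl⟩
    obtain ⟨v, h1, h2⟩ := parse_encode hok φ hφ
    refine ⟨v, ?_, h1.total_iff_valid.2 hv⟩
    rw [h2]
    simp [parseResult_eq_some]
  · rintro ⟨v, h1, h2⟩
    rw [Option.mem_toList, Option.bind_eq_some_iff] at h1
    obtain ⟨st, h3, h4⟩ := h1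
    rw [parseResult_eq_some] at h4
    subst h4
    obtain ⟨r, rfl, h⟩ := exists_parsed hok s h3
    obtain _ | _ | ⟨φ, hφ, hv, _ | _ | _⟩ := h
    exact ⟨φ, hφ, hv.total_iff_valid.1 h2, by simp⟩

end SpatialLogic

namespace SpatialLogic

variable {n : ℕ}

/-! ### Computability -/

section Primrec

open Primrec

/-- A case distinction over the finitely many first arguments. It lets the parser step be treated
separately for each symbol. -/
theorem primrec₂_of_finite {α β σ : Type} [Finite α] [Primcodable α] [Primcodable β]
    [Primcodable σ] {f : α → β → σ} (h : ∀ a, Primrec (f a)) : Primrec₂ f := by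
  classical
  cases nonempty_fintype α
  have key : ∀ l : List α,
      Primrec fun q : α × β => if q.1 ∈ l then some (f q.1 q.2) else none := by
    intro l
    induction l with
    | nil => simpa using Primrec.const none
    | cons a l ih =>
      refine (Primrec.ite (Primrec.eq.comp fst (Primrec.const a))
        (option_some.comp ((h a).comp snd)) ih).of_eq fun q => ?_
      by_cases hq : q.1 = a
      · simp [hq]
      · simp [hq]
  refine Primrec.option_some_iff.1 ((key Finset.univ.toList).of_eq fun q => ?_)
  simp

theorem primrec₂_offset_add : Primrec₂ ((· + ·) : Offset → Offset → Offset) :=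
  ((nat_add.comp (fst.comp (fst.comp fst)) (fst.comp (fst.comp snd))).pair
    (nat_add.comp (snd.comp (fst.comp fst)) (snd.comp (fst.comp snd)))).pair
  ((nat_add.comp (fst.comp (snd.comp fst)) (fst.comp (snd.comp snd))).pair
    (nat_add.comp (snd.comp (snd.comp fst)) (snd.comp (snd.comp snd))))

theorem primrecRel_same : PrimrecRel Offset.Same :=
  PrimrecPred.and
    (Primrec.eq.comp
      (nat_add.comp (fst.comp (fst.comp fst)) (snd.comp (fst.comp snd)))
      (nat_add.comp (fst.comp (fst.comp snd)) (snd.comp (fst.comp fst))))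
    (Primrec.eq.comp
      (nat_add.comp (fst.comp (snd.comp fst)) (snd.comp (snd.comp snd)))
      (nat_add.comp (fst.comp (snd.comp snd)) (snd.comp (snd.comp fst))))

theorem primrec_isRight {α β : Type} [Primcodable α] [Primcodable β] :
    Primrec (Sum.isRight : α ⊕ β → Bool) :=
  (sumCasesOn Primrec.id (Primrec₂.const false) (Primrec₂.const true)).of_eq fun x => by
    cases x <;> rfl

theorem primrecRel_conflict : PrimrecRel (Conflict (n := n)) := by
  have hs : PrimrecPred fun q : Lit n × Lit n => q.1.2.2.Same q.2.2.2 :=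
    primrecRel_same.comp (snd.comp (snd.comp fst)) (snd.comp (snd.comp snd))
  have hb : ∀ {f : Lit n × Lit n → Bool}, Primrec f → PrimrecPred fun q => f q = true :=
    fun hf => Primrec.eq.comp hf (Primrec.const true)
  exact PrimrecPred.and (Primrec.eq.comp (fst.comp (snd.comp fst)) (fst.comp (snd.comp snd)))
    (PrimrecPred.or
      (hs.and (Primrec.eq.comp (fst.comp fst) (fst.comp snd)).not)
      (((hb (primrec_isRight.comp (fst.comp (snd.comp fst)))).and
        ((hb (fst.comp fst)).and (hb (fst.comp snd)))).and hs.not))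

set_option synthInstance.maxSize 1000 in
set_option synthInstance.maxHeartbeats 200000 in
theorem primrec₂_seq : Primrec₂ (Dnf.seq (n := n)) := by
  refine list_flatMap fst (list_map (snd.comp fst) ?_)
  have hc : Primrec fun q : ((Dnf n × Dnf n) × List (Lit n) × Offset) × List (Lit n) × Offset =>
    q.1.2 := snd.comp fst
  refine Primrec.pair (list_append.comp (fst.comp hc) (list_map (fst.comp snd) ?_))
    (primrec₂_offset_add.comp (snd.comp hc) (snd.comp snd))
  exact (fst.comp snd).pair ((fst.comp (snd.comp snd)).pair
    (primrec₂_offset_add.comp (snd.comp (hc.comp fst)) (snd.comp (snd.comp snd))))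

set_option synthInstance.maxSize 1000 in
set_option synthInstance.maxHeartbeats 200000 in
theorem primrec_neg : Primrec (Dnf.neg (n := n)) := by
  refine list_foldr (h := fun (_ : Dnf n) (q : (List (Lit n) × Offset) × Dnf n) =>
    q.1.1.flatMap fun l => q.2.map fun c' => ((!l.1, l.2) :: c'.1, c'.2))
    Primrec.id (Primrec.const [([], 0)]) ?_
  refine list_flatMap (fst.comp (fst.comp snd)) (list_map (snd.comp (snd.comp fst)) ?_)
  have hl : Primrec fun q : ((Dnf n × (List (Lit n) × Offset) × Dnf n) × Lit n) ×
    List (Lit n) × Offset => q.1.2 := snd.comp fst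
  exact (list_cons.comp ((Primrec.not.comp (fst.comp hl)).pair (snd.comp hl))
    (fst.comp snd)).pair (snd.comp snd)

/-- Only quantifiers bounded by lists occur, over the negated clauses and over their literals. -/
theorem primrecPred_total : PrimrecPred (Dnf.Total (n := n)) := by
  have h1 : PrimrecRel fun (c : List (Lit n)) l => ∃ l' ∈ c, Conflict l' l :=
    primrecRel_conflict.exists_mem_list
  have h2 : PrimrecRel fun (c c' : List (Lit n)) => ∃ l ∈ c, ∃ l' ∈ c', Conflict l' l :=
    PrimrecRel.exists_mem_list h1.swap
  have h3 : PrimrecPred fun c : List (Lit n) × Offset => ∃ l ∈ c.1, ∃ l' ∈ c.1, Conflict l' l :=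
    h2.comp fst fst
  exact h3.forall_mem_list.comp primrec_neg

theorem primrec_popOne {t : Bool} {f : Dnf n → Bool × Dnf n} (hf : Primrec f) :
    Primrec (popOne t f) :=
  option_bind list_head? (Primrec.ite (Primrec.eq.comp (fst.comp snd) (Primrec.const t))
    (option_some.comp (list_cons.comp (hf.comp (snd.comp snd)) (list_tail.comp fst)))
    (Primrec.const none))

theorem primrec_popTwo {t t' : Bool} {f : Dnf n → Dnf n → Bool × Dnf n} (hf : Primrec₂ f) :
    Primrec (popTwo t t' f) :=
  option_bind list_head? (option_bind (list_head?.comp (list_tail.comp fst))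
    (Primrec.ite ((Primrec.eq.comp (fst.comp (snd.comp fst)) (Primrec.const t)).and
        (Primrec.eq.comp (fst.comp snd) (Primrec.const t')))
      (option_some.comp (list_cons.comp (hf.comp (snd.comp (snd.comp fst)) (snd.comp snd))
        (list_tail.comp (list_tail.comp (fst.comp fst)))))
      (Primrec.const none)))

theorem primrec_stackOp (s : Sym n) : Primrec (stackOp s) := by
  have hpush : ∀ x : Bool × Dnf n, Primrec fun k : DnfStack n => some (x :: k) := fun x =>
    option_some.comp (list_cons.comp (Primrec.const x) Primrec.id)
  rcases s with t | i
  · cases t with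
    | up => exact hpush _
    | down => exact hpush _
    | right => exact hpush _
    | left => exact hpush _
    | seq =>
      exact primrec_popTwo (f := fun v v' => (false, v.seq v'))
        ((Primrec.const false).pair primrec₂_seq)
    | choice =>
      exact primrec_popTwo (f := fun v v' => (false, v ++ v'))
        ((Primrec.const false).pair list_append)
    | test => exact primrec_popOne ((Primrec.const false).pair Primrec.id)
    | neg => exact primrec_popOne ((Primrec.const true).pair primrec_neg)
    | and =>
      exact primrec_popTwo (f := fun v v' => (true, v.seq v'))
        ((Primrec.const true).pair primrec₂_seq)
    | box =>
      exact primrec_popTwo (f := fun v v' => (true, (v.seq v'.neg).neg)) ((Primrec.const true).pair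
        (primrec_neg.comp (primrec₂_seq.comp fst (primrec_neg.comp snd))))
    | iter => exact Primrec.const none
    | atom => exact Primrec.const none
    | zero => exact Primrec.const none
    | one => exact Primrec.const none
  · exact hpush _

theorem primrec_parseStep {ok : List Bool → Bool} (hok : Primrec ok) (s : Sym n) :
    Primrec (parseStep ok s) := by
  have hs : ∀ t : Sym n, PrimrecPred fun _ : List Bool × DnfStack n => s = t := fun t =>
    Primrec.eq.comp (Primrec.const s) (Primrec.const t)
  have hlit : Primrec fun bs : List Bool => ((true, .inl bs, 0) : Lit n) :=
    (Primrec.const true).pair (sumInl.pair (Primrec.const 0))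
  have hdnf : Primrec fun bs : List Bool => ([([(true, .inl bs, 0)], 0)] : Dnf n) :=
    list_cons.comp ((list_cons.comp hlit (Primrec.const [])).pair (Primrec.const 0))
      (Primrec.const [])
  refine Primrec.ite (hs _)
    (option_some.comp ((list_cons.comp (Primrec.const false) fst).pair snd)) ?_
  refine Primrec.ite (hs _)
    (option_some.comp ((list_cons.comp (Primrec.const true) fst).pair snd)) ?_
  refine Primrec.ite (hs _) ?_ ?_
  · refine Primrec.ite (Primrec.eq.comp (hok.comp fst) (Primrec.const true)) ?_ (Primrec.const none)
    exact option_some.comp ((Primrec.const []).pair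
      (list_cons.comp ((Primrec.const true).pair (hdnf.comp fst)) snd))
  · refine Primrec.ite (Primrec.eq.comp fst (Primrec.const [])) ?_ (Primrec.const none)
    exact option_map ((primrec_stackOp s).comp snd) ((Primrec.const []).pair snd)

theorem primrec_parseResult : Primrec (parseResult (n := n)) := by
  refine Primrec.ite ((Primrec.eq.comp fst (Primrec.const [])).and
    (Primrec.eq.comp (list_tail.comp snd) (Primrec.const []))) ?_ (Primrec.const none)
  exact option_bind (list_head?.comp snd) (Primrec.ite
    (Primrec.eq.comp (fst.comp snd) (Primrec.const true))
    (option_some.comp (snd.comp snd)) (Primrec.const none))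

theorem primrec_parse {ok : List Bool → Bool} (hok : Primrec ok) :
    Primrec fun s : List (Sym n) => parse ok s (some ([], [])) := by
  refine list_foldr (h := fun (_ : List (Sym n)) (q : Sym n × Option (List Bool × DnfStack n)) =>
    q.2.bind (parseStep ok q.1)) Primrec.id (Primrec.const (some ([], []))) ?_
  refine option_bind (snd.comp snd) ?_
  have h : Primrec₂ (parseStep (n := n) ok) := primrec₂_of_finite (primrec_parseStep hok)
  exact h.comp (fst.comp (snd.comp fst)) snd

/-- The binary representations of the indices of atomic propositions can be recognized. -/
theorem exists_primrec_isIndex (N : ℕ∞) : ∃ ok : List Bool → Bool, Primrec ok ∧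
    ∀ bs, ok bs = true ↔ ∃ p : Atom N, Nat.bits p.1 = bs := by
  cases N with
  | top =>
    refine ⟨fun bs => decide ((true :: bs).reverse.head? = some true),
      PrimrecPred.decide <| Primrec.eq.comp (list_head?.comp (list_reverse.comp
        (list_cons.comp (Primrec.const true) Primrec.id))) (Primrec.const (some true)),
      fun bs => ?_⟩
    rw [decide_eq_true_eq, List.head?_reverse]
    constructor
    · intro h
      obtain ⟨k, hk⟩ := exists_bits_eq h
      exact ⟨⟨k, by simp⟩, hk⟩
    · rintro ⟨p, rfl⟩
      rw [List.getLast?_eq_some_getLast (by simp), Layout.getLast_true_cons_bits]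
  | coe N =>
    have h : PrimrecPred fun bs : List Bool => ∃ bs' ∈ (List.range N).map Nat.bits, bs' = bs :=
      (PrimrecRel.exists_mem_list (Primrec.eq (α := List Bool))).comp (Primrec.const _) Primrec.id
    classical
    refine ⟨_, h.decide, fun bs => ?_⟩
    rw [decide_eq_true_eq]
    simp only [List.mem_map, List.mem_range]
    constructor
    · rintro ⟨_, ⟨k, hk, rfl⟩, rfl⟩
      exact ⟨⟨k, by exact_mod_cast hk⟩, rfl⟩
    · rintro ⟨⟨k, hk⟩, rfl⟩
      exact ⟨_, ⟨k, by exact_mod_cast hk, rfl⟩, rfl⟩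

end Primrec

theorem primrecPred_DLS1 (N : ℕ∞) (n : ℕ) : PrimrecPred fun s : List (Sym n) => s ∈ DLS1 N n := by
  obtain ⟨ok, h1, h2⟩ := exists_primrec_isIndex N
  refine PrimrecPred.of_eq ?_ fun s => (mem_DLS1_iff h2 s).symm
  exact primrecPred_total.exists_mem_list.comp (Primrec.optionToList.comp
    (Primrec.option_bind (primrec_parse h1) (primrec_parseResult.comp Primrec.snd)))

/-- The symbols for programs that are not allowed in basic formulas. -/
def IsCompound (s : Sym n) : Prop := s = .inl .seq ∨ s = .inl .choice ∨ s = .inl .test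

/-- Each compound program shows its operator in the string, and star-freeness already rules out
iteration. Hence basicness is a condition on symbols, and no second parser is needed. -/
theorem basic_iff {N : ℕ∞} (φ : Form (Atom N) (Fin n)) :
    φ.Basic ↔ φ.StarFree ∧ ∀ s ∈ φ.encode, ¬ IsCompound s := by
  induction φ using Form.rec (motive_1 := fun _ => True) with
  | atom p =>
    simp only [Form.Basic, Form.StarFree, Form.encode, true_and, true_iff, List.mem_cons,
      List.mem_map]
    rintro _ (rfl | ⟨b, -, rfl⟩)
    · simp [IsCompound]
    · cases b <;> simp [IsCompound, Tok.bit]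
  | here i => simp [Form.Basic, Form.StarFree, Form.encode, IsCompound]
  | neg φ ih => simpa [Form.Basic, Form.StarFree, Form.encode, IsCompound] using ih
  | and φ ψ ih ih' =>
    rw [Form.Basic, Form.StarFree, Form.encode, ih, ih', List.forall_mem_cons,
      List.forall_mem_append]
    have : ¬ IsCompound (.inl .and : Sym n) := by simp [IsCompound]
    tauto
  | box α φ _ ih =>
    rw [Form.Basic, Form.StarFree, Form.encode, ih, List.forall_mem_cons, List.forall_mem_append]
    have h1 : ¬ IsCompound (.inl .box : Sym n) := by simp [IsCompound]
    have h2 : α.IsDirection ↔ α.StarFree ∧ ∀ s ∈ α.encode, ¬ IsCompound s := by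
      cases α <;> simp [Prog.IsDirection, Prog.StarFree, Prog.encode, IsCompound]
    tauto
  | _ => trivial

theorem mem_DLS0_iff {N : ℕ∞} (s : List (Sym n)) :
    s ∈ DLS0 N n ↔ s ∈ DLS1 N n ∧ ∀ t ∈ s, ¬ IsCompound t := by
  constructor
  · rintro ⟨φ, h1, h2, rfl⟩
    rw [basic_iff] at h1
    exact ⟨⟨φ, h1.1, h2, rfl⟩, h1.2⟩
  · rintro ⟨⟨φ, h1, h2, rfl⟩, h3⟩
    exact ⟨φ, (basic_iff φ).2 ⟨h1, h3⟩, h2, rfl⟩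

/-- The valid star-free formulas form a decidable set. -/
theorem isDecidable_DLS1 (N : ℕ∞) (n : ℕ) : IsDecidable (DLS1 N n) :=
  (primrecPred_DLS1 N n).computablePred

/-- The valid basic formulas form a decidable set. -/
theorem isDecidable_DLS0 (N : ℕ∞) (n : ℕ) : IsDecidable (DLS0 N n) := by
  classical
  have h : PrimrecPred fun t : Sym n => ¬ IsCompound t :=
    (Primrec.dom_finite fun t : Sym n => decide (¬ IsCompound t)).primrecPred
  exact (((primrecPred_DLS1 N n).and h.forall_mem_list).of_eq
    fun s => (mem_DLS0_iff s).symm).computablePred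

end SpatialLogic

theorem mainTheorem3 (N : ℕ∞) (n : ℕ) :
    SpatialLogic.IsDecidable (SpatialLogic.DLS0 N n) ∧
    SpatialLogic.IsDecidable (SpatialLogic.DLS1 N n) ∧
    SpatialLogic.InNP (SpatialLogic.SatDLS0 N n) := by
  exact ⟨SpatialLogic.isDecidable_DLS0 N n, SpatialLogic.isDecidable_DLS1 N n,
    SpatialLogic.inNP_satDLS0 N n⟩
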